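/- **Setting.** Let $n,m,d,T\ge 1$ and let $W=\{w_1,\dots,w_{|W|}\}\subset\mathbb R^d$ be a finite ordered set of actions that spans $\mathbb R^d$ and lies in the unit $\ell^2$-ball. Features $x\in\mathbb R^m$ have an arbitrary law $D_x$. For each action $w$ there is an unknown linear map $F_w:\mathbb R^m\to\mathbb R^d$, and the label of $x$ under $w$ is $c(w)=F_wx+\epsilon$, $\epsilon\sim\mathcal N(0,\sigma^2I_d)$. Using $w$ on $x$ costs $c(w)^\dagger w+\mu^\dagger w+\eta$, $\eta\sim\mathcal N(0,\sigma^2)$, with $\mu\in\mathbb R^d$ unknown; the two parts $c(w)^\dagger w$ and $\mu^\dagger w+\eta$ are both observed. All $(x,\epsilon,\eta)$ are independent across rounds and individuals, and $x,\epsilon,\eta$ are independent of each other. Assume $\|F_wx\|_1\le K_C$ for $D_x$-a.e. $x$ and all $w\in W$, and $|\mu^\dagger w|\le K_\mu$ for all $w\in W$. The regret $R_T$ is the expectation of the total cost, over rounds $1,\dots,T$ and the $n$ individuals of each round, minus the total cost of a policy $\pi$ for which $\pi(x)$ minimizes over $w\in W$ the expected cost given $x$. **Algorithm** (PROOF with a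 uniform exploration phase of length $\tilde T$, parameter $\gamma\in(0,1]$). Let $b_1,\dots,b_d\in W$ be a barycentric spanner of $W$: a basis of $\mathbb R^d$ in which every $w\in W$ has coordinates in $[-1,1]$. An initial dataset (round $0$) consists of $n$ independent samples labelled under arbitrary fixed actions. For each individual $i$ and round $t\ge1$, with $w_i^s$ the action taken and $u_{bi}^s=\mu^\dagger w_i^s+\eta_i^s$ the bandit part of the cost in round $s$, put $$A_i^t=\sum_{j=1}^d b_jb_j^\dagger+\sum_{1\le s<t}w_i^s(w_i^s)^\dagger,\qquad \hat\mu_i^t=(A_i^t)^{-1}\sum_{1\le s<t}u_{bi}^s\,w_i^s .$$ In rounds $1\le t\le\tilde T$ individual $i$ gets the action of index $nt+i$ modulo $|W|$. In rounds $t>\tilde T$, for each $w$ a linear predictor $\hat F^t_w$ is fit by ordinary least squares (any least-squares solution) to the training data collected under $w$, and individual $i$ gets $$w_i^t\in\arg\min_{w\in W}\ \min_{\nu\in B_i^t}(\hat F_w^tx_i^t+\nu)^\dagger w,\qquad B_i^t=\Big\{\nu:\sqrt{(\nu-\hat\mu_i^t)^\dagger A_i^t(\nu-\hat\mu_i^t)}\le\sqrt{\beta^t}\Big\},$$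 $$\beta^t=\max\Big(128\,d\log t\,\log\tfrac{nt^2}{\gamma},\ \big(\tfrac83\log\tfrac{nt^2}{\gamma}\big)^2\Big).$$ Ties are broken by any measurable rule that depends only on data available at that time. Two variants are considered: (a) *frozen*: the training data are those of rounds $0,\dots,\tilde T$; (b) *retraining*: at round $t$ the training data are those of rounds $0,\dots,t-1$. **Theorem.** Let $\tfrac12T^{2/3}(d|W|)^{1/3}\le\tilde T\le2\,T^{2/3}(d|W|)^{1/3}$. There are an absolute constant $p$ and a constant $C$ such that $$R_T\ \le\ C\,\Big(1+\log\frac{nT}{\gamma}\Big)^{p}\; n\,(d|W|)^{1/3}\,m^{1/2}\,T^{2/3},$$ that is, $R_T=\tilde O\big(n(d|W|)^{1/3}m^{1/2}T^{2/3}\big)$, the expectation that defines $R_T$ being well defined. In variant (a), $C$ depends only on $\sigma,K_C,K_\mu$. In variant (b) this holds if moreover $\|x\|_2\le K_X$ for $D_x$-a.e. $x$ and all eigenvalues of $\mathbb E_{x\sim D_x}[xx^\dagger]$ are at least $\kappa>0$, and $C$ then depends only on $\sigma,K_C,K_\mu,K_X,\kappa$. -/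

import Mathlib

open MeasureTheory ProbabilityTheory
open scoped NNReal

noncomputable section

namespace BanditDDO

/-- Column vectors with the Euclidean norm. -/
abbrev Vec (n : ℕ) := EuclideanSpace ℝ (Fin n)

/-- A bandit data-driven optimization problem with `k` actions `act 0, …, act (k - 1)` in `ℝ^d`,
features in `ℝ^m` of law `D`, action-specific linear label model `c = F a x + ε`,
`ε ∼ N(0, σ² I)`, known cost `c† w` and unknown cost `μ† w` observed with `N(0, σ²)` noise. -/
structure Problem (m d k : ℕ) where
  act : Fin k → Vec d
  F : Fin k → Vec m →L[ℝ] Vec d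
  μ : Vec d
  D : Measure (Vec m)
  σ : ℝ≥0

/-- Joint law of the label noise `ε ∼ N(0, σ² I)` and of the independent cost noise
`η ∼ N(0, σ²)`. -/
def Problem.noiseLaw {m d k : ℕ} (I : Problem m d k) : Measure (Vec d × ℝ) :=
  (multivariateGaussian 0 ((I.σ : ℝ) ^ 2 • (1 : Matrix (Fin d) (Fin d) ℝ))).prod
    (gaussianReal 0 (I.σ ^ 2))

/-- Law of one sample `(x, ε, η)`. -/
def Problem.sampleLaw {m d k : ℕ} (I : Problem m d k) : Measure (Vec m × Vec d × ℝ) :=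
  I.D.prod I.noiseLaw

/-- The label of the sample `z = (x, ε, η)` under action `a`. -/
def Problem.label {m d k : ℕ} (I : Problem m d k) (a : Fin k) (z : Vec m × Vec d × ℝ) : Vec d :=
  I.F a z.1 + z.2.1

/-- The bandit part `μ† w + η` of the cost. -/
def Problem.banditCost {m d k : ℕ} (I : Problem m d k) (a : Fin k) (z : Vec m × Vec d × ℝ) : ℝ :=
  inner ℝ I.μ (I.act a) + z.2.2

/-- The cost `u = c(w)† w + μ† w + η` of action `a` on the sample `z = (x, ε, η)`. -/
def Problem.cost {m d k : ℕ} (I : Problem m d k) (a : Fin k) (z : Vec m × Vec d × ℝ) : ℝ :=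
  inner ℝ (I.label a z) (I.act a) + I.banditCost a z

/-- Expected cost of action `a` given the feature `x`. -/
def Problem.expectedCost {m d k : ℕ} (I : Problem m d k) (x : Vec m) (a : Fin k) : ℝ :=
  ∫ e, I.cost a (x, e) ∂I.noiseLaw

/-- `π x` minimizes the expected cost given the feature `x`. -/
structure Problem.IsOptimalPolicy {m d k : ℕ} (I : Problem m d k) (π : Vec m → Fin k) : Prop where
  measurable : Measurable π
  le : ∀ x a, I.expectedCost x (π x) ≤ I.expectedCost x a

/-- The standing boundedness assumptions: distinct actions in the unit `ℓ²`-ball, mean labels of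
`ℓ¹`-norm at most `KC`, unknown costs of the actions at most `Kμ` in absolute value. -/
structure Problem.IsBounded {m d k : ℕ} (I : Problem m d k) (KC Kμ : ℝ) : Prop where
  act_injective : Function.Injective I.act
  norm_act_le : ∀ a, ‖I.act a‖ ≤ 1
  isProbabilityMeasure : IsProbabilityMeasure I.D
  mean_le : ∀ᵐ x ∂I.D, ∀ a, ∑ j, |I.F a x j| ≤ KC
  unknown_le : ∀ a, |inner ℝ I.μ (I.act a)| ≤ Kμ

/-- Features bounded by `KX`, with second moment matrix bounded below by `κ I`. -/
structure IsRegularDesign {m : ℕ} (D : Measure (Vec m)) (KX κ : ℝ) : Prop where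
  norm_le : ∀ᵐ x ∂D, ‖x‖ ≤ KX
  le_secondMoment : ∀ v : Vec m, κ * ‖v‖ ^ 2 ≤ ∫ x, (inner ℝ x v : ℝ) ^ 2 ∂D

/-- `b` is a barycentric spanner of the set of vectors `act 0, …, act (k - 1)`, which spans
`ℝ^d`. -/
structure IsBarycentricSpanner {d k : ℕ} (act : Fin k → Vec d) (b : Fin d → Vec d) : Prop where
  mem : ∀ j, b j ∈ Set.range act
  linearIndependent : LinearIndependent ℝ b
  exists_coeff : ∀ a, ∃ r : Fin d → ℝ, (∀ j, |r j| ≤ 1) ∧ act a = ∑ j, r j • b j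

/-- The data on which the predictors of the exploitation phase are trained: `frozen` uses the data
available at the end of the exploration phase; `retrain` uses, at each round, all the data collected
so far. -/
inductive Training
  | frozen
  | retrain

/-- The rounds whose data are used for the predictors of round `t`; round `0` is the initial
dataset. -/
def Training.rounds (mode : Training) (Te t : ℕ) : Finset ℕ :=
  match mode with
  | .frozen => Finset.range (Te + 1)
  | .retrain => Finset.range t

/-- Confidence radius `β^t`. -/
def radius (n d : ℕ) (γ : ℝ) (t : ℕ) : ℝ :=
  max (128 * d * Real.log t * Real.log (n * (t : ℝ) ^ 2 / γ))
    ((8 / 3 * Real.log (n * (t : ℝ) ^ 2 / γ)) ^ 2)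

section Run

variable {m d k n : ℕ} {Ω : Type*}

/-- Residual sum of squares of the linear predictor `G` on the data collected under action `a` in
the rounds `S`; `ξ t i` is the sample `(x, ε, η)` of individual `i` in round `t` and `A t i` the
index of the action taken. -/
def residual (I : Problem m d k) (ξ : ℕ → Fin n → Ω → Vec m × Vec d × ℝ)
    (A : ℕ → Fin n → Ω → Fin k) (S : Finset ℕ) (ω : Ω) (a : Fin k) (G : Vec m →L[ℝ] Vec d) : ℝ :=
  ∑ s ∈ S, ∑ i, if A s i ω = a then ‖I.label a (ξ s i ω) - G (ξ s i ω).1‖ ^ 2 else 0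

/-- `A^t_i = ∑ⱼ bⱼ bⱼ† + ∑_{1 ≤ s < t} w^s_i (w^s_i)†`. -/
def gram (I : Problem m d k) (b : Fin d → Vec d) (A : ℕ → Fin n → Ω → Fin k)
    (t : ℕ) (i : Fin n) (ω : Ω) : Matrix (Fin d) (Fin d) ℝ :=
  (∑ j, Matrix.vecMulVec (b j).ofLp (b j).ofLp) +
    ∑ s ∈ Finset.Ico 1 t, Matrix.vecMulVec (I.act (A s i ω)).ofLp (I.act (A s i ω)).ofLp

/-- `μ̂^t_i = (A^t_i)⁻¹ ∑_{1 ≤ s < t} u^s_{bi} w^s_i`. -/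
def muHat (I : Problem m d k) (b : Fin d → Vec d) (ξ : ℕ → Fin n → Ω → Vec m × Vec d × ℝ)
    (A : ℕ → Fin n → Ω → Fin k) (t : ℕ) (i : Fin n) (ω : Ω) : Fin d → ℝ :=
  Matrix.mulVec (gram I b A t i ω)⁻¹
    (∑ s ∈ Finset.Ico 1 t,
      I.banditCost (A s i ω) (ξ s i ω) • (I.act (A s i ω)).ofLp)

/-- The confidence ball `B^t_i = {ν : ‖ν - μ̂^t_i‖_{2, A^t_i} ≤ √β^t}`, where
`‖v‖_{2, A} = √(v† A v)`. -/
def confBall (I : Problem m d k) (b : Fin d → Vec d) (γ : ℝ)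
    (ξ : ℕ → Fin n → Ω → Vec m × Vec d × ℝ) (A : ℕ → Fin n → Ω → Fin k)
    (t : ℕ) (i : Fin n) (ω : Ω) : Set (Vec d) :=
  {ν | √((ν.ofLp - muHat I b ξ A t i ω) ⬝ᵥ
      Matrix.mulVec (gram I b A t i ω) (ν.ofLp - muHat I b ξ A t i ω)) ≤ √(radius n d γ t)}

/-- The σ-algebra of everything drawn before round `t`. -/
def history (ξ : ℕ → Fin n → Ω → Vec m × Vec d × ℝ) (t : ℕ) : MeasurableSpace Ω :=
  ⨆ s : Fin t, ⨆ i, MeasurableSpace.comap (ξ s i) inferInstance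

/-- The σ-algebra of the features of round `t`. -/
def features (ξ : ℕ → Fin n → Ω → Vec m × Vec d × ℝ) (t : ℕ) : MeasurableSpace Ω :=
  ⨆ i, MeasurableSpace.comap (fun ω => (ξ t i ω).1) inferInstance

/-- `(A, Fhat)` are the actions and the predictors in a run of PROOF with action-specific label
distribution, on i.i.d. samples `ξ t i = (x, ε, η)`. Round `0` is the initial dataset, with actions
`w0`; rounds `1, …, Te` are the uniform exploration phase; rounds `t > Te` are the exploitation
phase. Ties among least-squares solutions and among optimal actions may be broken in any
non-anticipating way. -/
structure IsRun [MeasurableSpace Ω] (P : Measure Ω) (I : Problem m d k) (b : Fin d → Vec d)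
    (w0 : Fin n → Fin k) (γ : ℝ) (Te : ℕ) (mode : Training)
    (ξ : ℕ → Fin n → Ω → Vec m × Vec d × ℝ) (A : ℕ → Fin n → Ω → Fin k)
    (Fhat : ℕ → Ω → Fin k → Vec m →L[ℝ] Vec d) : Prop where
  measurable_sample : ∀ t i, Measurable (ξ t i)
  law_sample : ∀ t i, P.map (ξ t i) = I.sampleLaw
  indep_sample : iIndepFun (fun p : ℕ × Fin n => ξ p.1 p.2) P
  initial : ∀ i ω, A 0 i ω = w0 i
  explore : ∀ t i ω, 1 ≤ t → t ≤ Te → (A t i ω : ℕ) = (n * t + (i + 1)) % k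
  measurable_predictor : ∀ t, Te < t → ∀ a, Measurable[history ξ t] fun ω => Fhat t ω a
  leastSquares : ∀ t, Te < t → ∀ ω a G,
    residual I ξ A (mode.rounds Te t) ω a (Fhat t ω a) ≤ residual I ξ A (mode.rounds Te t) ω a G
  measurable_action : ∀ t i, Te < t → Measurable[history ξ t ⊔ features ξ t] (A t i)
  optimistic : ∀ t i ω, Te < t → ∃ ν ∈ confBall I b γ ξ A t i ω,
    ∀ a, ∀ ν' ∈ confBall I b γ ξ A t i ω,
      (inner ℝ (Fhat t ω (A t i ω) (ξ t i ω).1 + ν) (I.act (A t i ω)) : ℝ) ≤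
        inner ℝ (Fhat t ω a (ξ t i ω).1 + ν') (I.act a)

/-- The sum over rounds `1, …, T` and individuals of the cost incurred minus the cost of the optimal
policy; the regret `R_T` is its expectation. -/
def excessCost (I : Problem m d k) (π : Vec m → Fin k)
    (ξ : ℕ → Fin n → Ω → Vec m × Vec d × ℝ) (A : ℕ → Fin n → Ω → Fin k) (T : ℕ) (ω : Ω) : ℝ :=
  ∑ t ∈ Finset.Icc 1 T, ∑ i,
    (I.cost (A t i ω) (ξ t i ω) - I.cost (π (ξ t i ω).1) (ξ t i ω))

end Run

end BanditDDO

end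

/-! Write S = (d k)^{1/3} T^{2/3}. The noise of a round is independent of everything that determines
the action, so it integrates to zero and the regret is a sum of conditional mean losses `gap`
(`IsRun.integral_excessCost`). These are bounded, so exploration costs O(S) per individual. In a
later round with μ in the confidence ball, comparing the optimistic choice with the pair (optimal
action, μ) bounds the loss by two prediction errors plus the width of the ball in the direction
played (`IsRun.gap_le`).

Confidence and widths. exp(θ/2 · |S_N|²) / √det, with the norm taken in the inverse Gram matrix, is
a supermartingale for Gaussian increments (`lintegral_selfNormalized_le`); Markov's inequality then
puts μ in the ball of round t up to probability O(1/t²). Coordinates in the barycentric spanner are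
at most one, so the ratio of Gram determinants is at most t^d whatever the geometry of the actions,
and the elliptical potential lemma bounds the sum of the truncated widths by √T times the root of d
log T. With the radius this gives d√T up to logarithms. If exploration ends before T then d k ≤ 8T,
and with d ≤ k this is O(S).

Predictions. Let V be the design matrix of an action. If V u = x, the error at x is the noise
weighted by the products of the regressors with u (`inner_leastSquares_error`); the squared weights
sum to x·u, which should be of order m k / T̃ up to logarithms. Over T rounds this gives S√m.

Frozen data: exploration actions are deterministic, so V depends on features only and the noise is
Gaussian given them. The law of x is arbitrary, yet by exchangeability the mean leverage of one
among M + 1 samples is at most m/(M+1) (`lintegral_ridgeLeverage_le`). A union over the k actions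
must not cost a factor k, so leverage is compared with a level that depends on x alone and is
exceeded by a block of M samples with probability at most 1/2; logarithmically many independent
blocks make it unlikely that all exceed it, and V dominates every block. Since V may be singular,
statements pass through ridge regularization with parameter tending to zero.

Retraining: V now depends on past noise, so the self-normalized bound replaces conditioning on the
features. It costs a factor depending on m, but a regular design forces m ≤ KX²/κ. Hoeffding's
inequality for the entries of the Gram matrix shows that the exploration samples alone make V well
conditioned (`IsRegularDesign.measure_not_forall_le`). -/

noncomputable section

namespace BanditDDO

open Matrix Filter Topology
open scoped ENNReal

/-! ### Quadratic forms, rank-one updates, determinants and the elliptical potential. -/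

section LinearAlgebra

set_option linter.unusedSectionVars false

variable {ι : Type*} [Fintype ι] [DecidableEq ι]

theorem dotProduct_mulVec_comm {G : Matrix ι ι ℝ} (hG : G.IsHermitian) (u v : ι → ℝ) :
    u ⬝ᵥ G *ᵥ v = v ⬝ᵥ G *ᵥ u := by
  have h : Gᵀ = G := by simpa [Matrix.IsHermitian, Matrix.conjTranspose_eq_transpose_of_trivial] using hG
  rw [Matrix.dotProduct_mulVec, ← Matrix.mulVec_transpose, h, dotProduct_comm]

theorem dotProduct_vecMulVec_mulVec (w u v : ι → ℝ) :
    u ⬝ᵥ vecMulVec w w *ᵥ v = (w ⬝ᵥ u) * (w ⬝ᵥ v) := by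
  rw [vecMulVec_mulVec]
  simp [dotProduct_smul, dotProduct_comm, mul_comm]

theorem posSemidef_vecMulVec_self (w : ι → ℝ) : (vecMulVec w w).PosSemidef := by
  simpa using Matrix.posSemidef_vecMulVec_self_star w

theorem posSemidef_sum_vecMulVec {α : Type*} (s : Finset α) (f : α → ι → ℝ) :
    (∑ a ∈ s, vecMulVec (f a) (f a)).PosSemidef :=
  Matrix.posSemidef_sum s fun a _ => posSemidef_vecMulVec_self (f a)

theorem dotProduct_sum_vecMulVec_mulVec {α : Type*} (s : Finset α) (f : α → ι → ℝ)
    (u v : ι → ℝ) :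
    u ⬝ᵥ (∑ a ∈ s, vecMulVec (f a) (f a)) *ᵥ v = ∑ a ∈ s, (f a ⬝ᵥ u) * (f a ⬝ᵥ v) := by
  rw [Matrix.sum_mulVec, dotProduct_sum]
  exact Finset.sum_congr rfl fun a _ => dotProduct_vecMulVec_mulVec _ _ _

theorem PosDef.mulVec_inv_mulVec {G : Matrix ι ι ℝ} (hG : G.PosDef) (v : ι → ℝ) :
    G *ᵥ (G⁻¹ *ᵥ v) = v := by
  rw [Matrix.mulVec_mulVec, Matrix.mul_nonsing_inv _ ((Matrix.isUnit_iff_isUnit_det _).1 hG.isUnit),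
    Matrix.one_mulVec]

theorem PosDef.inv_mulVec_eq {G : Matrix ι ι ℝ} (hG : G.PosDef) {u v : ι → ℝ}
    (h : G *ᵥ u = v) : G⁻¹ *ᵥ v = u := by
  rw [← h, Matrix.mulVec_mulVec,
    Matrix.nonsing_inv_mul _ ((Matrix.isUnit_iff_isUnit_det _).1 hG.isUnit), Matrix.one_mulVec]

theorem PosDef.inv_form_nonneg {G : Matrix ι ι ℝ} (hG : G.PosDef) (v : ι → ℝ) :
    0 ≤ v ⬝ᵥ G⁻¹ *ᵥ v := by
  simpa using hG.inv.posSemidef.dotProduct_mulVec_nonneg v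

theorem PosSemidef.form_nonneg {G : Matrix ι ι ℝ} (hG : G.PosSemidef) (v : ι → ℝ) :
    0 ≤ v ⬝ᵥ G *ᵥ v := by
  simpa using hG.dotProduct_mulVec_nonneg v

/-- Cauchy–Schwarz for the form of a positive semidefinite matrix. -/
theorem PosSemidef.form_sq_le {G : Matrix ι ι ℝ} (hG : G.PosSemidef) (u v : ι → ℝ) :
    (u ⬝ᵥ G *ᵥ v) ^ 2 ≤ (u ⬝ᵥ G *ᵥ u) * (v ⬝ᵥ G *ᵥ v) := by
  have key : ∀ s : ℝ, 0 ≤ (v ⬝ᵥ G *ᵥ v) * (s * s) + (2 * (u ⬝ᵥ G *ᵥ v)) * s + u ⬝ᵥ G *ᵥ u := by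
    intro s
    have h := PosSemidef.form_nonneg hG (u + s • v)
    rw [Matrix.mulVec_add, Matrix.mulVec_smul] at h
    simp only [dotProduct_add, add_dotProduct, smul_dotProduct, dotProduct_smul, smul_eq_mul] at h
    rw [dotProduct_mulVec_comm hG.isHermitian v u] at h
    linarith
  have h := discrim_le_zero key
  rw [discrim] at h
  nlinarith

/-- Cauchy–Schwarz for the dual norms of a positive definite matrix. -/
theorem PosDef.dotProduct_sq_le {G : Matrix ι ι ℝ} (hG : G.PosDef) (s v : ι → ℝ) :
    (s ⬝ᵥ v) ^ 2 ≤ (s ⬝ᵥ G⁻¹ *ᵥ s) * (v ⬝ᵥ G *ᵥ v) := by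
  have h := PosSemidef.form_sq_le hG.posSemidef v (G⁻¹ *ᵥ s)
  rw [PosDef.mulVec_inv_mulVec hG, dotProduct_comm v s, dotProduct_comm (G⁻¹ *ᵥ s) s] at h
  linarith

theorem PosDef.add_vecMulVec {G : Matrix ι ι ℝ} (hG : G.PosDef) (w : ι → ℝ) :
    (G + vecMulVec w w).PosDef :=
  hG.add_posSemidef (posSemidef_vecMulVec_self w)

/-- The Sherman–Morrison formula. -/
theorem PosDef.inv_add_vecMulVec_mulVec {G : Matrix ι ι ℝ} (hG : G.PosDef) (w v : ι → ℝ) :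
    (G + vecMulVec w w)⁻¹ *ᵥ v =
      G⁻¹ *ᵥ v - ((w ⬝ᵥ G⁻¹ *ᵥ v) / (1 + w ⬝ᵥ G⁻¹ *ᵥ w)) • (G⁻¹ *ᵥ w) := by
  have hq : (1 + w ⬝ᵥ G⁻¹ *ᵥ w) ≠ 0 := by
    have := PosDef.inv_form_nonneg hG w
    positivity
  apply PosDef.inv_mulVec_eq (PosDef.add_vecMulVec hG w)
  rw [Matrix.add_mulVec, Matrix.mulVec_sub, Matrix.mulVec_smul, PosDef.mulVec_inv_mulVec hG,
    PosDef.mulVec_inv_mulVec hG, vecMulVec_mulVec, dotProduct_sub, dotProduct_smul]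
  ext i
  simp
  field_simp
  ring

theorem PosDef.det_add_vecMulVec {G : Matrix ι ι ℝ} (hG : G.PosDef) (w : ι → ℝ) :
    (G + vecMulVec w w).det = G.det * (1 + w ⬝ᵥ G⁻¹ *ᵥ w) := by
  rw [vecMulVec_eq Unit, Matrix.det_add_replicateCol_mul_replicateRow
    ((Matrix.isUnit_iff_isUnit_det _).1 hG.isUnit)]
  congr 1
  simp [Matrix.det_unique, Matrix.mul_apply, dotProduct, Matrix.mulVec, Finset.sum_mul,
    Finset.mul_sum, mul_assoc]
  rw [Finset.sum_comm]

/-- The inverse form after a rank-one update of the matrix and of the vector. -/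
theorem PosDef.inv_form_update {G : Matrix ι ι ℝ} (hG : G.PosDef) (s w : ι → ℝ) (g : ℝ) :
    (s + g • w) ⬝ᵥ (G + vecMulVec w w)⁻¹ *ᵥ (s + g • w) =
      s ⬝ᵥ G⁻¹ *ᵥ s - (w ⬝ᵥ G⁻¹ *ᵥ s) ^ 2 / (1 + w ⬝ᵥ G⁻¹ *ᵥ w)
        + 2 * g * ((w ⬝ᵥ G⁻¹ *ᵥ s) / (1 + w ⬝ᵥ G⁻¹ *ᵥ w))
        + g ^ 2 * ((w ⬝ᵥ G⁻¹ *ᵥ w) / (1 + w ⬝ᵥ G⁻¹ *ᵥ w)) := by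
  have hq : (1 + w ⬝ᵥ G⁻¹ *ᵥ w) ≠ 0 := by
    have := PosDef.inv_form_nonneg hG w
    positivity
  rw [PosDef.inv_add_vecMulVec_mulVec hG]
  simp only [Matrix.mulVec_add, Matrix.mulVec_smul, dotProduct_add, dotProduct_sub, add_dotProduct,
    smul_dotProduct, dotProduct_smul, smul_eq_mul]
  rw [dotProduct_mulVec_comm hG.inv.isHermitian s w]
  field_simp
  ring

/-- The arithmetic-geometric mean inequality for the eigenvalues. -/
theorem PosSemidef.det_le_trace_div_pow [Nonempty ι] {G : Matrix ι ι ℝ} (hG : G.PosSemidef) :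
    G.det ≤ (G.trace / Fintype.card ι) ^ Fintype.card ι := by
  have hd : G.det = ∏ i, hG.isHermitian.eigenvalues i := by
    simpa using hG.isHermitian.det_eq_prod_eigenvalues
  have ht : G.trace = ∑ i, hG.isHermitian.eigenvalues i := by
    simpa using hG.isHermitian.trace_eq_sum_eigenvalues
  have hnn : ∀ i, 0 ≤ hG.isHermitian.eigenvalues i := hG.eigenvalues_nonneg
  have hc : (0 : ℝ) < Fintype.card ι := by exact_mod_cast Fintype.card_pos
  have h := Real.geom_mean_le_arith_mean Finset.univ (fun _ => 1) hG.isHermitian.eigenvalues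
    (by simp) (by simpa using Fintype.card_pos) fun i _ => hnn i
  simp only [Real.rpow_one, Finset.sum_const, Finset.card_univ, nsmul_eq_mul, mul_one, one_mul,
    ← hd, ← ht] at h
  calc G.det = (G.det ^ ((Fintype.card ι : ℝ)⁻¹)) ^ Fintype.card ι := by
        rw [Real.rpow_inv_natCast_pow hG.det_nonneg Fintype.card_ne_zero]
    _ ≤ _ := by
        gcongr
        exact Real.rpow_nonneg hG.det_nonneg _

/-- The trace bound for ridge leverage scores. -/
theorem sum_ridge_leverage_le {α : Type*} (s : Finset α) (f : α → ι → ℝ) {r : ℝ} (hr : 0 < r) :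
    ∑ a ∈ s, f a ⬝ᵥ (∑ a ∈ s, vecMulVec (f a) (f a) + r • (1 : Matrix ι ι ℝ))⁻¹ *ᵥ f a
      ≤ Fintype.card ι := by
  set V := ∑ a ∈ s, vecMulVec (f a) (f a) with hV
  have hG : (V + r • (1 : Matrix ι ι ℝ)).PosDef := by
    rw [add_comm]
    exact (Matrix.PosDef.one.smul hr).add_posSemidef (posSemidef_sum_vecMulVec s f)
  set G := V + r • (1 : Matrix ι ι ℝ) with hGdef
  have h1 : ∑ a ∈ s, f a ⬝ᵥ G⁻¹ *ᵥ f a = (G⁻¹ * V).trace := by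
    rw [hV, Matrix.mul_sum, Matrix.trace_sum]
    refine Finset.sum_congr rfl fun a _ => ?_
    rw [Matrix.mul_vecMulVec, Matrix.trace_vecMulVec, dotProduct_comm]
  -- The sum of the scores is the trace of this matrix, that is, the dimension minus r times a
  -- nonnegative trace.
  have h2 : G⁻¹ * V = 1 - r • G⁻¹ := by
    have : V = G - r • 1 := by rw [hGdef]; simp
    rw [this, Matrix.mul_sub,
      Matrix.nonsing_inv_mul _ ((Matrix.isUnit_iff_isUnit_det _).1 hG.isUnit)]
    simp
  have h3 : 0 ≤ (G⁻¹).trace := hG.inv.posSemidef.trace_nonneg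
  rw [h1, h2, Matrix.trace_sub, Matrix.trace_one, Matrix.trace_smul, smul_eq_mul]
  nlinarith [mul_nonneg hr.le h3]

theorem sum_vecMulVec_self_eq_transpose_mul (b : ι → ι → ℝ) :
    ∑ j, vecMulVec (b j) (b j) = (Matrix.of b)ᵀ * Matrix.of b := by
  ext i j
  simp [Matrix.sum_apply, vecMulVec_apply, Matrix.mul_apply]

theorem posDef_sum_vecMulVec_of_linearIndependent {b : ι → ι → ℝ} (hb : LinearIndependent ℝ b) :
    (∑ j, vecMulVec (b j) (b j)).PosDef := by
  rw [sum_vecMulVec_self_eq_transpose_mul]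
  have hu : IsUnit (Matrix.of b) := Matrix.linearIndependent_rows_iff_isUnit.1 hb
  have := Matrix.PosDef.one (n := ι) (R := ℝ)
  simpa [Matrix.conjTranspose_eq_transpose_of_trivial] using
    Matrix.PosDef.conjTranspose_mul_self (Matrix.of b) (Matrix.mulVec_injective_of_isUnit hu)

/-- The determinant of `1 + ∑ vₐ vₐ†` for vectors of bounded length. -/
theorem det_one_add_sum_vecMulVec_le [Nonempty ι] {α : Type*} (s : Finset α) (f : α → ι → ℝ) {K : ℝ}
    (hf : ∀ a ∈ s, f a ⬝ᵥ f a ≤ K * Fintype.card ι) :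
    (1 + ∑ a ∈ s, vecMulVec (f a) (f a)).det ≤ (1 + K * s.card) ^ Fintype.card ι := by
  have hc : (0 : ℝ) < Fintype.card ι := by exact_mod_cast Fintype.card_pos
  have hps : (1 + ∑ a ∈ s, vecMulVec (f a) (f a)).PosSemidef :=
    (Matrix.PosDef.one.add_posSemidef (posSemidef_sum_vecMulVec s f)).posSemidef
  refine (PosSemidef.det_le_trace_div_pow hps).trans ?_
  gcongr
  · exact div_nonneg hps.trace_nonneg hc.le
  rw [div_le_iff₀ hc, Matrix.trace_add, Matrix.trace_one, Matrix.trace_sum]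
  simp only [Matrix.trace_vecMulVec]
  have := Finset.sum_le_card_nsmul s _ _ hf
  rw [nsmul_eq_mul] at this
  linarith

/-- The determinant of a Gram matrix whose vectors have coordinates in `[-1, 1]` in the basis that
is used for the regularization. -/
theorem det_spanner_add_sum_vecMulVec_le [Nonempty ι] {α : Type*} (b : ι → ι → ℝ) (s : Finset α)
    (f : α → ι → ℝ) (hf : ∀ a ∈ s, ∃ r : ι → ℝ, (∀ j, |r j| ≤ 1) ∧ f a = ∑ j, r j • b j) :
    (∑ j, vecMulVec (b j) (b j) + ∑ a ∈ s, vecMulVec (f a) (f a)).det ≤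
      (1 + (s.card : ℝ)) ^ Fintype.card ι * (∑ j, vecMulVec (b j) (b j)).det := by
  classical
  choose! r hr hfr using hf
  have hfa : ∀ a ∈ s, f a = r a ᵥ* Matrix.of b := by
    intro a ha
    rw [hfr a ha]
    ext i
    simp [Matrix.vecMul, dotProduct, Finset.sum_apply]
  have h1 : ∑ a ∈ s, vecMulVec (f a) (f a) =
      (Matrix.of b)ᵀ * (∑ a ∈ s, vecMulVec (r a) (r a)) * Matrix.of b := by
    rw [Matrix.mul_sum, Matrix.sum_mul]
    refine Finset.sum_congr rfl fun a ha => ?_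
    rw [Matrix.mul_vecMulVec, Matrix.vecMulVec_mul, Matrix.mulVec_transpose, hfa a ha]
  -- In spanner coordinates the regularizer becomes the identity. The squared determinant of the
  -- basis factors out, and the coordinate vectors have squared length at most the dimension.
  have h2 : ∑ j, vecMulVec (b j) (b j) + ∑ a ∈ s, vecMulVec (f a) (f a) =
      (Matrix.of b)ᵀ * (1 + ∑ a ∈ s, vecMulVec (r a) (r a)) * Matrix.of b := by
    rw [h1, sum_vecMulVec_self_eq_transpose_mul, Matrix.mul_add, Matrix.add_mul, Matrix.mul_one]
  rw [h2, sum_vecMulVec_self_eq_transpose_mul]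
  simp only [Matrix.det_mul, Matrix.det_transpose]
  have h3 : (1 + ∑ a ∈ s, vecMulVec (r a) (r a)).det ≤ (1 + 1 * (s.card : ℝ)) ^ Fintype.card ι := by
    refine det_one_add_sum_vecMulVec_le s r fun a ha => ?_
    rw [one_mul, ← nsmul_one, ← Finset.card_univ, ← Finset.sum_const]
    refine Finset.sum_le_sum fun j _ => ?_
    rw [← abs_mul_abs_self]
    nlinarith [abs_nonneg (r a j), hr a ha j]
  rw [one_mul] at h3
  nlinarith [mul_self_nonneg (Matrix.of b).det]

/-- The elliptical potential lemma. -/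
theorem sum_log_one_add_inv_form {G : Matrix ι ι ℝ} (hG : G.PosDef) (f : ℕ → ι → ℝ) (N : ℕ) :
    ∑ s ∈ Finset.range N,
        Real.log (1 + f s ⬝ᵥ (G + ∑ r ∈ Finset.range s, vecMulVec (f r) (f r))⁻¹ *ᵥ f s) =
      Real.log (G + ∑ r ∈ Finset.range N, vecMulVec (f r) (f r)).det - Real.log G.det := by
  induction N with
  | zero => simp
  | succ N ih =>
    have hN : (G + ∑ r ∈ Finset.range N, vecMulVec (f r) (f r)).PosDef :=
      hG.add_posSemidef (posSemidef_sum_vecMulVec _ f)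
    rw [Finset.sum_range_succ, ih, Finset.sum_range_succ _ N, ← add_assoc,
      PosDef.det_add_vecMulVec hN, Real.log_mul hN.det_pos.ne']
    · ring
    · have := PosDef.inv_form_nonneg hN (f N)
      positivity

/-- The potential controls only logarithms, and squared widths may exceed 1. Truncation costs a
factor 2 because log (1 + q) ≥ q / (1 + q); it is harmless since losses are bounded. -/
theorem min_one_le_two_mul_log_one_add {q : ℝ} (hq : 0 ≤ q) : min 1 q ≤ 2 * Real.log (1 + q) := by
  have h := Real.one_sub_inv_le_log_of_pos (show 0 < 1 + q by positivity)
  have h1 : 1 - (1 + q)⁻¹ = q / (1 + q) := by field_simp; ring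
  rw [h1] at h
  have h2 : min 1 q ≤ 2 * (q / (1 + q)) := by
    rw [← mul_div_assoc, le_div_iff₀ (by positivity)]
    rcases le_total 1 q with h | h
    · rw [min_eq_left h]; linarith
    · rw [min_eq_right h]; nlinarith
  linarith

end LinearAlgebra

/-! ### Measurability of determinants, inverses and quadratic forms. -/

section Measurability

set_option linter.unusedSectionVars false

variable {ι Ω : Type*} [Fintype ι] [DecidableEq ι] {mΩ : MeasurableSpace Ω}

theorem measurable_det {G : Ω → Matrix ι ι ℝ} (hG : ∀ i j, Measurable fun ω => G ω i j) :
    Measurable fun ω => (G ω).det := by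
  simp only [Matrix.det_apply']
  fun_prop

theorem measurable_adjugate_apply {G : Ω → Matrix ι ι ℝ} (hG : ∀ i j, Measurable fun ω => G ω i j)
    (i j : ι) : Measurable fun ω => (G ω).adjugate i j := by
  simp only [Matrix.adjugate_apply]
  refine measurable_det fun k l => ?_
  simp only [Matrix.updateRow_apply]
  split_ifs
  · exact measurable_const
  · exact hG k l

theorem measurable_inv_apply {G : Ω → Matrix ι ι ℝ} (hG : ∀ i j, Measurable fun ω => G ω i j)
    (i j : ι) : Measurable fun ω => (G ω)⁻¹ i j := by
  simp only [Matrix.inv_def, Matrix.smul_apply, Ring.inverse_eq_inv', smul_eq_mul]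
  exact (measurable_det hG).inv.mul (measurable_adjugate_apply hG i j)

theorem measurable_mulVec {G : Ω → Matrix ι ι ℝ} (hG : ∀ i j, Measurable fun ω => G ω i j)
    {v : Ω → ι → ℝ} (hv : Measurable v) : Measurable fun ω => G ω *ᵥ v ω := by
  rw [measurable_pi_iff] at hv ⊢
  intro i
  simp only [Matrix.mulVec, dotProduct]
  exact Finset.measurable_sum _ fun j _ => (hG i j).mul (hv j)

theorem measurable_dotProduct {u v : Ω → ι → ℝ} (hu : Measurable u) (hv : Measurable v) :
    Measurable fun ω => u ω ⬝ᵥ v ω := by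
  rw [measurable_pi_iff] at hu hv
  simp only [dotProduct]
  exact Finset.measurable_sum _ fun j _ => (hu j).mul (hv j)

theorem measurable_sum_vecMulVec_apply {α : Type*} (s : Finset α) {f : α → Ω → ι → ℝ}
    (hf : ∀ a ∈ s, Measurable (f a)) (i j : ι) :
    Measurable fun ω => (∑ a ∈ s, vecMulVec (f a ω) (f a ω)) i j := by
  simp only [Matrix.sum_apply, vecMulVec_apply]
  exact Finset.measurable_sum _ fun a ha =>
    ((measurable_pi_iff.1 (hf a ha)) i).mul ((measurable_pi_iff.1 (hf a ha)) j)

end Measurability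

/-! ### Exponential supermartingales with Gaussian increments. -/

section Gaussian

/-- The Gaussian integral of the exponential of a quadratic polynomial. -/
theorem lintegral_exp_quadratic_gaussianReal (v : ℝ≥0) {β δ : ℝ} (h : 2 * δ * v < 1) :
    ∫⁻ g, ENNReal.ofReal (Real.exp (β * g + δ * g ^ 2)) ∂gaussianReal 0 v =
      ENNReal.ofReal (Real.exp (β ^ 2 * v / (2 * (1 - 2 * δ * v))) / √(1 - 2 * δ * v)) := by
  rcases eq_or_ne v 0 with rfl | hv
  · simp
  have hv0 : (0 : ℝ) < v := by positivity
  have ha : 0 < 1 - 2 * δ * v := by linarith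
  set a := 1 - 2 * δ * v with had
  set v' : ℝ≥0 := ⟨v / a, by positivity⟩ with hv'
  have hv'c : (v' : ℝ) = v / a := rfl
  have hv'0 : v' ≠ 0 := by
    rw [← NNReal.coe_ne_zero, hv'c]; positivity
  rw [gaussianReal_of_var_ne_zero _ hv, lintegral_withDensity_eq_lintegral_mul₀
    (measurable_gaussianPDF _ _).aemeasurable (by fun_prop)]
  -- Completing the square: the integrand is a constant multiple of the Gaussian density of mean
  -- βv/a and variance v/a.
  have key : ∀ g, (gaussianPDF 0 v * fun g => ENNReal.ofReal (Real.exp (β * g + δ * g ^ 2))) g =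
      ENNReal.ofReal (Real.exp (β ^ 2 * v / (2 * a)) / √a) * gaussianPDF (β * v') v' g := by
    intro g
    simp only [Pi.mul_apply, gaussianPDF]
    rw [← ENNReal.ofReal_mul (gaussianPDFReal_nonneg _ _ _), ← ENNReal.ofReal_mul (by positivity)]
    congr 1
    simp only [gaussianPDFReal, hv'c]
    rw [mul_assoc, ← Real.exp_add, show (2 * Real.pi * (v / a)) = (2 * Real.pi * v) / a by ring,
      Real.sqrt_div (by positivity), inv_div, div_mul_eq_mul_div, mul_div_assoc', mul_div_assoc',
      eq_div_iff (by positivity)]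
    rw [show Real.exp (β ^ 2 * v / (2 * a)) * ((√a / √(2 * Real.pi * v)) *
      Real.exp (-(g - β * v / a) ^ 2 / (2 * v / a))) = (√(2 * Real.pi * v))⁻¹ *
      (Real.exp (β ^ 2 * v / (2 * a)) * Real.exp (-(g - β * v / a) ^ 2 / (2 * v / a))) * √a by
        ring, ← Real.exp_add]
    congr 3
    have hδ : δ = (1 - a) / (2 * v) := by rw [had]; field_simp; ring
    rw [hδ]
    field_simp
    ring
  rw [lintegral_congr key, lintegral_const_mul _ (measurable_gaussianPDF _ _),
    lintegral_gaussianPDF_eq_one _ hv'0, mul_one]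

/-- Integrating out a Gaussian variable which is independent of the coefficients. -/
theorem lintegral_mul_exp_quadratic_le {Ω : Type*} {𝓕 mΩ : MeasurableSpace Ω} {P : Measure Ω}
    [IsProbabilityMeasure P] (h𝓕 : 𝓕 ≤ mΩ) {g : Ω → ℝ}
    (hg : Measurable g) (hind : Indep 𝓕 (MeasurableSpace.comap g inferInstance) P) {v : ℝ≥0}
    (hlaw : P.map g = gaussianReal 0 v) {Z Z' : Ω → ℝ≥0∞} {β δ : Ω → ℝ} (hZ : Measurable[𝓕] Z)
    (hβ : Measurable[𝓕] β) (hδ : Measurable[𝓕] δ) (h : ∀ ω, 2 * δ ω * v < 1)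
    (hZ' : ∀ ω, Z ω * ENNReal.ofReal (Real.exp (β ω ^ 2 * v / (2 * (1 - 2 * δ ω * v))) /
      √(1 - 2 * δ ω * v)) ≤ Z' ω) :
    ∫⁻ ω, Z ω * ENNReal.ofReal (Real.exp (β ω * g ω + δ ω * g ω ^ 2)) ∂P ≤ ∫⁻ ω, Z' ω ∂P := by
  let U : Ω → ℝ≥0∞ × ℝ × ℝ := fun ω => (Z ω, β ω, δ ω)
  have hU : Measurable[𝓕] U := hZ.prodMk (hβ.prodMk hδ)
  have hU' : Measurable U := hU.mono h𝓕 le_rfl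
  have hUg : IndepFun U g P := by
    rw [IndepFun_iff_Indep]
    exact indep_of_indep_of_le_left hind hU.comap_le
  have hprod := (indepFun_iff_map_prod_eq_prod_map_map hU'.aemeasurable hg.aemeasurable).1 hUg
  let f : (ℝ≥0∞ × ℝ × ℝ) × ℝ → ℝ≥0∞ := fun q =>
    q.1.1 * ENNReal.ofReal (Real.exp (q.1.2.1 * q.2 + q.1.2.2 * q.2 ^ 2))
  have hf : Measurable f := by fun_prop
  calc ∫⁻ ω, Z ω * ENNReal.ofReal (Real.exp (β ω * g ω + δ ω * g ω ^ 2)) ∂P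
      = ∫⁻ q, f q ∂(P.map fun ω => (U ω, g ω)) := by
        rw [lintegral_map hf (hU'.prodMk hg)]
    _ = ∫⁻ u, ∫⁻ y, f (u, y) ∂gaussianReal 0 v ∂(P.map U) := by
        rw [hprod, hlaw, lintegral_prod _ hf.aemeasurable]
    _ = ∫⁻ ω, ∫⁻ y, f (U ω, y) ∂gaussianReal 0 v ∂P := by
        rw [lintegral_map (Measurable.lintegral_prod_right' hf) hU']
    _ ≤ ∫⁻ ω, Z' ω ∂P := by
        refine lintegral_mono fun ω => (le_of_eq ?_).trans (hZ' ω)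
        simp only [f, U]
        rw [lintegral_const_mul _ (by fun_prop), lintegral_exp_quadratic_gaussianReal v (h ω)]

variable {Ω : Type*} {mΩ : MeasurableSpace Ω} {P : Measure Ω} [IsProbabilityMeasure P]

/-- Exponential supermartingales for linear forms of conditionally Gaussian variables. -/
theorem lintegral_exp_sum_le {𝓕 : ℕ → MeasurableSpace Ω} (h𝓕 : ∀ p, 𝓕 p ≤ mΩ) (hmono : Monotone 𝓕)
    {φ g : ℕ → Ω → ℝ} (hφ : ∀ p, Measurable[𝓕 p] (φ p)) (hg : ∀ p, Measurable[𝓕 (p + 1)] (g p))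
    (hind : ∀ p, Indep (𝓕 p) (MeasurableSpace.comap (g p) inferInstance) P) {v : ℕ → ℝ≥0} {s : ℝ}
    (hlaw : ∀ p, P.map (g p) = gaussianReal 0 (v p)) (hv : ∀ p, v p ≤ s) (N : ℕ) :
    ∫⁻ ω, ENNReal.ofReal (Real.exp (∑ p ∈ Finset.range N, φ p ω * g p ω -
      s / 2 * ∑ p ∈ Finset.range N, φ p ω ^ 2)) ∂P ≤ 1 := by
  induction N with
  | zero => simp
  | succ N ih =>
    refine le_trans ?_ ih
    have hmeas : ∀ p < N, Measurable[𝓕 N] (φ p) ∧ Measurable[𝓕 N] (g p) := fun p hp =>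
      ⟨(hφ p).mono (hmono hp.le) le_rfl, (hg p).mono (hmono hp) le_rfl⟩
    -- The last square is predictable, so it belongs to the factor `Z`; it compensates the
    -- exponential moment of the last increment.
    have h := lintegral_mul_exp_quadratic_le (h𝓕 N) ((hg N).mono (h𝓕 _) le_rfl) (hind N) (hlaw N)
      (Z := fun ω => ENNReal.ofReal (Real.exp (∑ p ∈ Finset.range N, φ p ω * g p ω -
        s / 2 * ∑ p ∈ Finset.range (N + 1), φ p ω ^ 2)))
      (Z' := fun ω => ENNReal.ofReal (Real.exp (∑ p ∈ Finset.range N, φ p ω * g p ω -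
        s / 2 * ∑ p ∈ Finset.range N, φ p ω ^ 2))) (β := φ N) (δ := fun _ => 0)
      ?_ (hφ N) measurable_const (by simp) ?_
    · refine le_trans (le_of_eq (lintegral_congr fun ω => ?_)) h
      rw [← ENNReal.ofReal_mul (by positivity), ← Real.exp_add]
      congr 2
      rw [Finset.sum_range_succ (fun p => φ p ω * g p ω)]
      ring
    · refine ENNReal.measurable_ofReal.comp (Real.measurable_exp.comp (Measurable.sub ?_ ?_))
      · exact Finset.measurable_sum _ fun p hp =>
          (hmeas p (Finset.mem_range.1 hp)).1.mul (hmeas p (Finset.mem_range.1 hp)).2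
      · refine Measurable.const_mul (Finset.measurable_sum _ fun p hp => ?_) _
        exact ((hφ p).mono (hmono (Nat.lt_succ_iff.1 (Finset.mem_range.1 hp))) le_rfl).pow_const 2
    · intro ω
      rw [← ENNReal.ofReal_mul (by positivity)]
      refine ENNReal.ofReal_le_ofReal ?_
      simp only [mul_zero, zero_mul, sub_zero, Real.sqrt_one, div_one, mul_one]
      rw [← Real.exp_add, Real.exp_le_exp, Finset.sum_range_succ (fun p => φ p ω ^ 2)]
      nlinarith [mul_le_mul_of_nonneg_left (hv N) (sq_nonneg (φ N ω))]

variable {ι : Type*} [Fintype ι] [DecidableEq ι]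

/-- The self-normalized exponential bound for vector-valued martingales with conditionally Gaussian
increments. -/
theorem lintegral_selfNormalized_le {𝓕 : ℕ → MeasurableSpace Ω} (h𝓕 : ∀ p, 𝓕 p ≤ mΩ)
    (hmono : Monotone 𝓕) {φ : ℕ → Ω → ι → ℝ} {g : ℕ → Ω → ℝ} (hφ : ∀ p, Measurable[𝓕 p] (φ p))
    (hg : ∀ p, Measurable[𝓕 (p + 1)] (g p))
    (hind : ∀ p, Indep (𝓕 p) (MeasurableSpace.comap (g p) inferInstance) P) {v : ℕ → ℝ≥0} {θ : ℝ}
    (hlaw : ∀ p, P.map (g p) = gaussianReal 0 (v p)) (hθ : 0 ≤ θ) (hv : ∀ p, θ * v p ≤ 1)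
    {G : Matrix ι ι ℝ} (hG : G.PosDef) (N : ℕ) :
    ∫⁻ ω, ENNReal.ofReal (Real.exp (θ / 2 * ((∑ p ∈ Finset.range N, g p ω • φ p ω) ⬝ᵥ
        (G + ∑ p ∈ Finset.range N, vecMulVec (φ p ω) (φ p ω))⁻¹ *ᵥ
          (∑ p ∈ Finset.range N, g p ω • φ p ω))) /
        √(G + ∑ p ∈ Finset.range N, vecMulVec (φ p ω) (φ p ω)).det) ∂P ≤
      ENNReal.ofReal (1 / √G.det) := by
  induction N with
  | zero => simp
  | succ N ih =>
    refine le_trans ?_ ih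
    have hφN : ∀ p ∈ Finset.range N, Measurable[𝓕 N] (φ p) := fun p hp =>
      (hφ p).mono (hmono (Finset.mem_range.1 hp).le) le_rfl
    have hgN : ∀ p ∈ Finset.range N, Measurable[𝓕 N] (g p) := fun p hp =>
      (hg p).mono (hmono (Finset.mem_range.1 hp)) le_rfl
    set H : Ω → Matrix ι ι ℝ := fun ω => G + ∑ p ∈ Finset.range N, vecMulVec (φ p ω) (φ p ω) with hH
    set S : Ω → ι → ℝ := fun ω => ∑ p ∈ Finset.range N, g p ω • φ p ω with hS
    have hHpd : ∀ ω, (H ω).PosDef := fun ω => hG.add_posSemidef (posSemidef_sum_vecMulVec _ _)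
    have hHm : ∀ i j, Measurable[𝓕 N] fun ω => H ω i j := by
      intro i j
      simp only [hH, Matrix.add_apply]
      exact measurable_const.add (measurable_sum_vecMulVec_apply (mΩ := 𝓕 N) _ hφN i j)
    have hSm : Measurable[𝓕 N] S :=
      Finset.measurable_sum _ fun p hp => (hgN p hp).smul (hφN p hp)
    have hinv : ∀ {u w : Ω → ι → ℝ}, Measurable[𝓕 N] u → Measurable[𝓕 N] w →
        Measurable[𝓕 N] fun ω => u ω ⬝ᵥ (H ω)⁻¹ *ᵥ w ω := fun hu hw =>
      measurable_dotProduct (mΩ := 𝓕 N) hu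
        (measurable_mulVec (mΩ := 𝓕 N) (measurable_inv_apply (mΩ := 𝓕 N) hHm) hw)
    have hqm := hinv (hφ N) (hφ N)
    have hpm := hinv (hφ N) hSm
    have hQm := hinv hSm hSm
    have hdm := measurable_det (mΩ := 𝓕 N) hHm
    set q : Ω → ℝ := fun ω => φ N ω ⬝ᵥ (H ω)⁻¹ *ᵥ φ N ω with hq
    set r : Ω → ℝ := fun ω => φ N ω ⬝ᵥ (H ω)⁻¹ *ᵥ S ω with hr
    set Q : Ω → ℝ := fun ω => S ω ⬝ᵥ (H ω)⁻¹ *ᵥ S ω with hQ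
    have hq0 : ∀ ω, 0 ≤ q ω := fun ω => PosDef.inv_form_nonneg (hHpd ω) _
    have hd0 : ∀ ω, 0 < (H ω).det := fun ω => (hHpd ω).det_pos
    -- By `PosDef.inv_form_update` the new exponent is a quadratic polynomial in the last increment,
    -- with coefficients `β` and `δ` known beforehand; the determinant gains the factor 1 + q.
    have h := lintegral_mul_exp_quadratic_le (h𝓕 N) ((hg N).mono (h𝓕 _) le_rfl) (hind N) (hlaw N)
      (Z := fun ω => ENNReal.ofReal (Real.exp (θ / 2 * (Q ω - r ω ^ 2 / (1 + q ω))) /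
        √((H ω).det * (1 + q ω))))
      (Z' := fun ω => ENNReal.ofReal (Real.exp (θ / 2 * Q ω) / √(H ω).det))
      (β := fun ω => θ * (r ω / (1 + q ω))) (δ := fun ω => θ / 2 * (q ω / (1 + q ω)))
      ?_ ?_ ?_ ?_ ?_
    · refine le_trans (le_of_eq (lintegral_congr fun ω => ?_)) h
      rw [← ENNReal.ofReal_mul (by positivity), div_mul_eq_mul_div (Real.exp _) (√_), ← Real.exp_add]
      simp only [Finset.sum_range_succ _ N]
      rw [← add_assoc, PosDef.det_add_vecMulVec (hHpd ω), PosDef.inv_form_update (hHpd ω)]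
      congr 3
      simp only [q, r, Q, S]
      ring
    · exact ENNReal.measurable_ofReal.comp ((Real.measurable_exp.comp ((hQm.sub
        ((hpm.pow_const 2).div (measurable_const.add hqm))).const_mul _)).div
          (hdm.mul (measurable_const.add hqm)).sqrt)
    · exact (hpm.div (measurable_const.add hqm)).const_mul _
    · exact (hqm.div (measurable_const.add hqm)).const_mul _
    · intro ω
      have h1 : q ω / (1 + q ω) < 1 := by
        rw [div_lt_one (by linarith [hq0 ω])]; linarith
      have h2 : 0 ≤ q ω / (1 + q ω) := div_nonneg (hq0 ω) (by linarith [hq0 ω])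
      have h3 := hv N
      have h4 : 2 * (θ / 2 * (q ω / (1 + q ω))) * v N = (θ * v N) * (q ω / (1 + q ω)) := by ring
      rw [h4]
      nlinarith [mul_nonneg hθ (v N).coe_nonneg]
    · intro ω
      have hq1 : 0 < 1 + q ω := by linarith [hq0 ω]
      rw [← ENNReal.ofReal_mul (by positivity)]
      refine ENNReal.ofReal_le_ofReal ?_
      set a := 1 - 2 * (θ / 2 * (q ω / (1 + q ω))) * v N with ha
      -- This is where θ v ≤ 1 enters. It gives a (1 + q) ≥ 1, so the gain of the determinant pays
      -- for the Gaussian factor 1/√a, and the exponent produced by β is at most the one removed by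
      -- the rank-one update.
      have ha1 : 1 / (1 + q ω) ≤ a := by
        have h4 : a = 1 - (θ * v N) * (q ω / (1 + q ω)) := by rw [ha]; ring
        have h5 : 1 / (1 + q ω) = 1 - q ω / (1 + q ω) := by field_simp; ring
        have h2 : 0 ≤ q ω / (1 + q ω) := div_nonneg (hq0 ω) hq1.le
        rw [h4, h5]
        nlinarith [hv N]
      have ha0 : 0 < a := lt_of_lt_of_le (by positivity) ha1
      have haq : 1 ≤ a * (1 + q ω) := by
        rwa [div_le_iff₀ hq1] at ha1
      rw [div_mul_div_comm, ← Real.exp_add, ← Real.sqrt_mul (mul_pos (hd0 ω) hq1).le]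
      gcongr
      · exact Real.sqrt_pos.2 (hd0 ω)
      · have h6 : (θ * (r ω / (1 + q ω))) ^ 2 * v N / (2 * a) ≤
            θ / 2 * (r ω ^ 2 / (1 + q ω)) := by
          have e1 : (θ * (r ω / (1 + q ω))) ^ 2 * v N / (2 * a) =
            (θ * v N) * (1 / (a * (1 + q ω))) * (θ / 2 * (r ω ^ 2 / (1 + q ω))) := by
            field_simp
          rw [e1]
          have e2 : (θ * v N) * (1 / (a * (1 + q ω))) ≤ 1 := by
            have : 1 / (a * (1 + q ω)) ≤ 1 := by
              rw [div_le_one (by positivity)]; exact haq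
            exact mul_le_one₀ (hv N) (by positivity) this
          have e3 : 0 ≤ θ / 2 * (r ω ^ 2 / (1 + q ω)) := by positivity
          nlinarith
        linarith
      · nlinarith [hd0 ω]

end Gaussian

/-! ### Least squares with a possibly singular design as a limit of ridge regression. -/

section Ridge

set_option linter.unusedSectionVars false

variable {ι α : Type*} [Fintype ι] [DecidableEq ι]

theorem dotProduct_self_nonneg (v : ι → ℝ) : 0 ≤ v ⬝ᵥ v :=
  Finset.sum_nonneg fun i _ => mul_self_nonneg (v i)

/-- The regularization parameters `1, 1/2, 1/3, …`. -/
def ridge (j : ℕ) : ℝ := 1 / ((j : ℝ) + 1)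

theorem ridge_pos (j : ℕ) : 0 < ridge j := by
  unfold ridge; positivity

theorem tendsto_ridge : Tendsto ridge atTop (𝓝 0) := tendsto_one_div_add_atTop_nhds_zero_nat

theorem PosSemidef.add_smul_one {V : Matrix ι ι ℝ} (hV : V.PosSemidef) {r : ℝ} (hr : 0 < r) :
    (V + r • (1 : Matrix ι ι ℝ)).PosDef := by
  rw [add_comm]
  exact (Matrix.PosDef.one.smul hr).add_posSemidef hV

theorem dotProduct_add_smul_one_mulVec (V : Matrix ι ι ℝ) (r : ℝ) (v : ι → ℝ) :
    v ⬝ᵥ (V + r • (1 : Matrix ι ι ℝ)) *ᵥ v = v ⬝ᵥ V *ᵥ v + r * (v ⬝ᵥ v) := by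
  rw [Matrix.add_mulVec, dotProduct_add, Matrix.smul_mulVec, Matrix.one_mulVec, dotProduct_smul,
    smul_eq_mul]

/-- The coefficient vector of the normalized ridge prediction at `x`. -/
def ridgeCoeff (V : Matrix ι ι ℝ) (x : ι → ℝ) (j : ℕ) : ι → ℝ :=
  (√(x ⬝ᵥ (V + ridge j • (1 : Matrix ι ι ℝ))⁻¹ *ᵥ x))⁻¹ •
    ((V + ridge j • (1 : Matrix ι ι ℝ))⁻¹ *ᵥ x)

/-- Since V ≤ G, the sum of the squared weights before normalization is at most the form x·G⁻¹x,
whose root is the normalization. A ridge statistic of noise thus has variance proxy at most that of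
one noise variable, for every j and however singular V is. -/
theorem sum_sq_ridgeCoeff_le (s : Finset α) (f : α → ι → ℝ) (x : ι → ℝ) (j : ℕ) :
    ∑ a ∈ s, (f a ⬝ᵥ ridgeCoeff (∑ a ∈ s, vecMulVec (f a) (f a)) x j) ^ 2 ≤ 1 := by
  have hV := posSemidef_sum_vecMulVec s f
  set V := ∑ a ∈ s, vecMulVec (f a) (f a) with hVdef
  have hG := PosSemidef.add_smul_one hV (ridge_pos j)
  set G := V + ridge j • (1 : Matrix ι ι ℝ) with hGdef
  have h0 := PosDef.inv_form_nonneg hG x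
  have h1 : ∑ a ∈ s, (f a ⬝ᵥ G⁻¹ *ᵥ x) ^ 2 ≤ x ⬝ᵥ G⁻¹ *ᵥ x := by
    have e1 : ∑ a ∈ s, (f a ⬝ᵥ G⁻¹ *ᵥ x) ^ 2 = (G⁻¹ *ᵥ x) ⬝ᵥ V *ᵥ (G⁻¹ *ᵥ x) := by
      rw [hVdef, dotProduct_sum_vecMulVec_mulVec]
      simp only [sq]
    have e2 := dotProduct_add_smul_one_mulVec V (ridge j) (G⁻¹ *ᵥ x)
    rw [← hGdef, PosDef.mulVec_inv_mulVec hG, dotProduct_comm] at e2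
    have e3 : 0 ≤ (G⁻¹ *ᵥ x) ⬝ᵥ (G⁻¹ *ᵥ x) := dotProduct_self_nonneg _
    rw [e1, e2]
    nlinarith [ridge_pos j]
  simp only [ridgeCoeff, ← hGdef, dotProduct_smul, smul_eq_mul, mul_pow, ← Finset.mul_sum]
  rw [inv_pow, Real.sq_sqrt h0]
  exact inv_mul_le_one_of_le₀ h1 h0

/-- The ridge solution is u - r z with z = G⁻¹ u, and r z need not vanish in the limit: it retains
the kernel component of u. Regressors do not see the kernel, since (f a · z)² ≤ z·Vz, and this
leaves an error of order √r on them. -/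
theorem tendsto_dotProduct_ridge (s : Finset α) (f : α → ι → ℝ) {x u : ι → ℝ}
    (hu : (∑ a ∈ s, vecMulVec (f a) (f a)) *ᵥ u = x) {a : α} (ha : a ∈ s) :
    Tendsto (fun j => f a ⬝ᵥ ((∑ a ∈ s, vecMulVec (f a) (f a)) + ridge j • (1 : Matrix ι ι ℝ))⁻¹ *ᵥ x)
      atTop (𝓝 (f a ⬝ᵥ u)) := by
  have hV := posSemidef_sum_vecMulVec s f
  set V := ∑ a ∈ s, vecMulVec (f a) (f a) with hVdef
  have key : ∀ j, (f a ⬝ᵥ (V + ridge j • (1 : Matrix ι ι ℝ))⁻¹ *ᵥ x - f a ⬝ᵥ u) ^ 2 ≤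
      ridge j * (u ⬝ᵥ u) := by
    intro j
    have hr := ridge_pos j
    have hG := PosSemidef.add_smul_one hV hr
    set r := ridge j
    set G := V + r • (1 : Matrix ι ι ℝ) with hGdef
    set z := G⁻¹ *ᵥ u with hz
    have hGz : G *ᵥ z = u := PosDef.mulVec_inv_mulVec hG u
    have h1 : G⁻¹ *ᵥ x = u - r • z := by
      apply PosDef.inv_mulVec_eq hG
      rw [Matrix.mulVec_sub, Matrix.mulVec_smul, hGz, hGdef, Matrix.add_mulVec, hu,
        Matrix.smul_mulVec, Matrix.one_mulVec]
      simp
    have h2 : (f a ⬝ᵥ z) ^ 2 ≤ z ⬝ᵥ V *ᵥ z := by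
      rw [hVdef, dotProduct_sum_vecMulVec_mulVec]
      simp only [← sq]
      exact Finset.single_le_sum (f := fun a => (f a ⬝ᵥ z) ^ 2) (fun b _ => sq_nonneg _) ha
    have h3 := dotProduct_add_smul_one_mulVec V r z
    rw [← hGdef, hGz] at h3
    rw [h1, dotProduct_sub, dotProduct_smul, smul_eq_mul]
    -- Together with u·z = z·Vz + r z·z, this square yields r z·Vz ≤ u·u.
    have h4 : 0 ≤ (u - (r / 2) • z) ⬝ᵥ (u - (r / 2) • z) := dotProduct_self_nonneg _
    simp only [dotProduct_sub, sub_dotProduct, smul_dotProduct, dotProduct_smul, smul_eq_mul] at h4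
    rw [dotProduct_comm u z] at h4
    have h5 : 0 ≤ z ⬝ᵥ z := dotProduct_self_nonneg _
    have h6 : r * (z ⬝ᵥ V *ᵥ z) ≤ u ⬝ᵥ u := by nlinarith [mul_nonneg (mul_pos hr hr).le h5]
    nlinarith [mul_pos hr hr]
  rw [tendsto_iff_norm_sub_tendsto_zero]
  refine squeeze_zero (fun j => norm_nonneg _) (g := fun j => √(ridge j * (u ⬝ᵥ u)))
    (fun j => ?_) ?_
  · exact Real.abs_le_sqrt (key j)
  · have : Tendsto (fun j => √(ridge j * (u ⬝ᵥ u))) atTop (𝓝 √(0 * (u ⬝ᵥ u))) :=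
      (tendsto_ridge.mul_const _).sqrt
    simpa using this

/-- Along the normalized ridge predictions, a linear statistic converges to the normalized
least-squares statistic. -/
theorem tendsto_sum_ridgeCoeff (s : Finset α) (f : α → ι → ℝ) (g : α → ℝ) {x u : ι → ℝ}
    (hu : (∑ a ∈ s, vecMulVec (f a) (f a)) *ᵥ u = x) (hpos : 0 < x ⬝ᵥ u) :
    Tendsto (fun j => ∑ a ∈ s, (f a ⬝ᵥ ridgeCoeff (∑ a ∈ s, vecMulVec (f a) (f a)) x j) * g a)
      atTop (𝓝 ((∑ a ∈ s, (f a ⬝ᵥ u) * g a) / √(x ⬝ᵥ u))) := by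
  have hx : ∀ w : ι → ℝ, x ⬝ᵥ w = ∑ a ∈ s, (f a ⬝ᵥ w) * (f a ⬝ᵥ u) := by
    intro w
    rw [← dotProduct_sum_vecMulVec_mulVec, hu, dotProduct_comm]
  set V := ∑ a ∈ s, vecMulVec (f a) (f a) with hVdef
  have h1 : Tendsto (fun j => x ⬝ᵥ (V + ridge j • (1 : Matrix ι ι ℝ))⁻¹ *ᵥ x) atTop
      (𝓝 (x ⬝ᵥ u)) := by
    rw [hx u]
    simp_rw [hx (_ *ᵥ x)]
    exact tendsto_finsetSum _ fun a ha => (tendsto_dotProduct_ridge s f hu ha).mul_const _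
  have h2 : Tendsto (fun j => ∑ a ∈ s, (f a ⬝ᵥ (V + ridge j • (1 : Matrix ι ι ℝ))⁻¹ *ᵥ x) * g a)
      atTop (𝓝 (∑ a ∈ s, (f a ⬝ᵥ u) * g a)) :=
    tendsto_finsetSum _ fun a ha => (tendsto_dotProduct_ridge s f hu ha).mul_const _
  have h3 := (h1.sqrt.inv₀ (Real.sqrt_pos.2 hpos).ne').mul h2
  rw [inv_mul_eq_div] at h3
  refine h3.congr fun j => ?_
  simp only [ridgeCoeff, dotProduct_smul, smul_eq_mul, mul_assoc, Finset.mul_sum]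

/-- A vector outside of the range of a symmetric matrix is not orthogonal to its kernel. -/
theorem exists_mulVec_eq_zero_of_notMem_range {V : Matrix ι ι ℝ} (hV : V.IsHermitian) {x : ι → ℝ}
    (hx : ∀ u, V *ᵥ u ≠ x) : ∃ v, V *ᵥ v = 0 ∧ x ⬝ᵥ v ≠ 0 := by
  by_contra! hcon
  let W : Submodule ℝ (EuclideanSpace ℝ ι) := LinearMap.range (Matrix.toEuclideanLin V)
  have hmem : WithLp.toLp 2 x ∈ Wᗮᗮ := by
    rw [Submodule.mem_orthogonal]
    intro v hv
    have h1 : V *ᵥ v.ofLp = 0 := by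
      refine dotProduct_self_eq_zero.1 ?_
      have h2 := (Submodule.mem_orthogonal _ _).1 hv
        (Matrix.toEuclideanLin V (WithLp.toLp 2 (V *ᵥ v.ofLp))) (LinearMap.mem_range_self _ _)
      rw [EuclideanSpace.inner_eq_star_dotProduct] at h2
      simp only [star_trivial, Matrix.toLpLin_apply] at h2
      rwa [dotProduct_mulVec_comm hV] at h2
    have := hcon v.ofLp h1
    rw [EuclideanSpace.inner_eq_star_dotProduct]
    simpa using this
  rw [Submodule.orthogonal_orthogonal] at hmem
  obtain ⟨u, hu⟩ := hmem
  refine hx u.ofLp ?_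
  have := congrArg WithLp.ofLp hu
  simpa [Matrix.toLpLin_apply] using this

end Ridge

/-! ### Leverage scores under an arbitrary feature law. -/

section Leverage

variable {m M : ℕ}

/-- The Gram matrix of a sample. -/
def sampleGram (X : Fin M → Vec m) : Matrix (Fin m) (Fin m) ℝ :=
  ∑ l, vecMulVec (X l).ofLp (X l).ofLp

/-- The ridge leverage score of `x` in the sample `x, X`. -/
def ridgeLeverage (j : ℕ) (x : Vec m) (X : Fin M → Vec m) : ℝ :=
  x.ofLp ⬝ᵥ (vecMulVec x.ofLp x.ofLp + sampleGram X + ridge j • (1 : Matrix (Fin m) (Fin m) ℝ))⁻¹ *ᵥ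
    x.ofLp

/-- The leverage score of `x` in the sample `x, X`. -/
def leverage (x : Vec m) (X : Fin M → Vec m) : ℝ≥0∞ :=
  liminf (fun j => ENNReal.ofReal (ridgeLeverage j x X)) atTop

theorem measurable_ridgeLeverage (j : ℕ) :
    Measurable fun q : Vec m × (Fin M → Vec m) => ridgeLeverage j q.1 q.2 := by
  have h1 : Measurable fun q : Vec m × (Fin M → Vec m) => q.1.ofLp := by fun_prop
  refine measurable_dotProduct h1 (measurable_mulVec (measurable_inv_apply fun i k => ?_) h1)
  simp only [Matrix.add_apply, sampleGram, Matrix.sum_apply, vecMulVec_apply]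
  fun_prop

theorem measurable_leverage :
    Measurable fun q : Vec m × (Fin M → Vec m) => leverage q.1 q.2 :=
  Measurable.liminf fun j => (measurable_ridgeLeverage j).ennreal_ofReal

/-- Exchangeability: the mean leverage score of one of `M + 1` independent samples. -/
theorem lintegral_ridgeLeverage_le (D : Measure (Vec m)) [IsProbabilityMeasure D] (j : ℕ) :
    ∫⁻ q, ENNReal.ofReal (ridgeLeverage j q.1 q.2) ∂(D.prod (Measure.pi fun _ : Fin M => D)) ≤
      m / (M + 1 : ℕ) := by
  set J := ∫⁻ q, ENNReal.ofReal (ridgeLeverage j q.1 q.2)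
    ∂(D.prod (Measure.pi fun _ : Fin M => D)) with hJ
  have hf : Measurable fun q : Vec m × (Fin M → Vec m) =>
    ENNReal.ofReal (ridgeLeverage j q.1 q.2) := (measurable_ridgeLeverage j).ennreal_ofReal
  -- Each of the M + 1 samples may play the role of x with the same expectation, while the sum of
  -- all scores is at most m pointwise.
  have h1 : ∀ i : Fin (M + 1), ∫⁻ Y, ENNReal.ofReal (ridgeLeverage j (Y i) (i.removeNth Y))
      ∂(Measure.pi fun _ : Fin (M + 1) => D) = J := by
    intro i
    have h := measurePreserving_piFinSuccAbove (fun _ : Fin (M + 1) => D) i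
    rw [hJ, ← h.lintegral_comp hf]
    rfl
  have h2 : ∀ (Y : Fin (M + 1) → Vec m) (i : Fin (M + 1)), ridgeLeverage j (Y i) (i.removeNth Y) =
      (Y i).ofLp ⬝ᵥ (∑ l, vecMulVec (Y l).ofLp (Y l).ofLp +
        ridge j • (1 : Matrix (Fin m) (Fin m) ℝ))⁻¹ *ᵥ (Y i).ofLp := by
    intro Y i
    rw [Fin.sum_univ_succAbove _ i]
    rfl
  have h3 : ((M + 1 : ℕ) : ℝ≥0∞) * J ≤ m := by
    calc ((M + 1 : ℕ) : ℝ≥0∞) * J = ∑ _i : Fin (M + 1), J := by simp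
      _ = ∑ i : Fin (M + 1), ∫⁻ Y, ENNReal.ofReal (ridgeLeverage j (Y i) (i.removeNth Y))
            ∂(Measure.pi fun _ : Fin (M + 1) => D) := by simp only [h1]
      _ = ∫⁻ Y, ∑ i : Fin (M + 1), ENNReal.ofReal (ridgeLeverage j (Y i) (i.removeNth Y))
            ∂(Measure.pi fun _ : Fin (M + 1) => D) := by
          rw [lintegral_finsetSum]
          intro i _
          exact hf.comp (MeasurableEquiv.piFinSuccAbove (fun _ : Fin (M + 1) => Vec m) i).measurable
      _ ≤ ∫⁻ _, m ∂(Measure.pi fun _ : Fin (M + 1) => D) := by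
          refine lintegral_mono fun Y => ?_
          rw [← ENNReal.ofReal_sum_of_nonneg]
          · rw [← ENNReal.ofReal_natCast]
            refine ENNReal.ofReal_le_ofReal ?_
            simp only [h2]
            simpa using sum_ridge_leverage_le Finset.univ
              (fun l => (Y l).ofLp) (ridge_pos j)
          · intro i _
            rw [h2]
            exact PosDef.inv_form_nonneg
              (PosSemidef.add_smul_one (posSemidef_sum_vecMulVec _ _) (ridge_pos j)) _
      _ = m := by simp
  rw [ENNReal.le_div_iff_mul_le (by simp) (by simp), mul_comm]
  exact h3

/-- Fatou's lemma removes the ridge. This is why `leverage` is a lower limit: no convergence in j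
has to be proved. -/
theorem lintegral_leverage_le (D : Measure (Vec m)) [IsProbabilityMeasure D] :
    ∫⁻ x, ∫⁻ X, leverage x X ∂(Measure.pi fun _ : Fin M => D) ∂D ≤ m / (M + 1 : ℕ) := by
  rw [← lintegral_prod (fun q : Vec m × (Fin M → Vec m) => leverage q.1 q.2)
    measurable_leverage.aemeasurable]
  refine (lintegral_liminf_le fun j => (measurable_ridgeLeverage j).ennreal_ofReal).trans ?_
  refine liminf_le_of_frequently_le' (Frequently.of_forall fun j => ?_)
  exact lintegral_ridgeLeverage_le D j

/-- Cauchy–Schwarz in the dual norms: each test vector v gives a lower bound on the ridge leverage,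
in which the ridge contributes a multiple of v·v that tends to zero. -/
theorem le_leverage (x : Vec m) (X : Fin M → Vec m) {v : Fin m → ℝ} {a c : ℝ} (ha : 0 ≤ a)
    (hX : v ⬝ᵥ sampleGram X *ᵥ v ≤ a) (hc : x.ofLp ⬝ᵥ v = c) (hc0 : c ≠ 0) :
    ENNReal.ofReal (c ^ 2 / (a + c ^ 2)) ≤ leverage x X := by
  have hpos : 0 < c ^ 2 := by positivity
  have h1 : Tendsto (fun j => ENNReal.ofReal (c ^ 2 / (a + c ^ 2 + ridge j * (v ⬝ᵥ v)))) atTop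
      (𝓝 (ENNReal.ofReal (c ^ 2 / (a + c ^ 2)))) := by
    refine ENNReal.tendsto_ofReal (Tendsto.div tendsto_const_nhds ?_ (by positivity))
    simpa using (tendsto_ridge.mul_const (v ⬝ᵥ v)).const_add (a + c ^ 2)
  rw [← h1.liminf_eq]
  refine liminf_le_liminf (Eventually.of_forall fun j => ENNReal.ofReal_le_ofReal ?_)
  have hps : (vecMulVec x.ofLp x.ofLp + sampleGram X).PosSemidef :=
    (posSemidef_vecMulVec_self _).add (posSemidef_sum_vecMulVec _ _)
  have h2 := PosDef.dotProduct_sq_le (PosSemidef.add_smul_one hps (ridge_pos j)) x.ofLp v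
  rw [dotProduct_add_smul_one_mulVec, Matrix.add_mulVec, dotProduct_add,
    dotProduct_vecMulVec_mulVec, hc] at h2
  have hvv : 0 ≤ v ⬝ᵥ v := dotProduct_self_nonneg _
  have hr := ridge_pos j
  rw [div_le_iff₀ (by positivity)]
  refine h2.trans (mul_le_mul_of_nonneg_left ?_
    (PosDef.inv_form_nonneg (PosSemidef.add_smul_one hps (ridge_pos j)) _))
  linarith [sq c]

attribute [irreducible] leverage

theorem measurable_leverage_comp {Ω : Type*} {mΩ : MeasurableSpace Ω} {x : Ω → Vec m}
    {X : Ω → Fin M → Vec m} (hx : Measurable x) (hX : Measurable X) :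
    Measurable fun ω => leverage (x ω) (X ω) :=
  measurable_leverage.comp (hx.prodMk hX)

theorem measurable_lintegral_leverage (D : Measure (Vec m)) [IsProbabilityMeasure D] :
    Measurable fun x => ∫⁻ X, leverage x X ∂(Measure.pi fun _ : Fin M => D) :=
  measurable_leverage.lintegral_prod_right'

/-- A sample dominated by a design matrix `V` bounds the variance of the least-squares
prediction from `V`. -/
theorem leverage_dichotomy (x : Vec m) (X : Fin M → Vec m) {V : Matrix (Fin m) (Fin m) ℝ}
    (hV : V.PosSemidef) (hXV : ∀ v, v ⬝ᵥ sampleGram X *ᵥ v ≤ v ⬝ᵥ V *ᵥ v) :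
    1 ≤ leverage x X ∨ ∃ u, V *ᵥ u = x.ofLp ∧ 0 ≤ x.ofLp ⬝ᵥ u ∧
      ENNReal.ofReal ((x.ofLp ⬝ᵥ u) / (1 + x.ofLp ⬝ᵥ u)) ≤ leverage x X := by
  by_cases hx : ∃ u, V *ᵥ u = x.ofLp
  · right
    obtain ⟨u, hu⟩ := hx
    have h0 : 0 ≤ x.ofLp ⬝ᵥ u := by
      rw [← hu, dotProduct_comm]
      exact PosSemidef.form_nonneg hV u
    refine ⟨u, hu, h0, ?_⟩
    rcases h0.eq_or_lt with h | h
    · simp [← h]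
    · have h1 := le_leverage x X h0 (v := u) (c := x.ofLp ⬝ᵥ u)
        ((hXV u).trans (by rw [hu, dotProduct_comm])) rfl h.ne'
      refine le_trans (le_of_eq ?_) h1
      congr 1
      field_simp
  · left
    push Not at hx
    obtain ⟨v, hv, hxv⟩ := exists_mulVec_eq_zero_of_notMem_range hV.isHermitian hx
    have h1 := le_leverage x X le_rfl (v := v) ((hXV v).trans (by simp [hv])) rfl hxv
    rw [zero_add, div_self (by positivity)] at h1
    simpa using h1

/-- A level which the leverage score of `x` exceeds with probability at most `1 / 2`. -/
def leverageLevel (D : Measure (Vec m)) (M : ℕ) (x : Vec m) : ℝ≥0∞ :=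
  2 * (∫⁻ X, leverage x X ∂(Measure.pi fun _ : Fin M => D) + m / (M + 1 : ℕ))

theorem measurable_leverageLevel (D : Measure (Vec m)) [IsProbabilityMeasure D] :
    Measurable (leverageLevel D M) :=
  ((measurable_lintegral_leverage D).add measurable_const).const_mul _

theorem lintegral_leverageLevel_le (D : Measure (Vec m)) [IsProbabilityMeasure D] :
    ∫⁻ x, leverageLevel D M x ∂D ≤ 4 * (m / (M + 1 : ℕ)) := by
  unfold leverageLevel
  rw [lintegral_const_mul _ ((measurable_lintegral_leverage D).add_const _),
    lintegral_add_right _ measurable_const, lintegral_const, measure_univ, mul_one]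
  calc 2 * (∫⁻ x, ∫⁻ X, leverage x X ∂(Measure.pi fun _ : Fin M => D) ∂D + m / (M + 1 : ℕ))
      ≤ 2 * ((m / (M + 1 : ℕ) : ℝ≥0∞) + m / (M + 1 : ℕ)) := by
        gcongr; exact lintegral_leverage_le D
    _ = 4 * (m / (M + 1 : ℕ)) := by ring

/-- Markov's inequality at a level at least twice the conditional mean given x. -/
theorem measure_leverageLevel_lt_le (D : Measure (Vec m)) [IsProbabilityMeasure D] (hm : 1 ≤ m)
    (x : Vec m) :
    (Measure.pi fun _ : Fin M => D) {X | leverageLevel D M x < leverage x X} ≤ 2⁻¹ := by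
  set J := ∫⁻ X, leverage x X ∂(Measure.pi fun _ : Fin M => D) with hJ
  -- The summm and m/(M+1) in the level keeps it positive where the mean vanishes, so that Markov's
  -- inequality may divide by it.
  have hpos : (m : ℝ≥0∞) / (M + 1 : ℕ) ≠ 0 := by
    rw [ne_eq, ENNReal.div_eq_zero_iff]
    simp; omega
  rcases eq_or_ne (leverageLevel D M x) ⊤ with h | h
  · simp [h]
  have h0 : leverageLevel D M x ≠ 0 := by
    simp only [leverageLevel, ne_eq, mul_eq_zero, add_eq_zero, not_or, not_and]
    exact ⟨by simp, fun _ => hpos⟩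
  have hme : Measurable fun X : Fin M → Vec m => leverage x X :=
    measurable_leverage_comp measurable_const measurable_id
  calc (Measure.pi fun _ : Fin M => D) {X | leverageLevel D M x < leverage x X}
      ≤ (Measure.pi fun _ : Fin M => D) {X | leverageLevel D M x ≤ leverage x X} :=
        measure_mono (by intro X hX; simp only [Set.mem_ofPred_eq] at hX ⊢; exact hX.le)
    _ ≤ J / leverageLevel D M x := meas_ge_le_lintegral_div hme.aemeasurable h0 h
    _ ≤ 2⁻¹ := by
        rw [ENNReal.div_le_iff h0 h, leverageLevel, ← mul_assoc,
          ENNReal.inv_mul_cancel (by simp) (by simp), one_mul]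
        exact le_self_add

/-- Independent blocks: it is unlikely that the leverage scores of `x` in `B` independent
samples are all large. -/
theorem measure_forall_leverageLevel_lt_le {Ω : Type*} {mΩ : MeasurableSpace Ω} {P : Measure Ω}
    (D : Measure (Vec m)) [IsProbabilityMeasure D] (hm : 1 ≤ m) {B : ℕ} {x : Ω → Vec m}
    {X : Fin B → Fin M → Ω → Vec m} (hx : Measurable x) (hX : ∀ β l, Measurable (X β l))
    (hlaw : P.map (fun ω => (x ω, fun β l => X β l ω)) =
      D.prod (Measure.pi fun _ : Fin B => Measure.pi fun _ : Fin M => D)) :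
    P {ω | ∀ β, leverageLevel D M (x ω) < leverage (x ω) fun l => X β l ω} ≤ 2⁻¹ ^ B := by
  let S : Set (Vec m × (Fin B → Fin M → Vec m)) :=
    {q | ∀ β, leverageLevel D M q.1 < leverage q.1 (q.2 β)}
  have hS : MeasurableSet S := by
    simp only [S, Set.ofPred_forall]
    refine MeasurableSet.iInter fun β => measurableSet_lt
      ((measurable_leverageLevel D).comp measurable_fst) ?_
    exact measurable_leverage_comp measurable_fst ((measurable_pi_apply β).comp measurable_snd)
  have hmeas : Measurable fun ω => (x ω, fun β l => X β l ω) := by fun_prop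
  have h1 : P {ω | ∀ β, leverageLevel D M (x ω) < leverage (x ω) fun l => X β l ω} =
      (P.map (fun ω => (x ω, fun β l => X β l ω))) S := by
    rw [Measure.map_apply hmeas hS]
    rfl
  rw [h1, hlaw, Measure.prod_apply hS]
  calc ∫⁻ y, (Measure.pi fun _ : Fin B => Measure.pi fun _ : Fin M => D) (Prod.mk y ⁻¹' S) ∂D
      ≤ ∫⁻ _, 2⁻¹ ^ B ∂D := by
        refine lintegral_mono fun y => ?_
        have : Prod.mk y ⁻¹' S =
            Set.univ.pi fun _ : Fin B => {Y | leverageLevel D M y < leverage y Y} := by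
          ext Y; simp [S]
        rw [this, Measure.pi_pi]
        calc _ ≤ ∏ _i : Fin B, (2⁻¹ : ℝ≥0∞) :=
              Finset.prod_le_prod' fun i _ => measure_leverageLevel_lt_le D hm y
          _ = _ := by simp
    _ = 2⁻¹ ^ B := by simp

end Leverage

/-! ### Projections and means of the noise; the conditional mean cost. -/

section NoiseLaw

variable {m d k : ℕ}

instance (I : Problem m d k) : IsProbabilityMeasure I.noiseLaw := by
  unfold Problem.noiseLaw; infer_instance

theorem posSemidef_sq_smul_one (s : ℝ) :
    (s ^ 2 • (1 : Matrix (Fin d) (Fin d) ℝ)).PosSemidef :=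
  Matrix.PosSemidef.one.smul (sq_nonneg s)

theorem map_inner_multivariateGaussian (s : ℝ≥0) (w : Vec d) :
    (multivariateGaussian 0 ((s : ℝ) ^ 2 • (1 : Matrix (Fin d) (Fin d) ℝ))).map
      (fun e => inner ℝ w e) = gaussianReal 0 (s ^ 2 * ‖w‖₊ ^ 2) := by
  have h := IsGaussian.map_eq_gaussianReal
    (μ := multivariateGaussian 0 ((s : ℝ) ^ 2 • (1 : Matrix (Fin d) (Fin d) ℝ))) (innerSL ℝ w)
  have h1 : (fun e => inner ℝ w e) = (innerSL ℝ w : Vec d → ℝ) := rfl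
  rw [h1, h]
  congr 1
  · have := ContinuousLinearMap.integral_comp_comm (innerSL ℝ w) (φ := fun x => x)
      (μ := multivariateGaussian 0 ((s : ℝ) ^ 2 • (1 : Matrix (Fin d) (Fin d) ℝ)))
      IsGaussian.integrable_fun_id
    rw [this]
    simp
  · have h2 := covarianceBilin_self (μ := multivariateGaussian 0
      ((s : ℝ) ^ 2 • (1 : Matrix (Fin d) (Fin d) ℝ))) IsGaussian.memLp_two_id w
    rw [covarianceBilin_multivariateGaussian (posSemidef_sq_smul_one _)] at h2
    have h3 : Var[innerSL ℝ w; multivariateGaussian 0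
      ((s : ℝ) ^ 2 • (1 : Matrix (Fin d) (Fin d) ℝ))] = (s : ℝ) ^ 2 * ‖w‖ ^ 2 := by
      rw [h1] at h2
      rw [← h2, Matrix.smul_mulVec, Matrix.one_mulVec, dotProduct_smul, EuclideanSpace.norm_sq_eq]
      simp [dotProduct, sq]
    rw [h3]
    ext
    rw [Real.coe_toNNReal _ (by positivity)]
    simp

theorem Problem.integral_inner_noise (I : Problem m d k) (w : Vec d) :
    Integrable (fun e : Vec d × ℝ => (inner ℝ w e.1 : ℝ)) I.noiseLaw ∧
      ∫ e, (inner ℝ w e.1 : ℝ) ∂I.noiseLaw = 0 := by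
  have h : I.noiseLaw.map (fun e => (inner ℝ w e.1 : ℝ)) = gaussianReal 0 (I.σ ^ 2 * ‖w‖₊ ^ 2) := by
    rw [← map_inner_multivariateGaussian, ← Measure.fst_prod
      (μ := multivariateGaussian 0 ((I.σ : ℝ) ^ 2 • (1 : Matrix (Fin d) (Fin d) ℝ)))
      (ν := gaussianReal 0 (I.σ ^ 2)), Measure.fst, Measure.map_map (by fun_prop) measurable_fst]
    rfl
  have hm : Measurable fun e : Vec d × ℝ => (inner ℝ w e.1 : ℝ) := by fun_prop
  constructor
  · have := IsGaussian.integrable_id (μ := gaussianReal 0 (I.σ ^ 2 * ‖w‖₊ ^ 2))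
    rw [← h] at this
    exact this.comp_measurable hm
  · have := integral_id_gaussianReal (μ := 0) (v := I.σ ^ 2 * ‖w‖₊ ^ 2)
    rw [← h, integral_map hm.aemeasurable (by fun_prop)] at this
    exact this

theorem Problem.integral_snd_noise (I : Problem m d k) :
    Integrable (fun e : Vec d × ℝ => e.2) I.noiseLaw ∧ ∫ e, e.2 ∂I.noiseLaw = 0 := by
  have h : I.noiseLaw.map Prod.snd = gaussianReal 0 (I.σ ^ 2) := by
    rw [Problem.noiseLaw]
    exact Measure.snd_prod
  constructor
  · have := IsGaussian.integrable_id (μ := gaussianReal 0 (I.σ ^ 2))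
    rw [← h] at this
    exact this.comp_measurable measurable_snd
  · have := integral_id_gaussianReal (μ := 0) (v := I.σ ^ 2)
    rw [← h, integral_map measurable_snd.aemeasurable (by fun_prop)] at this
    exact this

/-- The mean cost of action `a` given the feature `x`. -/
def Problem.meanCost (I : Problem m d k) (x : Vec m) (a : Fin k) : ℝ :=
  inner ℝ (I.F a x) (I.act a) + inner ℝ I.μ (I.act a)

theorem Problem.cost_eq (I : Problem m d k) (a : Fin k) (z : Vec m × Vec d × ℝ) :
    I.cost a z = I.meanCost z.1 a + (inner ℝ (I.act a) z.2.1 + z.2.2) := by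
  simp only [Problem.cost, Problem.label, Problem.banditCost, Problem.meanCost, inner_add_left]
  rw [real_inner_comm z.2.1]
  ring

theorem Problem.expectedCost_eq (I : Problem m d k) (x : Vec m) (a : Fin k) :
    I.expectedCost x a = I.meanCost x a := by
  have h : Integrable (fun e : Vec d × ℝ => inner ℝ (I.act a) e.1 + e.2) I.noiseLaw :=
    (I.integral_inner_noise _).1.add I.integral_snd_noise.1
  simp only [Problem.expectedCost, Problem.cost_eq]
  rw [integral_add (integrable_const _) h, integral_add (I.integral_inner_noise _).1 I.integral_snd_noise.1,
    (I.integral_inner_noise _).2, I.integral_snd_noise.2]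
  simp

end NoiseLaw

/-! ### Independence of all features and noises. -/

section Independence

set_option linter.unusedSectionVars false

variable {m d k n : ℕ} {Ω : Type*}

/-- The σ-algebra of the features (`false`) or of the noise (`true`) of one sample. -/
@[reducible] def part (ξ : ℕ → Fin n → Ω → Vec m × Vec d × ℝ) (q : (ℕ × Fin n) × Bool) :
    MeasurableSpace Ω :=
  if q.2 then MeasurableSpace.comap (fun ω => (ξ q.1.1 q.1.2 ω).2) inferInstance
  else MeasurableSpace.comap (fun ω => (ξ q.1.1 q.1.2 ω).1) inferInstance

/-- The σ-algebra generated by a set of features and noises. -/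
@[reducible] def past (ξ : ℕ → Fin n → Ω → Vec m × Vec d × ℝ) (S : Set ((ℕ × Fin n) × Bool)) :
    MeasurableSpace Ω :=
  ⨆ q ∈ S, part ξ q

/-- What is drawn before the noise of round `t`. -/
def beforeNoise (n t : ℕ) : Set ((ℕ × Fin n) × Bool) :=
  {q | q.1.1 < t ∨ (q.1.1 = t ∧ q.2 = false)}

theorem measurable_blocks {mΩ : MeasurableSpace Ω} {B M : ℕ} {X : Fin B → Fin M → Ω → Vec m}
    (hX : ∀ β l, Measurable (X β l)) : Measurable fun ω β l => X β l ω := by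
  fun_prop

theorem part_le_past {ξ : ℕ → Fin n → Ω → Vec m × Vec d × ℝ} {S : Set ((ℕ × Fin n) × Bool)}
    {q : (ℕ × Fin n) × Bool} (hq : q ∈ S) : part ξ q ≤ past ξ S :=
  le_iSup₂_of_le q hq le_rfl

theorem past_mono {ξ : ℕ → Fin n → Ω → Vec m × Vec d × ℝ} {S T : Set ((ℕ × Fin n) × Bool)}
    (h : S ⊆ T) : past ξ S ≤ past ξ T :=
  iSup₂_le fun _ hq => part_le_past (h hq)

theorem measurable_feature_part (ξ : ℕ → Fin n → Ω → Vec m × Vec d × ℝ) (q : ℕ × Fin n) :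
    Measurable[part ξ (q, false)] fun ω => (ξ q.1 q.2 ω).1 := by
  simpa [part] using comap_measurable _

theorem measurable_noise_part (ξ : ℕ → Fin n → Ω → Vec m × Vec d × ℝ) (q : ℕ × Fin n) :
    Measurable[part ξ (q, true)] fun ω => (ξ q.1 q.2 ω).2 := by
  simpa [part] using comap_measurable _

theorem history_sup_features_le (ξ : ℕ → Fin n → Ω → Vec m × Vec d × ℝ) (t : ℕ) :
    history ξ t ⊔ features ξ t ≤ past ξ (beforeNoise n t) := by
  refine sup_le (iSup_le fun s => iSup_le fun i => ?_) (iSup_le fun i => ?_)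
  · have h1 : Measurable[past ξ (beforeNoise n t)] fun ω => (ξ s i ω).1 :=
      (measurable_feature_part ξ ((s : ℕ), i)).mono (part_le_past (Or.inl s.2)) le_rfl
    have h2 : Measurable[past ξ (beforeNoise n t)] fun ω => (ξ s i ω).2 :=
      (measurable_noise_part ξ ((s : ℕ), i)).mono (part_le_past (Or.inl s.2)) le_rfl
    exact (h1.prodMk h2).comap_le
  · have h1 : Measurable[past ξ (beforeNoise n t)] fun ω => (ξ t i ω).1 :=
      (measurable_feature_part ξ (t, i)).mono (part_le_past (Or.inr ⟨rfl, rfl⟩)) le_rfl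
    exact h1.comap_le

variable [mΩ : MeasurableSpace Ω] {P : Measure Ω} {ξ : ℕ → Fin n → Ω → Vec m × Vec d × ℝ}

theorem part_le (hξ : ∀ t i, Measurable (ξ t i)) (q : (ℕ × Fin n) × Bool) : part ξ q ≤ mΩ := by
  unfold part
  split_ifs
  · exact (measurable_snd.comp (hξ _ _)).comap_le
  · exact (measurable_fst.comp (hξ _ _)).comap_le

theorem past_le (hξ : ∀ t i, Measurable (ξ t i)) (S : Set ((ℕ × Fin n) × Bool)) :
    past ξ S ≤ mΩ :=
  iSup₂_le fun q _ => part_le hξ q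

variable [IsProbabilityMeasure P]

theorem map_feature {I : Problem m d k} [IsProbabilityMeasure I.D]
    (hξ : ∀ t i, Measurable (ξ t i)) (hlaw : ∀ t i, P.map (ξ t i) = I.sampleLaw) (q : ℕ × Fin n) :
    P.map (fun ω => (ξ q.1 q.2 ω).1) = I.D := by
  have : (fun ω => (ξ q.1 q.2 ω).1) = Prod.fst ∘ ξ q.1 q.2 := rfl
  rw [this, ← Measure.map_map measurable_fst (hξ _ _), hlaw, Problem.sampleLaw]
  exact Measure.fst_prod

theorem map_noise {I : Problem m d k} [IsProbabilityMeasure I.D]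
    (hξ : ∀ t i, Measurable (ξ t i)) (hlaw : ∀ t i, P.map (ξ t i) = I.sampleLaw) (q : ℕ × Fin n) :
    P.map (fun ω => (ξ q.1 q.2 ω).2) = I.noiseLaw := by
  have : (fun ω => (ξ q.1 q.2 ω).2) = Prod.snd ∘ ξ q.1 q.2 := rfl
  rw [this, ← Measure.map_map measurable_snd (hξ _ _), hlaw, Problem.sampleLaw]
  exact Measure.snd_prod

/-- The features and the noises of all samples are independent. -/
theorem iIndep_part {I : Problem m d k} [IsProbabilityMeasure I.D]
    (hξ : ∀ t i, Measurable (ξ t i)) (hlaw : ∀ t i, P.map (ξ t i) = I.sampleLaw)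
    (hind : iIndepFun (fun p : ℕ × Fin n => ξ p.1 p.2) P) : iIndep (part ξ) P := by
  classical
  rw [iIndep_iff]
  intro s f hf
  -- Padding with the whole space completes each sample to a pair (feature event, noise event). The
  -- product formula then splits into independence across samples and independence within a sample.
  set g : (ℕ × Fin n) × Bool → Set Ω := fun q => if q ∈ s then f q else Set.univ with hg
  have hgm : ∀ q, MeasurableSet[part ξ q] (g q) := by
    intro q
    simp only [hg]
    split_ifs with h
    · exact hf q h
    · exact MeasurableSet.univ
  have hpair : ∀ p, P (g (p, false) ∩ g (p, true)) = P (g (p, false)) * P (g (p, true)) := by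
    intro p
    have h : IndepFun (fun ω => (ξ p.1 p.2 ω).1) (fun ω => (ξ p.1 p.2 ω).2) P := by
      rw [indepFun_iff_map_prod_eq_prod_map_map (hξ p.1 p.2).fst.aemeasurable
        (hξ p.1 p.2).snd.aemeasurable, map_feature hξ hlaw, map_noise hξ hlaw]
      exact hlaw p.1 p.2
    rw [IndepFun_iff] at h
    exact h _ _ (by simpa [part] using hgm (p, false)) (by simpa [part] using hgm (p, true))
  have hset : ⋂ q ∈ s, f q = ⋂ p ∈ s.image Prod.fst, (g (p, false) ∩ g (p, true)) := by
    ext ω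
    simp only [Set.mem_iInter, Set.mem_inter_iff, Finset.mem_image]
    constructor
    · intro h p _
      constructor <;>
      · simp only [hg]
        split_ifs with h'
        · exact h _ h'
        · trivial
    · rintro h ⟨p, c⟩ hq
      have := h p ⟨_, hq, rfl⟩
      cases c
      · have := this.1; simpa [hg, hq] using this
      · have := this.2; simpa [hg, hq] using this
  have hmeas : ∀ p ∈ s.image Prod.fst,
      MeasurableSet[MeasurableSpace.comap (ξ p.1 p.2) inferInstance] (g (p, false) ∩ g (p, true)) := by
    intro p _
    have h0 : Measurable[MeasurableSpace.comap (ξ p.1 p.2) inferInstance] (ξ p.1 p.2) :=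
      comap_measurable _
    refine MeasurableSet.inter ?_ ?_
    · exact (measurable_fst.comp h0).comap_le _ (by simpa [part] using hgm (p, false))
    · exact (measurable_snd.comp h0).comap_le _ (by simpa [part] using hgm (p, true))
  rw [hset, hind.meas_biInter hmeas]
  calc ∏ p ∈ s.image Prod.fst, P (g (p, false) ∩ g (p, true))
      = ∏ p ∈ s.image Prod.fst, ∏ c : Bool, P (g (p, c)) := by
        refine Finset.prod_congr rfl fun p _ => ?_
        rw [hpair, Fintype.prod_bool, mul_comm]
    _ = ∏ q ∈ s.image Prod.fst ×ˢ Finset.univ, P (g q) := by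
        rw [Finset.prod_product]
    _ = ∏ q ∈ s, P (g q) := by
        symm
        refine Finset.prod_subset ?_ ?_
        · intro q hq
          simp only [Finset.mem_product, Finset.mem_univ, and_true]
          exact Finset.mem_image_of_mem _ hq
        · intro q _ hq
          simp [hg, hq]
    _ = ∏ q ∈ s, P (f q) := by
        refine Finset.prod_congr rfl fun q hq => ?_
        simp [hg, hq]

/-- The form in which noises are separated from the past: filtrations are generated by index sets of
features and noises, and independence of a new variable reduces to its index lying outside the set.
-/
theorem indep_past_part {I : Problem m d k} [IsProbabilityMeasure I.D]
    (hξ : ∀ t i, Measurable (ξ t i)) (hlaw : ∀ t i, P.map (ξ t i) = I.sampleLaw)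
    (hind : iIndepFun (fun p : ℕ × Fin n => ξ p.1 p.2) P) {S : Set ((ℕ × Fin n) × Bool)}
    {q : (ℕ × Fin n) × Bool} (hq : q ∉ S) : Indep (past ξ S) (part ξ q) P := by
  have h := indep_iSup_of_disjoint (part_le hξ) (iIndep_part hξ hlaw hind)
    (S := S) (T := {q}) (by simpa using hq)
  simpa using h

/-- The joint law of one feature vector and of disjoint blocks of other feature vectors. -/
theorem map_feature_blocks {I : Problem m d k} [IsProbabilityMeasure I.D]
    (hξ : ∀ t i, Measurable (ξ t i)) (hlaw : ∀ t i, P.map (ξ t i) = I.sampleLaw)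
    (hind : iIndepFun (fun p : ℕ × Fin n => ξ p.1 p.2) P) {B M : ℕ} (q₀ : ℕ × Fin n)
    (idx : Fin B × Fin M → ℕ × Fin n) (hidx : Function.Injective idx) (hq₀ : ∀ c, idx c ≠ q₀) :
    P.map (fun ω => ((ξ q₀.1 q₀.2 ω).1, fun β l => (ξ (idx (β, l)).1 (idx (β, l)).2 ω).1)) =
      I.D.prod (Measure.pi fun _ : Fin B => Measure.pi fun _ : Fin M => I.D) := by
  have hx : ∀ q : ℕ × Fin n, Measurable fun ω => (ξ q.1 q.2 ω).1 := fun q =>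
    measurable_fst.comp (hξ _ _)
  have hX : Measurable fun ω => fun (β : Fin B) (l : Fin M) =>
      (ξ (idx (β, l)).1 (idx (β, l)).2 ω).1 :=
    measurable_pi_iff.2 fun β => measurable_pi_iff.2 fun l => hx _
  have h1 : IndepFun (fun ω => (ξ q₀.1 q₀.2 ω).1) (fun ω => fun (β : Fin B) (l : Fin M) =>
      (ξ (idx (β, l)).1 (idx (β, l)).2 ω).1) P := by
    refine IndepFun.symm ?_
    rw [IndepFun_iff_Indep]
    have h := indep_past_part hξ hlaw hind (S := Set.range fun c => (idx c, false))
      (q := (q₀, false)) (by rintro ⟨c, hc⟩; exact hq₀ c (congrArg Prod.fst hc))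
    refine indep_of_indep_of_le_right (indep_of_indep_of_le_left h ?_)
      (measurable_feature_part ξ q₀).comap_le
    refine Measurable.comap_le (measurable_blocks (mΩ := past ξ _) fun β l => ?_)
    exact (measurable_feature_part ξ (idx (β, l))).mono (part_le_past ⟨(β, l), rfl⟩) le_rfl
  have h2 : P.map (fun ω (c : Fin B × Fin M) => (ξ (idx c).1 (idx c).2 ω).1) =
      Measure.pi fun _ => I.D := by
    have h3 : iIndepFun (fun (c : Fin B × Fin M) ω => (ξ (idx c).1 (idx c).2 ω).1) P :=
      (hind.precomp hidx).comp (fun _ => Prod.fst) fun _ => measurable_fst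
    rw [(iIndepFun_iff_map_fun_eq_pi_map fun c => (hx (idx c)).aemeasurable).1 h3]
    simp only [map_feature hξ hlaw]
  rw [(indepFun_iff_map_prod_eq_prod_map_map (hx q₀).aemeasurable hX.aemeasurable).1 h1,
    map_feature hξ hlaw]
  congr 1
  have h4 := Measure.infinitePi_map_curry (ι := Fin B) (κ := Fin M) (X := Vec m)
    (μ := fun _ _ => I.D)
  simp only [Measure.infinitePi_eq_pi] at h4
  rw [← h4, ← h2, Measure.map_map (MeasurableEquiv.measurable _)
    (measurable_pi_iff.2 fun c => hx (idx c))]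
  rfl

end Independence

/-! ### From the exponential bound to a self-normalized tail bound. -/

section SelfNormalizedTail

theorem measure_setOf_le_of_ae_imp {Ω : Type*} {mΩ : MeasurableSpace Ω} {P : Measure Ω}
    {p q : Ω → Prop} (h : ∀ᵐ ω ∂P, p ω → q ω) : P {ω | p ω} ≤ P {ω | q ω} := by
  refine measure_mono_ae (ae_le_set.2 (measure_mono_null ?_ (ae_iff.1 h)))
  intro ω hω
  simpa using hω

variable {ι Ω : Type*} [Fintype ι] [DecidableEq ι] {mΩ : MeasurableSpace Ω} {P : Measure Ω}
  [IsProbabilityMeasure P]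

/-- The self-normalized tail bound for vector-valued martingales with conditionally Gaussian
increments. -/
theorem measure_selfNormalized_ge_le {𝓕 : ℕ → MeasurableSpace Ω} (h𝓕 : ∀ p, 𝓕 p ≤ mΩ)
    (hmono : Monotone 𝓕) {φ : ℕ → Ω → ι → ℝ} {g : ℕ → Ω → ℝ} (hφ : ∀ p, Measurable[𝓕 p] (φ p))
    (hg : ∀ p, Measurable[𝓕 (p + 1)] (g p))
    (hind : ∀ p, Indep (𝓕 p) (MeasurableSpace.comap (g p) inferInstance) P) {v : ℕ → ℝ≥0} {θ : ℝ}
    (hlaw : ∀ p, P.map (g p) = gaussianReal 0 (v p)) (hθ : 0 < θ) (hv : ∀ p, θ * v p ≤ 1)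
    {G : Matrix ι ι ℝ} (hG : G.PosDef) (N : ℕ) {R δ : ℝ} (hR : 0 < R) (hδ : 0 < δ)
    (hdet : ∀ᵐ ω ∂P, (G + ∑ p ∈ Finset.range N, vecMulVec (φ p ω) (φ p ω)).det ≤ R * G.det) :
    P {ω | 2 / θ * (Real.log (1 / δ) + Real.log R / 2) ≤ (∑ p ∈ Finset.range N, g p ω • φ p ω) ⬝ᵥ
        (G + ∑ p ∈ Finset.range N, vecMulVec (φ p ω) (φ p ω))⁻¹ *ᵥ
          (∑ p ∈ Finset.range N, g p ω • φ p ω)} ≤ ENNReal.ofReal δ := by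
  have key := lintegral_selfNormalized_le h𝓕 hmono hφ hg hind hlaw hθ.le hv hG N
  have hφm : ∀ p, Measurable (φ p) := fun p => (hφ p).mono (h𝓕 _) le_rfl
  have hgm : ∀ p, Measurable (g p) := fun p => (hg p).mono (h𝓕 _) le_rfl
  set H : Ω → Matrix ι ι ℝ := fun ω => G + ∑ p ∈ Finset.range N, vecMulVec (φ p ω) (φ p ω) with hH
  set S : Ω → ι → ℝ := fun ω => ∑ p ∈ Finset.range N, g p ω • φ p ω with hS
  have hHpd : ∀ ω, (H ω).PosDef := fun ω => hG.add_posSemidef (posSemidef_sum_vecMulVec _ _)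
  have hHm : ∀ i j, Measurable fun ω => H ω i j := by
    intro i j
    simp only [hH, Matrix.add_apply]
    exact measurable_const.add (measurable_sum_vecMulVec_apply _ (fun p _ => hφm p) i j)
  have hSm : Measurable S := Finset.measurable_sum _ fun p _ => (hgm p).smul (hφm p)
  have hQm : Measurable fun ω => S ω ⬝ᵥ (H ω)⁻¹ *ᵥ S ω :=
    measurable_dotProduct hSm (measurable_mulVec (measurable_inv_apply hHm) hSm)
  have hdm := measurable_det hHm
  set f : Ω → ℝ≥0∞ := fun ω =>
    ENNReal.ofReal (Real.exp (θ / 2 * (S ω ⬝ᵥ (H ω)⁻¹ *ᵥ S ω)) / √(H ω).det) with hf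
  have hfm : Measurable f :=
    ((Real.measurable_exp.comp (hQm.const_mul _)).div hdm.sqrt).ennreal_ofReal
  have hGd : 0 < √G.det := Real.sqrt_pos.2 hG.det_pos
  -- On the event the supermartingale is at least c by the determinant bound, whereas its mean is at
  -- most 1/√det G; Markov's inequality leaves exactly δ.
  set c : ℝ := 1 / δ * (1 / √G.det) with hc
  have hc0 : 0 < c := by positivity
  have hsub : ∀ᵐ ω ∂P, 2 / θ * (Real.log (1 / δ) + Real.log R / 2) ≤ S ω ⬝ᵥ (H ω)⁻¹ *ᵥ S ω →
      ENNReal.ofReal c ≤ f ω := by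
    filter_upwards [hdet] with ω hω hQ
    refine ENNReal.ofReal_le_ofReal ?_
    have h1 : Real.log (1 / δ) + Real.log R / 2 ≤ θ / 2 * (S ω ⬝ᵥ (H ω)⁻¹ *ᵥ S ω) := by
      have := mul_le_mul_of_nonneg_left hQ (show 0 ≤ θ / 2 by positivity)
      refine le_trans (le_of_eq ?_) this
      field_simp
    have h2 : 1 / δ * √R ≤ Real.exp (θ / 2 * (S ω ⬝ᵥ (H ω)⁻¹ *ᵥ S ω)) := by
      refine le_trans (le_of_eq ?_) (Real.exp_le_exp.2 h1)
      rw [Real.exp_add, Real.exp_log (by positivity), ← Real.log_sqrt hR.le,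
        Real.exp_log (Real.sqrt_pos.2 hR)]
    have h3 : √(H ω).det ≤ √R * √G.det := by
      rw [← Real.sqrt_mul hR.le]
      exact Real.sqrt_le_sqrt hω
    have h4 : 0 < √(H ω).det := Real.sqrt_pos.2 (hHpd ω).det_pos
    rw [le_div_iff₀ h4]
    calc c * √(H ω).det ≤ c * (√R * √G.det) := by gcongr
      _ = 1 / δ * √R := by rw [hc]; field_simp
      _ ≤ _ := h2
  calc P {ω | 2 / θ * (Real.log (1 / δ) + Real.log R / 2) ≤ S ω ⬝ᵥ (H ω)⁻¹ *ᵥ S ω}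
      ≤ P {ω | ENNReal.ofReal c ≤ f ω} := measure_setOf_le_of_ae_imp hsub
    _ ≤ (∫⁻ ω, f ω ∂P) / ENNReal.ofReal c :=
        meas_ge_le_lintegral_div hfm.aemeasurable (by simpa using hc0) (by simp)
    _ ≤ ENNReal.ofReal (1 / √G.det) / ENNReal.ofReal c := by gcongr
    _ = ENNReal.ofReal δ := by
        rw [← ENNReal.ofReal_div_of_pos hc0]
        congr 1
        rw [hc]; field_simp

end SelfNormalizedTail

/-! ### The confidence ball for μ. -/

section Confidence

variable {m d k n : ℕ} {Ω : Type*} {I : Problem m d k} {b : Fin d → Vec d} {γ KC Kμ : ℝ}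
  {ξ : ℕ → Fin n → Ω → Vec m × Vec d × ℝ} {A : ℕ → Fin n → Ω → Fin k}

theorem inner_eq_dotProduct {r : ℕ} (x y : Vec r) : (inner ℝ x y : ℝ) = x.ofLp ⬝ᵥ y.ofLp := by
  rw [EuclideanSpace.inner_eq_star_dotProduct, dotProduct_comm]
  simp

theorem IsBarycentricSpanner.linearIndependent_ofLp (hb : IsBarycentricSpanner I.act b) :
    LinearIndependent ℝ fun j => (b j).ofLp := by
  have := hb.linearIndependent.map' (WithLp.linearEquiv 2 ℝ (Fin d → ℝ)).toLinearMap
    (LinearEquiv.ker _)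
  exact this

theorem IsBarycentricSpanner.posDef (hb : IsBarycentricSpanner I.act b) :
    (∑ j, vecMulVec (b j).ofLp (b j).ofLp).PosDef :=
  posDef_sum_vecMulVec_of_linearIndependent hb.linearIndependent_ofLp

theorem IsBarycentricSpanner.posDef_gram (hb : IsBarycentricSpanner I.act b) (t : ℕ) (i : Fin n)
    (ω : Ω) : (gram I b A t i ω).PosDef :=
  hb.posDef.add_posSemidef (posSemidef_sum_vecMulVec _ _)

theorem IsBarycentricSpanner.card_le (hb : IsBarycentricSpanner I.act b) : d ≤ k := by
  choose f hf using hb.mem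
  have : Function.Injective f := by
    intro j j' h
    apply hb.linearIndependent.injective
    rw [← hf j, ← hf j', h]
  simpa using Fintype.card_le_of_injective f this

/-- Only the ratio of determinants matters later, so neither the length nor the conditioning of the
spanner enters. The base is t because t - 1 rounds are added to the identity. -/
theorem IsBarycentricSpanner.det_gram_le (hb : IsBarycentricSpanner I.act b) (hd : 1 ≤ d) {t : ℕ}
    (ht : 1 ≤ t) (i : Fin n) (ω : Ω) :
    (gram I b A t i ω).det ≤ (t : ℝ) ^ d * (∑ j, vecMulVec (b j).ofLp (b j).ofLp).det := by
  have : Nonempty (Fin d) := ⟨⟨0, hd⟩⟩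
  have h := det_spanner_add_sum_vecMulVec_le (fun j => (b j).ofLp) (Finset.Ico 1 t)
    (fun s => (I.act (A s i ω)).ofLp) fun s _ => by
      obtain ⟨r, hr, h⟩ := hb.exists_coeff (A s i ω)
      refine ⟨r, hr, ?_⟩
      rw [h]
      simp
  rw [Nat.card_Ico, Fintype.card_fin, Nat.cast_sub ht, Nat.cast_one, add_sub_cancel] at h
  exact h

/-- The noise part of `A^t_i (μ̂^t_i - μ)`. -/
def banditNoise (I : Problem m d k) (ξ : ℕ → Fin n → Ω → Vec m × Vec d × ℝ)
    (A : ℕ → Fin n → Ω → Fin k) (t : ℕ) (i : Fin n) (ω : Ω) : Fin d → ℝ :=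
  ∑ s ∈ Finset.Ico 1 t, (ξ s i ω).2.2 • (I.act (A s i ω)).ofLp

/-- The squared length of the noise part of the estimate. -/
def banditNoiseForm (I : Problem m d k) (b : Fin d → Vec d)
    (ξ : ℕ → Fin n → Ω → Vec m × Vec d × ℝ)
    (A : ℕ → Fin n → Ω → Fin k) (t : ℕ) (i : Fin n) (ω : Ω) : ℝ :=
  banditNoise I ξ A t i ω ⬝ᵥ (gram I b A t i ω)⁻¹ *ᵥ banditNoise I ξ A t i ω

/-- The observed costs contain μ through the data part of the Gram matrix, which cancels. What
remains is the noise and the bias due to regularizing by the spanner without observations of it. -/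
theorem gram_mulVec_sub_muHat (hb : IsBarycentricSpanner I.act b) (t : ℕ) (i : Fin n) (ω : Ω) :
    gram I b A t i ω *ᵥ (I.μ.ofLp - muHat I b ξ A t i ω) =
      (∑ j, vecMulVec (b j).ofLp (b j).ofLp) *ᵥ I.μ.ofLp - banditNoise I ξ A t i ω := by
  rw [Matrix.mulVec_sub, muHat, PosDef.mulVec_inv_mulVec (hb.posDef_gram t i ω), gram,
    Matrix.add_mulVec, banditNoise, add_sub_assoc, sub_eq_add_neg _ (∑ s ∈ Finset.Ico 1 t, _)]
  have h : ∑ s ∈ Finset.Ico 1 t, I.banditCost (A s i ω) (ξ s i ω) • (I.act (A s i ω)).ofLp =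
      (∑ s ∈ Finset.Ico 1 t, vecMulVec (I.act (A s i ω)).ofLp (I.act (A s i ω)).ofLp) *ᵥ I.μ.ofLp +
        ∑ s ∈ Finset.Ico 1 t, (ξ s i ω).2.2 • (I.act (A s i ω)).ofLp := by
    rw [Matrix.sum_mulVec, ← Finset.sum_add_distrib]
    refine Finset.sum_congr rfl fun s _ => ?_
    rw [vecMulVec_mulVec, Problem.banditCost, inner_eq_dotProduct, add_smul, dotProduct_comm]
    simp
  rw [h]
  abel

/-- The squared error is at most twice the noise form plus twice the bias form. The bias form is at
most the sum of the squares of b_j·μ, hence at most d Kμ², because every b_j is an action. -/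
theorem mem_confBall_of_form_le (hb : IsBarycentricSpanner I.act b)
    (hI : ∀ a, |(inner ℝ I.μ (I.act a) : ℝ)| ≤ Kμ) {t : ℕ} {i : Fin n} {ω : Ω}
    (h : 2 * banditNoiseForm I b ξ A t i ω + 2 * (d * Kμ ^ 2) ≤ radius n d γ t) :
    I.μ ∈ confBall I b γ ξ A t i ω := by
  have hG := hb.posDef_gram (A := A) t i ω
  have hL := hb.posDef
  have hy := gram_mulVec_sub_muHat (ξ := ξ) (A := A) hb t i ω
  have hGL : ∀ v, v ⬝ᵥ (∑ j, vecMulVec (b j).ofLp (b j).ofLp) *ᵥ v ≤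
      v ⬝ᵥ gram I b A t i ω *ᵥ v := by
    intro v
    rw [gram, Matrix.add_mulVec, dotProduct_add]
    linarith [PosSemidef.form_nonneg (posSemidef_sum_vecMulVec (Finset.Ico 1 t)
      fun s => (I.act (A s i ω)).ofLp) v]
  simp only [banditNoiseForm] at h
  change √_ ≤ √_
  refine Real.sqrt_le_sqrt (le_trans ?_ h)
  set G := gram I b A t i ω
  set Λ := ∑ j, vecMulVec (b j).ofLp (b j).ofLp with hΛ
  set S := banditNoise I ξ A t i ω
  set c := Λ *ᵥ I.μ.ofLp with hc
  set z := I.μ.ofLp - muHat I b ξ A t i ω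
  have hz : z = G⁻¹ *ᵥ (c - S) := (PosDef.inv_mulVec_eq hG hy).symm
  have h1 : z ⬝ᵥ G *ᵥ z ≤ 2 * (S ⬝ᵥ G⁻¹ *ᵥ S) + 2 * (c ⬝ᵥ G⁻¹ *ᵥ c) := by
    have e1 := PosDef.inv_form_nonneg hG (c + S)
    rw [hy, hz, dotProduct_comm]
    simp only [Matrix.mulVec_add, Matrix.mulVec_sub, dotProduct_add, add_dotProduct,
      dotProduct_sub, sub_dotProduct] at e1 ⊢
    linarith
  -- With y = G⁻¹c, Cauchy–Schwarz for Λ and Λ ≤ G give (c·y)² ≤ (μ·Λμ)(c·y).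
  have h2 : c ⬝ᵥ G⁻¹ *ᵥ c ≤ I.μ.ofLp ⬝ᵥ Λ *ᵥ I.μ.ofLp := by
    set y := G⁻¹ *ᵥ c with hyd
    have e1 : c ⬝ᵥ y = I.μ.ofLp ⬝ᵥ Λ *ᵥ y := by
      rw [dotProduct_comm, hc, dotProduct_mulVec_comm hL.isHermitian]
    have e2 := PosSemidef.form_sq_le hL.posSemidef I.μ.ofLp y
    have e3 := hGL y
    rw [hyd, PosDef.mulVec_inv_mulVec hG, ← hyd, dotProduct_comm y c] at e3
    have e4 : 0 ≤ c ⬝ᵥ y := PosDef.inv_form_nonneg hG c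
    have e5 := PosSemidef.form_nonneg hL.posSemidef I.μ.ofLp
    rw [← e1] at e2
    by_contra! hcon
    have : 0 < c ⬝ᵥ y := lt_of_le_of_lt e5 hcon
    nlinarith [mul_le_mul_of_nonneg_left e3 e5]
  have h3 : I.μ.ofLp ⬝ᵥ Λ *ᵥ I.μ.ofLp ≤ d * Kμ ^ 2 := by
    rw [hΛ, dotProduct_sum_vecMulVec_mulVec]
    calc ∑ j, ((b j).ofLp ⬝ᵥ I.μ.ofLp) * ((b j).ofLp ⬝ᵥ I.μ.ofLp) ≤ ∑ _j : Fin d, Kμ ^ 2 := by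
          refine Finset.sum_le_sum fun j _ => ?_
          obtain ⟨a, ha⟩ := hb.mem j
          have := hI a
          rw [ha, inner_eq_dotProduct, dotProduct_comm] at this
          rw [← sq, ← sq_abs]
          gcongr
      _ = d * Kμ ^ 2 := by simp
  linarith

/-- The width of the confidence ball in the direction of the action taken. -/
theorem abs_inner_sub_le (hb : IsBarycentricSpanner I.act b) {t : ℕ} {i : Fin n} {ω : Ω}
    {ν ν' : Vec d} (hν : ν ∈ confBall I b γ ξ A t i ω) (hν' : ν' ∈ confBall I b γ ξ A t i ω)
    (w : Vec d) :
    |(inner ℝ (ν - ν') w : ℝ)| ≤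
      2 * √(radius n d γ t) * √(w.ofLp ⬝ᵥ (gram I b A t i ω)⁻¹ *ᵥ w.ofLp) := by
  have hG := hb.posDef_gram (A := A) t i ω
  have key : ∀ ν ∈ confBall I b γ ξ A t i ω, |w.ofLp ⬝ᵥ (ν.ofLp - muHat I b ξ A t i ω)| ≤
      √(w.ofLp ⬝ᵥ (gram I b A t i ω)⁻¹ *ᵥ w.ofLp) * √(radius n d γ t) := by
    intro ν hν
    change √_ ≤ √_ at hν
    have h1 := Real.abs_le_sqrt (PosDef.dotProduct_sq_le hG w.ofLp
      (ν.ofLp - muHat I b ξ A t i ω))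
    rw [Real.sqrt_mul (PosDef.inv_form_nonneg hG _)] at h1
    exact h1.trans (mul_le_mul_of_nonneg_left hν (Real.sqrt_nonneg _))
  have e : (inner ℝ (ν - ν') w : ℝ) = w.ofLp ⬝ᵥ (ν.ofLp - muHat I b ξ A t i ω) -
      w.ofLp ⬝ᵥ (ν'.ofLp - muHat I b ξ A t i ω) := by
    rw [inner_eq_dotProduct, dotProduct_comm, ← dotProduct_sub]
    congr 1
    simp
  rw [e]
  refine (abs_sub _ _).trans ?_
  linarith [key ν hν, key ν' hν']

/-- The first term of the maximum suffices, as n/γ ≥ 1. The second power of log t lets the radius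
outgrow σ and Kμ, which do not appear in it. -/
theorem radius_ge (hn : 1 ≤ n) (hγ : 0 < γ) (hγ1 : γ ≤ 1) {t : ℕ} (ht : 1 ≤ t) :
    256 * d * Real.log t ^ 2 ≤ radius n d γ t := by
  have ht' : (1 : ℝ) ≤ t := by exact_mod_cast ht
  have hn' : (1 : ℝ) ≤ n := by exact_mod_cast hn
  have hlog : 0 ≤ Real.log t := Real.log_nonneg ht'
  have h1 : 2 * Real.log t ≤ Real.log (n * (t : ℝ) ^ 2 / γ) := by
    rw [show 2 * Real.log t = Real.log ((t : ℝ) ^ 2) by rw [Real.log_pow]; norm_num]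
    refine Real.log_le_log (by positivity) ?_
    rw [le_div_iff₀ hγ]
    nlinarith [sq_nonneg (t : ℝ), mul_le_mul hn' hγ1 hγ.le (by positivity)]
  refine le_trans ?_ (le_max_left _ _)
  have : 0 ≤ 128 * (d : ℝ) * Real.log t := by positivity
  nlinarith

end Confidence

/-! ### Measurability of the actions and coverage of the confidence ball. -/

section RunMeasurability

theorem measurable_of_forall_eq {Ω α : Type*} {𝓕 : MeasurableSpace Ω} {_ : MeasurableSpace α}
    {f : Ω → α} (h : ∀ ω ω', f ω = f ω') : Measurable f :=
  measurable_const' h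

variable {m d k n Te : ℕ} {Ω : Type*} [mΩ : MeasurableSpace Ω] {P : Measure Ω}
  {I : Problem m d k} {b : Fin d → Vec d} {w0 : Fin n → Fin k} {γ KC Kμ : ℝ} {mode : Training}
  {ξ : ℕ → Fin n → Ω → Vec m × Vec d × ℝ} {A : ℕ → Fin n → Ω → Fin k}
  {Fhat : ℕ → Ω → Fin k → Vec m →L[ℝ] Vec d}

/-- Actions up to the end of exploration are deterministic. In the frozen variant this makes the
design a function of the features alone. -/
theorem IsRun.action_eq_of_le (h : IsRun P I b w0 γ Te mode ξ A Fhat) {t : ℕ} (ht : t ≤ Te)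
    (i : Fin n) (ω ω' : Ω) : A t i ω = A t i ω' := by
  rcases Nat.eq_zero_or_pos t with rfl | h0
  · rw [h.initial, h.initial]
  · ext
    rw [h.explore t i ω h0 ht, h.explore t i ω' h0 ht]

theorem IsRun.measurable_action_past (h : IsRun P I b w0 γ Te mode ξ A Fhat) (t : ℕ) (i : Fin n) :
    Measurable[past ξ (beforeNoise n t)] (A t i) := by
  rcases le_or_gt t Te with ht | ht
  · exact measurable_of_forall_eq (h.action_eq_of_le ht i)
  · exact (h.measurable_action t i ht).mono (history_sup_features_le ξ t) le_rfl

theorem beforeNoise_mono : Monotone (beforeNoise n) := by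
  intro s t hst q hq
  rcases hq with hq | hq
  · exact Or.inl (hq.trans_le hst)
  · rcases hst.lt_or_eq with h | h
    · exact Or.inl (hq.1 ▸ h)
    · exact Or.inr ⟨hq.1.trans h, hq.2⟩

variable [IsProbabilityMeasure P]

/-- The noise part of the estimate of `μ` is small with high probability. -/
theorem IsRun.measure_banditNoiseForm_ge_le (h : IsRun P I b w0 γ Te mode ξ A Fhat)
    [IsProbabilityMeasure I.D] (hb : IsBarycentricSpanner I.act b) (hd : 1 ≤ d) {t : ℕ}
    (ht : 1 ≤ t) (i : Fin n) :
    P {ω | (4 + d) * Real.log t * ((I.σ : ℝ) ^ 2 + 1) ≤ banditNoiseForm I b ξ A t i ω} ≤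
      ENNReal.ofReal (1 / (t : ℝ) ^ 2) := by
  have ht0 : (0 : ℝ) < t := by exact_mod_cast ht
  have hs : (0 : ℝ) < (I.σ : ℝ) ^ 2 + 1 := by positivity
  have hnoise : ∀ p, Measurable[past ξ (beforeNoise n (p + 1 + 1))] fun ω => (ξ (1 + p) i ω).2.2 :=
    fun p => (measurable_snd.comp (measurable_noise_part ξ (1 + p, i))).mono
      (part_le_past (Or.inl (by simp; omega))) le_rfl
  -- Index p stands for round p + 1. The summand 1 in σ² + 1 keeps θ meaningful for σ = 0; with R =
  -- t^d and δ = 1/t² the threshold is (4 + d) log t (σ² + 1).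
  have key := measure_selfNormalized_ge_le (P := P) (G := ∑ j, vecMulVec (b j).ofLp (b j).ofLp)
    (𝓕 := fun p => past ξ (beforeNoise n (p + 1)))
    (φ := fun p ω => (I.act (A (1 + p) i ω)).ofLp) (g := fun p ω => (ξ (1 + p) i ω).2.2)
    (v := fun _ => I.σ ^ 2) (θ := ((I.σ : ℝ) ^ 2 + 1)⁻¹) (R := (t : ℝ) ^ d)
    (δ := 1 / (t : ℝ) ^ 2)
    (fun p => past_le h.measurable_sample _) (fun p q hpq => past_mono (beforeNoise_mono (by simpa using hpq)))
    (fun p => ?_) hnoise (fun p => ?_) (fun p => ?_) (by positivity) (fun p => ?_) hb.posDef (t - 1)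
    (by positivity) (by positivity) (Eventually.of_forall fun ω => ?_)
  · refine le_trans (measure_mono ?_) key
    intro ω hω
    simp only [Set.mem_ofPred_eq] at hω ⊢
    refine le_trans (le_of_eq ?_) (hω.trans (le_of_eq ?_))
    · rw [one_div_one_div, Real.log_pow, Real.log_pow]
      push_cast
      field_simp
      ring
    · simp only [banditNoiseForm, banditNoise, gram, Finset.sum_Ico_eq_sum_range]
  · rw [add_comm p 1]
    exact (measurable_from_top (f := fun a => (I.act a).ofLp)).comp (h.measurable_action_past (1 + p) i)
  · refine indep_of_indep_of_le_right (indep_past_part h.measurable_sample h.law_sample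
      h.indep_sample (q := ((1 + p, i), true)) ?_)
      (measurable_snd.comp (measurable_noise_part ξ (1 + p, i))).comap_le
    simp [beforeNoise]
  · have e : (fun ω => (ξ (1 + p) i ω).2.2) = Prod.snd ∘ fun ω => (ξ (1 + p) i ω).2 := rfl
    rw [e, ← Measure.map_map measurable_snd (h.measurable_sample _ _).snd,
      map_noise h.measurable_sample h.law_sample (1 + p, i), Problem.noiseLaw]
    exact Measure.snd_prod
  · rw [inv_mul_le_iff₀ hs]
    push_cast
    linarith
  · have := hb.det_gram_le (A := A) hd ht i ω
    simpa only [gram, Finset.sum_Ico_eq_sum_range] using this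

/-- Once log t exceeds both constants of the problem, noise and bias together need at most 12 d log²
t, well below the lower bound 256 d log² t of the radius. -/
theorem IsRun.measure_notMem_confBall_le (h : IsRun P I b w0 γ Te mode ξ A Fhat)
    (hI : I.IsBounded KC Kμ) (hb : IsBarycentricSpanner I.act b) (hd : 1 ≤ d) (hn : 1 ≤ n)
    (hγ : 0 < γ) (hγ1 : γ ≤ 1) {t : ℕ} (ht : 1 ≤ t) (hσ : (I.σ : ℝ) ^ 2 + 1 ≤ Real.log t)
    (hK : |Kμ| ≤ Real.log t) (i : Fin n) :
    P {ω | I.μ ∉ confBall I b γ ξ A t i ω} ≤ ENNReal.ofReal (1 / (t : ℝ) ^ 2) := by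
  have := hI.isProbabilityMeasure
  refine le_trans (measure_mono ?_) (h.measure_banditNoiseForm_ge_le hb hd ht i)
  intro ω hω
  simp only [Set.mem_ofPred_eq] at hω ⊢
  by_contra! hcon
  refine hω (mem_confBall_of_form_le hb hI.unknown_le (le_trans ?_ (radius_ge hn hγ hγ1 ht)))
  have hL : 1 ≤ Real.log t := by nlinarith [sq_nonneg (I.σ : ℝ)]
  have hd' : (1 : ℝ) ≤ d := by exact_mod_cast hd
  have h1 : (4 + d) * Real.log t * ((I.σ : ℝ) ^ 2 + 1) ≤ 5 * d * Real.log t ^ 2 := by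
    have e : (4 + (d : ℝ)) * Real.log t ≤ 5 * d * Real.log t := by nlinarith
    calc (4 + d) * Real.log t * ((I.σ : ℝ) ^ 2 + 1) ≤ (5 * d * Real.log t) * Real.log t := by
          gcongr
      _ = _ := by ring
  have h2 : Kμ ^ 2 ≤ Real.log t ^ 2 := by
    rw [← sq_abs Kμ]
    gcongr
  have h3 : d * Kμ ^ 2 ≤ d * Real.log t ^ 2 := by gcongr
  have h4 : 0 ≤ d * Real.log t ^ 2 := by positivity
  linarith

end RunMeasurability

/-! ### The error of a least-squares prediction. -/

section LeastSquares

variable {m d k n : ℕ} [NeZero n] {Ω : Type*}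

/-- The samples in the order in which they are drawn. -/
def sampleIdx (n : ℕ) [NeZero n] (p : ℕ) : ℕ × Fin n := (p / n, Fin.ofNat n p)

theorem sampleIdx_mul_add (s : ℕ) (i : Fin n) : sampleIdx n (s * n + i) = (s, i) := by
  have hn : 0 < n := Nat.pos_of_ne_zero (NeZero.ne n)
  unfold sampleIdx
  ext
  · simp only
    rw [add_comm, Nat.add_mul_div_right _ _ hn, Nat.div_eq_of_lt i.2, zero_add]
  · simp [Nat.mod_eq_of_lt i.2]

theorem sampleIdx_injective : Function.Injective (sampleIdx n) := by
  intro p q hpq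
  have h1 : p / n = q / n := congrArg Prod.fst hpq
  have h2 : p % n = q % n := congrArg (fun x : ℕ × Fin n => (x.2 : ℕ)) hpq
  rw [← Nat.div_add_mod p n, ← Nat.div_add_mod q n, h1, h2]

theorem sum_range_sampleIdx {β : Type*} [AddCommMonoid β] (f : ℕ × Fin n → β) (R : ℕ) :
    ∑ p ∈ Finset.range (R * n), f (sampleIdx n p) = ∑ s ∈ Finset.range R, ∑ i, f (s, i) := by
  induction R with
  | zero => simp
  | succ R ih =>
    rw [Finset.sum_range_succ, ← ih, Nat.succ_mul, Finset.sum_range_add]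
    congr 1
    rw [Finset.sum_range]
    exact Finset.sum_congr rfl fun i _ => by rw [sampleIdx_mul_add]

/-- The feature vector of the `p`-th sample if it is labelled under `a`, and zero otherwise. -/
def regressor (ξ : ℕ → Fin n → Ω → Vec m × Vec d × ℝ) (A : ℕ → Fin n → Ω → Fin k) (a : Fin k)
    (p : ℕ) (ω : Ω) : Fin m → ℝ :=
  if A (sampleIdx n p).1 (sampleIdx n p).2 ω = a then
    (ξ (sampleIdx n p).1 (sampleIdx n p).2 ω).1.ofLp else 0

/-- The label noise of the `p`-th sample in the direction of the action `a`. -/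
def labelNoise (I : Problem m d k) (ξ : ℕ → Fin n → Ω → Vec m × Vec d × ℝ) (a : Fin k) (p : ℕ)
    (ω : Ω) : ℝ :=
  inner ℝ (I.act a) (ξ (sampleIdx n p).1 (sampleIdx n p).2 ω).2.1

/-- The design matrix of the first `N` samples under the action `a`. -/
def design (ξ : ℕ → Fin n → Ω → Vec m × Vec d × ℝ) (A : ℕ → Fin n → Ω → Fin k) (a : Fin k)
    (N : ℕ) (ω : Ω) : Matrix (Fin m) (Fin m) ℝ :=
  ∑ p ∈ Finset.range N, vecMulVec (regressor ξ A a p ω) (regressor ξ A a p ω)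

theorem posSemidef_design (ξ : ℕ → Fin n → Ω → Vec m × Vec d × ℝ) (A : ℕ → Fin n → Ω → Fin k)
    (a : Fin k) (N : ℕ) (ω : Ω) : (design ξ A a N ω).PosSemidef :=
  posSemidef_sum_vecMulVec _ _

/-- First-order optimality of a minimizer along a line, without derivatives. -/
theorem eq_zero_of_forall_quadratic_nonneg {c e : ℝ} (h : ∀ s : ℝ, 0 ≤ s ^ 2 * c - 2 * s * e) :
    e = 0 := by
  have key : ∀ s : ℝ, 0 ≤ c * (s * s) + (-2 * e) * s + 0 := fun s => by
    have := h s; nlinarith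
  have := discrim_le_zero key
  rw [discrim] at this
  nlinarith

/-- The error of a least-squares prediction at a point in the range of the design matrix. -/
theorem inner_leastSquares_error {I : Problem m d k} {ξ : ℕ → Fin n → Ω → Vec m × Vec d × ℝ}
    {A : ℕ → Fin n → Ω → Fin k} {R : ℕ} {ω : Ω} {a : Fin k} {H : Vec m →L[ℝ] Vec d}
    (hH : ∀ G, residual I ξ A (Finset.range R) ω a H ≤ residual I ξ A (Finset.range R) ω a G)
    {x : Vec m} {u : Fin m → ℝ} (hu : design ξ A a (R * n) ω *ᵥ u = x.ofLp) :
    (inner ℝ (H x - I.F a x) (I.act a) : ℝ) =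
      ∑ p ∈ Finset.range (R * n), (regressor ξ A a p ω ⬝ᵥ u) * labelNoise I ξ a p ω := by
  set w := I.act a with hw
  set y : ℕ × Fin n → Vec m := fun q => (ξ q.1 q.2 ω).1 with hy
  set e : ℕ × Fin n → Vec d := fun q => I.label a (ξ q.1 q.2 ω) - H (y q) with he
  set c : ℕ × Fin n → ℝ := fun q => if A q.1 q.2 ω = a then 1 else 0 with hc
  have hres : ∀ G, residual I ξ A (Finset.range R) ω a G =
      ∑ p ∈ Finset.range (R * n), c (sampleIdx n p) *
        ‖I.label a (ξ (sampleIdx n p).1 (sampleIdx n p).2 ω) - G (y (sampleIdx n p))‖ ^ 2 := by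
    intro G
    rw [sum_range_sampleIdx (fun q => c q * ‖I.label a (ξ q.1 q.2 ω) - G (y q)‖ ^ 2)]
    unfold residual
    refine Finset.sum_congr rfl fun s _ => Finset.sum_congr rfl fun i _ => ?_
    simp only [hc, hy]
    split_ifs <;> simp
  -- The normal equation for the rank-one perturbation y ↦ (u·y) w of the predictor. It holds for
  -- every minimizer, unique or not.
  have hb : ∑ p ∈ Finset.range (R * n), c (sampleIdx n p) *
      ((y (sampleIdx n p)).ofLp ⬝ᵥ u * inner ℝ (e (sampleIdx n p)) w) = 0 := by
    refine eq_zero_of_forall_quadratic_nonneg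
      (c := ∑ p ∈ Finset.range (R * n), c (sampleIdx n p) *
        ((y (sampleIdx n p)).ofLp ⬝ᵥ u) ^ 2 * ‖w‖ ^ 2) fun s => ?_
    have h1 := hH (H + s • (innerSL ℝ (WithLp.toLp 2 u : Vec m)).smulRight w)
    rw [hres, hres, ← sub_nonneg, ← Finset.sum_sub_distrib] at h1
    refine h1.trans (le_of_eq ?_)
    rw [Finset.mul_sum, Finset.mul_sum, ← Finset.sum_sub_distrib]
    refine Finset.sum_congr rfl fun p _ => ?_
    set q := sampleIdx n p
    have h2 : I.label a (ξ q.1 q.2 ω) -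
        (H + s • (innerSL ℝ (WithLp.toLp 2 u : Vec m)).smulRight w) (y q) =
        e q - (s * ((y q).ofLp ⬝ᵥ u)) • w := by
      simp only [he, _root_.add_apply, _root_.smul_apply,
        ContinuousLinearMap.smulRight_apply, innerSL_apply_apply, inner_eq_dotProduct, smul_smul]
      rw [dotProduct_comm u]
      abel
    rw [h2, norm_sub_sq_real, inner_smul_right, norm_smul, mul_pow, Real.norm_eq_abs, sq_abs]
    ring
  -- Reading V u = x as a combination of training features reduces the error at x to errors at
  -- training points.
  have hxx : x = ∑ p ∈ Finset.range (R * n), (c (sampleIdx n p) * ((y (sampleIdx n p)).ofLp ⬝ᵥ u)) •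
      y (sampleIdx n p) := by
    apply (WithLp.linearEquiv 2 ℝ (Fin m → ℝ)).injective
    rw [map_sum]
    simp only [map_smul]
    change x.ofLp = ∑ p ∈ Finset.range (R * n), (c (sampleIdx n p) *
      ((y (sampleIdx n p)).ofLp ⬝ᵥ u)) • (y (sampleIdx n p)).ofLp
    rw [← hu, design, Matrix.sum_mulVec]
    refine Finset.sum_congr rfl fun p _ => ?_
    rw [vecMulVec_mulVec]
    simp only [regressor, hc, hy]
    split_ifs <;> simp
  have hlin : (inner ℝ (H x - I.F a x) w : ℝ) = ∑ p ∈ Finset.range (R * n),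
      c (sampleIdx n p) * ((y (sampleIdx n p)).ofLp ⬝ᵥ u) *
        inner ℝ (H (y (sampleIdx n p)) - I.F a (y (sampleIdx n p))) w := by
    have : ∀ z, H z - I.F a z = (H - I.F a) z := fun z => rfl
    simp only [this]
    conv_lhs => rw [hxx]
    rw [map_sum, sum_inner]
    refine Finset.sum_congr rfl fun p _ => ?_
    rw [map_smul, inner_smul_left]
    simp
  -- At a training point the prediction error is the noise minus the residual, and the normal
  -- equation removes the residuals.
  rw [hlin, ← sub_eq_zero, ← neg_eq_zero, ← hb, ← Finset.sum_sub_distrib, ← Finset.sum_neg_distrib]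
  refine Finset.sum_congr rfl fun p _ => ?_
  have h3 : e (sampleIdx n p) = (ξ (sampleIdx n p).1 (sampleIdx n p).2 ω).2.1 -
      (H (y (sampleIdx n p)) - I.F a (y (sampleIdx n p))) := by
    simp only [he, hy, Problem.label]
    abel
  rw [h3, inner_sub_left (𝕜 := ℝ) _ (H _ - _)]
  simp only [regressor, labelNoise, hc, hy, ← hw]
  rw [real_inner_comm _ w]
  split_ifs <;> simp
  ring

end LeastSquares

/-! ### The samples that the exploration phase provides for each action. -/

section Exploration

set_option linter.unusedSectionVars false

variable {m d k n Te : ℕ} [NeZero n] {Ω : Type*} [mΩ : MeasurableSpace Ω] {P : Measure Ω}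
  {I : Problem m d k} {b : Fin d → Vec d} {w0 : Fin n → Fin k} {γ KC Kμ : ℝ} {mode : Training}
  {ξ : ℕ → Fin n → Ω → Vec m × Vec d × ℝ} {A : ℕ → Fin n → Ω → Fin k}
  {Fhat : ℕ → Ω → Fin k → Vec m →L[ℝ] Vec d}

/-- The `q`-th sample of the exploration phase which is labelled under `a`. -/
def exploreIdx (n : ℕ) {k : ℕ} (a : Fin k) (q : ℕ) : ℕ :=
  n + (a + (n + 1) * (k - 1)) % k + k * q

theorem exploreIdx_injective (a : Fin k) : Function.Injective (exploreIdx n a) := by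
  intro q q' h
  have hk : 0 < k := a.pos
  simp only [exploreIdx, Nat.add_left_cancel_iff] at h
  exact Nat.eq_of_mul_eq_mul_left hk h

theorem exploreIdx_lt (a : Fin k) {q : ℕ} (hq : k * (q + 1) ≤ n * Te) :
    exploreIdx n a q < (Te + 1) * n := by
  have hk : 0 < k := a.pos
  have := Nat.mod_lt (a + (n + 1) * (k - 1)) hk
  simp only [exploreIdx]
  nlinarith

/-- In `exploreIdx`, k - 1 acts as -1 modulo k, so the offset is a - n - 1 and the index is a - 1.
The initial n skips round 0; the added 1 reflects that individuals are numbered from 1 in the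
exploration rule. -/
theorem exploreIdx_add_one_mod (a : Fin k) (q : ℕ) : (exploreIdx n a q + 1) % k = a := by
  obtain ⟨l, hl⟩ : ∃ l, k = l + 1 := ⟨k - 1, by have := a.pos; omega⟩
  have h1 : (exploreIdx n a q + 1) ≡ a [MOD k] := by
    have e1 : exploreIdx n a q + 1 ≡ n + (a + (n + 1) * (k - 1)) + k * q + 1 [MOD k] :=
      (((Nat.mod_modEq _ _).add_left n).add_right _).add_right 1
    have e2 : n + (a + (n + 1) * (k - 1)) + k * q + 1 = a + k * (n + 1 + q) := by
      rw [show k - 1 = l by omega]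
      have e3 : k * (n + 1 + q) = (l + 1) * (n + 1) + k * q := by rw [← hl]; ring
      rw [e3]
      ring
    rw [e2] at e1
    refine e1.trans ?_
    simp [Nat.ModEq]
  have := h1
  rwa [Nat.ModEq, Nat.mod_eq_of_lt a.2] at this

theorem IsRun.action_exploreIdx (h : IsRun P I b w0 γ Te mode ξ A Fhat) (a : Fin k) {q : ℕ}
    (hq : k * (q + 1) ≤ n * Te) (ω : Ω) :
    A (sampleIdx n (exploreIdx n a q)).1 (sampleIdx n (exploreIdx n a q)).2 ω = a := by
  have hn : 0 < n := Nat.pos_of_ne_zero (NeZero.ne n)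
  have hlt := exploreIdx_lt a hq
  have hge : n ≤ exploreIdx n a q := by unfold exploreIdx; omega
  have hmod := exploreIdx_add_one_mod (n := n) a q
  set p := exploreIdx n a q
  have h1 : 1 ≤ p / n := (Nat.le_div_iff_mul_le hn).2 (by simpa using hge)
  have h2 : p / n ≤ Te := Nat.lt_succ_iff.1 ((Nat.div_lt_iff_lt_mul hn).2 hlt)
  ext
  rw [sampleIdx, h.explore _ _ ω h1 h2]
  have e : n * (p / n) + ((Fin.ofNat n p : ℕ) + 1) = p + 1 := by
    simp only [Fin.ofNat]
    rw [← add_assoc, Nat.div_add_mod]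
  rw [e, hmod]

/-- A block of samples of the exploration phase is dominated by the design matrix. -/
theorem IsRun.sampleGram_le_design (h : IsRun P I b w0 γ Te mode ξ A Fhat) (a : Fin k) {M N : ℕ}
    {idx : Fin M → ℕ} (hidx : Function.Injective idx) (hle : ∀ l, k * (idx l + 1) ≤ n * Te)
    (hN : (Te + 1) * n ≤ N) (ω : Ω) (v : Fin m → ℝ) :
    v ⬝ᵥ sampleGram (fun l => (ξ (sampleIdx n (exploreIdx n a (idx l))).1
      (sampleIdx n (exploreIdx n a (idx l))).2 ω).1) *ᵥ v ≤ v ⬝ᵥ design ξ A a N ω *ᵥ v := by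
  rw [sampleGram, design, dotProduct_sum_vecMulVec_mulVec, dotProduct_sum_vecMulVec_mulVec]
  have hinj : Set.InjOn (fun l => exploreIdx n a (idx l)) (Finset.univ : Finset (Fin M)) :=
    fun l _ l' _ hll => hidx (exploreIdx_injective a hll)
  have hsub : Finset.univ.image (fun l => exploreIdx n a (idx l)) ⊆ Finset.range N := by
    intro p hp
    obtain ⟨l, -, rfl⟩ := Finset.mem_image.1 hp
    exact Finset.mem_range.2 ((exploreIdx_lt a (hle l)).trans_le hN)
  refine le_trans (le_of_eq ?_) (Finset.sum_le_sum_of_subset_of_nonneg hsub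
    fun p _ _ => mul_self_nonneg _)
  rw [Finset.sum_image hinj]
  refine Finset.sum_congr rfl fun l _ => ?_
  simp only [regressor]
  rw [if_pos (h.action_exploreIdx a (hle l) ω)]

end Exploration

/-! ### Label noise for a design that is fixed given the features. -/

section FrozenNoise

set_option linter.unusedSectionVars false

variable {m d k n Te : ℕ} [NeZero n] {Ω : Type*} [mΩ : MeasurableSpace Ω] {P : Measure Ω}
  [IsProbabilityMeasure P]
  {I : Problem m d k} {b : Fin d → Vec d} {w0 : Fin n → Fin k} {γ KC Kμ : ℝ} {mode : Training}
  {ξ : ℕ → Fin n → Ω → Vec m × Vec d × ℝ} {A : ℕ → Fin n → Ω → Fin k}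
  {Fhat : ℕ → Ω → Fin k → Vec m →L[ℝ] Vec d}

theorem map_labelNoise [IsProbabilityMeasure I.D] (hξ : ∀ t i, Measurable (ξ t i))
    (hlaw : ∀ t i, P.map (ξ t i) = I.sampleLaw) (a : Fin k) (p : ℕ) :
    P.map (labelNoise I ξ a p) = gaussianReal 0 (I.σ ^ 2 * ‖I.act a‖₊ ^ 2) := by
  have e : labelNoise I ξ a p = (fun v : Vec d => (inner ℝ (I.act a) v : ℝ)) ∘ (Prod.fst ∘
    fun ω => (ξ (sampleIdx n p).1 (sampleIdx n p).2 ω).2) := rfl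
  have hm : Measurable fun ω => (ξ (sampleIdx n p).1 (sampleIdx n p).2 ω).2 := (hξ _ _).snd
  rw [e, ← Measure.map_map (by fun_prop) (measurable_fst.comp hm),
    ← Measure.map_map measurable_fst hm, map_noise hξ hlaw, Problem.noiseLaw,
    ← map_inner_multivariateGaussian]
  congr 1
  exact Measure.fst_prod

theorem measurable_labelNoise_part (I : Problem m d k) (ξ : ℕ → Fin n → Ω → Vec m × Vec d × ℝ)
    (a : Fin k) (p : ℕ) : Measurable[part ξ (sampleIdx n p, true)] (labelNoise I ξ a p) := by
  have h := measurable_noise_part ξ (sampleIdx n p)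
  have h2 : Measurable fun e : Vec d × ℝ => (inner ℝ (I.act a) e.1 : ℝ) := by fun_prop
  exact h2.comp h

theorem noise_var_le {s : ℝ≥0} {w : Vec d} (hw : ‖w‖ ≤ 1) :
    ((s ^ 2 * ‖w‖₊ ^ 2 : ℝ≥0) : ℝ) ≤ (s : ℝ) ^ 2 := by
  push_cast
  have h : ‖w‖ ^ 2 ≤ 1 := pow_le_one₀ (norm_nonneg _) hw
  nlinarith [sq_nonneg (s : ℝ)]

/-- All features, and the noises of the first `p` samples. -/
def allFeatures (n : ℕ) [NeZero n] (p : ℕ) : Set ((ℕ × Fin n) × Bool) :=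
  {q | q.2 = false ∨ ∃ r < p, q.1 = sampleIdx n r}

theorem allFeatures_mono : Monotone (allFeatures n) := by
  intro p p' hpp q hq
  rcases hq with hq | ⟨r, hr, hq⟩
  · exact Or.inl hq
  · exact Or.inr ⟨r, hr.trans_le hpp, hq⟩

theorem notMem_allFeatures (p : ℕ) : (sampleIdx n p, true) ∉ allFeatures n p := by
  rintro (h | ⟨r, hr, h⟩)
  · simp at h
  · exact hr.ne' (sampleIdx_injective h)

theorem measurable_feature_allFeatures (ξ : ℕ → Fin n → Ω → Vec m × Vec d × ℝ) (q : ℕ × Fin n)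
    (p : ℕ) : Measurable[past ξ (allFeatures n p)] fun ω => (ξ q.1 q.2 ω).1.ofLp := by
  have h := (measurable_feature_part ξ q).mono (part_le_past (ξ := ξ) (S := allFeatures n p)
    (Or.inl rfl)) le_rfl
  have h2 : Measurable fun x : Vec m => x.ofLp := by fun_prop
  exact h2.comp h

theorem measurable_ite_apply {Ω α β : Type*} {𝓕 : MeasurableSpace Ω} [MeasurableSpace β] [Fintype α]
    [MeasurableSpace α] [MeasurableSingletonClass α] [DecidableEq α] {f : Ω → α} {g : Ω → β}
    (hf : Measurable f) (hg : Measurable g) (a : α) (c : β) :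
    Measurable fun ω => if f ω = a then g ω else c :=
  Measurable.ite (hf (measurableSet_singleton a)) hg measurable_const

/-- No label noise enters: the actions that select these regressors are constant. -/
theorem IsRun.measurable_regressor_allFeatures (h : IsRun P I b w0 γ Te mode ξ A Fhat) (a : Fin k)
    {r : ℕ} (hr : r < (Te + 1) * n) (p : ℕ) :
    Measurable[past ξ (allFeatures n p)] (regressor ξ A a r) := by
  have hn : 0 < n := Nat.pos_of_ne_zero (NeZero.ne n)
  refine measurable_ite_apply (measurable_of_forall_eq (h.action_eq_of_le ?_ _))
    (measurable_feature_allFeatures ξ _ p) a 0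
  exact Nat.lt_succ_iff.1 ((Nat.div_lt_iff_lt_mul hn).2 hr)

theorem measurable_ridgeCoeff {Ω : Type*} {𝓕 : MeasurableSpace Ω} {V : Ω → Matrix (Fin m) (Fin m) ℝ}
    {x : Ω → Fin m → ℝ} (hV : ∀ i j, Measurable fun ω => V ω i j) (hx : Measurable x) (j : ℕ) :
    Measurable fun ω => ridgeCoeff (V ω) (x ω) j := by
  have h1 : ∀ i l, Measurable fun ω => (V ω + ridge j • (1 : Matrix (Fin m) (Fin m) ℝ)) i l := by
    intro i l
    simp only [Matrix.add_apply]
    exact (hV i l).add_const _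
  have h2 := measurable_mulVec (measurable_inv_apply h1) hx
  exact (measurable_dotProduct hx h2).sqrt.inv.smul h2

/-- The normalized ridge approximation of the least-squares noise at the features of `q₀`. -/
def ridgeNoise (I : Problem m d k) (ξ : ℕ → Fin n → Ω → Vec m × Vec d × ℝ)
    (A : ℕ → Fin n → Ω → Fin k) (N : ℕ) (q₀ : ℕ × Fin n) (a : Fin k) (j : ℕ) (ω : Ω) : ℝ :=
  ∑ p ∈ Finset.range N,
    (regressor ξ A a p ω ⬝ᵥ ridgeCoeff (design ξ A a N ω) (ξ q₀.1 q₀.2 ω).1.ofLp j) *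
      labelNoise I ξ a p ω

theorem IsRun.measurable_ridgeStat (h : IsRun P I b w0 γ Te mode ξ A Fhat) (q₀ : ℕ × Fin n)
    (a : Fin k) (j : ℕ) {r : ℕ} (hr : r < (Te + 1) * n) (p : ℕ) :
    Measurable[past ξ (allFeatures n p)] fun ω => regressor ξ A a r ω ⬝ᵥ
      ridgeCoeff (design ξ A a ((Te + 1) * n) ω) (ξ q₀.1 q₀.2 ω).1.ofLp j := by
  refine measurable_dotProduct (mΩ := past ξ (allFeatures n p))
    (h.measurable_regressor_allFeatures a hr p)
    (measurable_ridgeCoeff (𝓕 := past ξ (allFeatures n p)) ?_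
      (measurable_feature_allFeatures ξ q₀ p) j)
  exact measurable_sum_vecMulVec_apply (mΩ := past ξ (allFeatures n p)) _ fun s hs =>
    h.measurable_regressor_allFeatures a (Finset.mem_range.1 hs) p

theorem IsRun.measurable_ridgeNoise (h : IsRun P I b w0 γ Te mode ξ A Fhat) (q₀ : ℕ × Fin n)
    (a : Fin k) (j : ℕ) : Measurable (ridgeNoise I ξ A ((Te + 1) * n) q₀ a j) := by
  refine Finset.measurable_sum _ fun p hp => Measurable.mul ?_ ?_
  · exact (h.measurable_ridgeStat q₀ a j (Finset.mem_range.1 hp) 0).mono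
      (past_le h.measurable_sample _) le_rfl
  · exact (measurable_labelNoise_part I ξ a p).mono (part_le h.measurable_sample _) le_rfl

/-- Reveal all features first, then the noises one by one: the ridge statistic is a linear form in
the noise with predictable coefficients whose squares sum to at most one. The signs c = 1 and c = -1
give the two tails. -/
theorem IsRun.lintegral_exp_ridgeNoise_le (h : IsRun P I b w0 γ Te mode ξ A Fhat)
    (hI : I.IsBounded KC Kμ) (q₀ : ℕ × Fin n) (a : Fin k) (j : ℕ) {c : ℝ} (hc : c ^ 2 = 1) :
    ∫⁻ ω, ENNReal.ofReal (Real.exp (c * ridgeNoise I ξ A ((Te + 1) * n) q₀ a j ω)) ∂P ≤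
      ENNReal.ofReal (Real.exp ((I.σ : ℝ) ^ 2 / 2)) := by
  have := hI.isProbabilityMeasure
  set N := (Te + 1) * n with hN
  set ψ : ℕ → Ω → ℝ := fun p ω => regressor ξ A a p ω ⬝ᵥ
    ridgeCoeff (design ξ A a N ω) (ξ q₀.1 q₀.2 ω).1.ofLp j with hψ
  have key := lintegral_exp_sum_le (P := P) (𝓕 := fun p => past ξ (allFeatures n p))
    -- The supermartingale bound wants coefficients for all p, but regressors are functions of the
    -- features only for p < N; the others are set to 0.
    (φ := fun p ω => if p < N then c * ψ p ω else 0) (g := labelNoise I ξ a)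
    (v := fun _ => I.σ ^ 2 * ‖I.act a‖₊ ^ 2) (s := (I.σ : ℝ) ^ 2)
    (fun p => past_le h.measurable_sample _) (fun p q hpq => past_mono (allFeatures_mono hpq))
    (fun p => ?_) (fun p => ?_) (fun p => ?_) (fun p => map_labelNoise h.measurable_sample
      h.law_sample a p) (fun p => noise_var_le (hI.norm_act_le a)) N
  · have hle : ∀ ω, ENNReal.ofReal (Real.exp (c * ridgeNoise I ξ A N q₀ a j ω)) ≤
        ENNReal.ofReal (Real.exp ((I.σ : ℝ) ^ 2 / 2)) * ENNReal.ofReal (Real.exp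
          (∑ p ∈ Finset.range N, (if p < N then c * ψ p ω else 0) * labelNoise I ξ a p ω -
            (I.σ : ℝ) ^ 2 / 2 * ∑ p ∈ Finset.range N, (if p < N then c * ψ p ω else 0) ^ 2)) := by
      intro ω
      rw [← ENNReal.ofReal_mul (by positivity), ← Real.exp_add]
      refine ENNReal.ofReal_le_ofReal (Real.exp_le_exp.2 ?_)
      have e1 : ∑ p ∈ Finset.range N, (if p < N then c * ψ p ω else 0) * labelNoise I ξ a p ω =
          c * ridgeNoise I ξ A N q₀ a j ω := by
        rw [ridgeNoise, Finset.mul_sum]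
        refine Finset.sum_congr rfl fun p hp => ?_
        rw [if_pos (Finset.mem_range.1 hp), mul_assoc]
      have e2 : ∑ p ∈ Finset.range N, (if p < N then c * ψ p ω else 0) ^ 2 =
          ∑ p ∈ Finset.range N, ψ p ω ^ 2 := by
        refine Finset.sum_congr rfl fun p hp => ?_
        rw [if_pos (Finset.mem_range.1 hp), mul_pow, hc, one_mul]
      have e3 : ∑ p ∈ Finset.range N, ψ p ω ^ 2 ≤ 1 :=
        sum_sq_ridgeCoeff_le (Finset.range N) (fun p => regressor ξ A a p ω) _ j
      rw [e1, e2]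
      nlinarith [sq_nonneg (I.σ : ℝ)]
    calc _ ≤ _ := lintegral_mono hle
      _ ≤ ENNReal.ofReal (Real.exp ((I.σ : ℝ) ^ 2 / 2)) * 1 := by
          rw [lintegral_const_mul' _ _ ENNReal.ofReal_ne_top]
          gcongr
      _ = _ := mul_one _
  · by_cases hp : p < N
    · simp only [hp, if_true]
      exact (h.measurable_ridgeStat q₀ a j hp p).const_mul c
    · simp only [hp, if_false]
      exact measurable_const
  · exact (measurable_labelNoise_part I ξ a p).mono
      (part_le_past (Or.inr ⟨p, Nat.lt_succ_self p, rfl⟩)) le_rfl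
  · exact indep_of_indep_of_le_right (indep_past_part h.measurable_sample h.law_sample
      h.indep_sample (notMem_allFeatures p)) (measurable_labelNoise_part I ξ a p).comap_le

/-- The least-squares noise at the features of `q₀` is small with high probability, when the
design is fixed in advance. -/
theorem IsRun.exists_noise_event (h : IsRun P I b w0 γ Te mode ξ A Fhat)
    (hI : I.IsBounded KC Kμ) (q₀ : ℕ × Fin n) (a : Fin k) {K : ℝ} (hK : 1 ≤ K) :
    ∃ E : Set Ω, P E ≤ ENNReal.ofReal (1 / K) ∧ ∀ ω ∉ E, ∀ u : Fin m → ℝ,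
      design ξ A a ((Te + 1) * n) ω *ᵥ u = (ξ q₀.1 q₀.2 ω).1.ofLp →
      |∑ p ∈ Finset.range ((Te + 1) * n), (regressor ξ A a p ω ⬝ᵥ u) * labelNoise I ξ a p ω| ≤
        √((ξ q₀.1 q₀.2 ω).1.ofLp ⬝ᵥ u) * (Real.log (2 * K) + (I.σ : ℝ) ^ 2 / 2) := by
  set N := (Te + 1) * n with hN
  set C : ℝ := 2 * Real.exp ((I.σ : ℝ) ^ 2 / 2) with hC
  have hC0 : 0 < C := by positivity
  set f : ℕ → Ω → ℝ≥0∞ := fun j ω => ENNReal.ofReal (Real.exp (1 * ridgeNoise I ξ A N q₀ a j ω)) +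
    ENNReal.ofReal (Real.exp ((-1) * ridgeNoise I ξ A N q₀ a j ω)) with hf
  have hfm : ∀ j, Measurable (f j) := fun j =>
    (Real.measurable_exp.comp ((h.measurable_ridgeNoise q₀ a j).const_mul 1)).ennreal_ofReal.add
      (Real.measurable_exp.comp ((h.measurable_ridgeNoise q₀ a j).const_mul (-1))).ennreal_ofReal
  have hint : ∀ j, ∫⁻ ω, f j ω ∂P ≤ ENNReal.ofReal C := by
    intro j
    have hm : Measurable fun ω =>
        ENNReal.ofReal (Real.exp (1 * ridgeNoise I ξ A N q₀ a j ω)) :=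
      (Real.measurable_exp.comp ((h.measurable_ridgeNoise q₀ a j).const_mul 1)).ennreal_ofReal
    simp only [hf]
    rw [lintegral_add_left hm, hC, two_mul, ENNReal.ofReal_add (by positivity) (by positivity)]
    exact add_le_add (h.lintegral_exp_ridgeNoise_le hI q₀ a j (by norm_num))
      (h.lintegral_exp_ridgeNoise_le hI q₀ a j (by norm_num))
  -- Taking the lower limit over the ridge parameters before Markov's inequality yields one event,
  -- valid for all solutions u at once.
  set Y : Ω → ℝ≥0∞ := fun ω => liminf (fun j => f j ω) atTop with hY
  have hYm : Measurable Y := Measurable.liminf hfm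
  have hYint : ∫⁻ ω, Y ω ∂P ≤ ENNReal.ofReal C :=
    (lintegral_liminf_le hfm).trans (liminf_le_of_frequently_le' (Frequently.of_forall hint))
  have hCK : 0 < C * K := by positivity
  refine ⟨{ω | ENNReal.ofReal (C * K) ≤ Y ω}, ?_, ?_⟩
  · calc P {ω | ENNReal.ofReal (C * K) ≤ Y ω} ≤ (∫⁻ ω, Y ω ∂P) / ENNReal.ofReal (C * K) :=
          meas_ge_le_lintegral_div hYm.aemeasurable (by simpa using hCK) (by simp)
      _ ≤ ENNReal.ofReal C / ENNReal.ofReal (C * K) := by gcongr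
      _ = ENNReal.ofReal (1 / K) := by
          rw [← ENNReal.ofReal_div_of_pos hCK]
          congr 1
          field_simp
  · intro ω hω u hu
    simp only [Set.mem_ofPred_eq, not_le] at hω
    set x := (ξ q₀.1 q₀.2 ω).1.ofLp
    have hxu : x ⬝ᵥ u = ∑ p ∈ Finset.range N, (regressor ξ A a p ω ⬝ᵥ u) ^ 2 := by
      rw [← hu, dotProduct_comm, design, dotProduct_sum_vecMulVec_mulVec]
      simp only [sq]
    set s := ∑ p ∈ Finset.range N, (regressor ξ A a p ω ⬝ᵥ u) * labelNoise I ξ a p ω with hs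
    have hx0 : 0 ≤ x ⬝ᵥ u := by rw [hxu]; positivity
    -- If x·u = 0, normalization is impossible, but then every weight vanishes and so does the noise
    -- term.
    rcases hx0.eq_or_lt with h0 | hpos
    · have hz : ∀ p ∈ Finset.range N, regressor ξ A a p ω ⬝ᵥ u = 0 := by
        intro p hp
        rw [hxu, eq_comm, Finset.sum_eq_zero_iff_of_nonneg fun _ _ => sq_nonneg _] at h0
        exact pow_eq_zero_iff two_ne_zero |>.1 (h0 p hp)
      have : s = 0 := Finset.sum_eq_zero fun p hp => by rw [hz p hp, zero_mul]
      rw [this, ← h0]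
      simp
    · have hlim : Tendsto (fun j => ridgeNoise I ξ A N q₀ a j ω) atTop (𝓝 (s / √(x ⬝ᵥ u))) :=
        tendsto_sum_ridgeCoeff (Finset.range N) (fun p => regressor ξ A a p ω)
          (fun p => labelNoise I ξ a p ω) hu hpos
      have hlimY : Y ω = ENNReal.ofReal (Real.exp (1 * (s / √(x ⬝ᵥ u)))) +
          ENNReal.ofReal (Real.exp ((-1) * (s / √(x ⬝ᵥ u)))) :=
        Tendsto.liminf_eq ((ENNReal.tendsto_ofReal ((hlim.const_mul 1).rexp)).add
          (ENNReal.tendsto_ofReal ((hlim.const_mul (-1)).rexp)))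
      rw [hlimY, ← ENNReal.ofReal_add (by positivity) (by positivity),
        ENNReal.ofReal_lt_ofReal_iff hCK] at hω
      have habs : Real.exp (|s| / √(x ⬝ᵥ u)) ≤ C * K := by
        rcases abs_cases s with ⟨hs, _⟩ | ⟨hs, _⟩ <;> rw [hs]
        · rw [one_mul] at hω
          linarith [Real.exp_pos ((-1) * (s / √(x ⬝ᵥ u)))]
        · rw [show -s / √(x ⬝ᵥ u) = (-1) * (s / √(x ⬝ᵥ u)) by ring]
          linarith [Real.exp_pos (1 * (s / √(x ⬝ᵥ u)))]
      rw [← Real.le_log_iff_exp_le hCK, div_le_iff₀ (Real.sqrt_pos.2 hpos)] at habs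
      have hlog : Real.log (C * K) = Real.log (2 * K) + (I.σ : ℝ) ^ 2 / 2 := by
        rw [hC, show 2 * Real.exp ((I.σ : ℝ) ^ 2 / 2) * K = (2 * K) *
          Real.exp ((I.σ : ℝ) ^ 2 / 2) by ring, Real.log_mul (by positivity) (by positivity),
          Real.log_exp]
      rw [hlog] at habs
      linarith

end FrozenNoise

/-! ### Prediction errors in the frozen variant. -/

section LabelBound

/-- The tangent bound √f ≤ (f/√s + √s)/2 gives Jensen's inequality and integrability together. -/
theorem integral_sqrt_toReal_le {Ω : Type*} [MeasurableSpace Ω] {P : Measure Ω}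
    [IsProbabilityMeasure P] {f : Ω → ℝ≥0∞} (hf : Measurable f) {s : ℝ} (hs : 0 < s)
    (h : ∫⁻ ω, f ω ∂P ≤ ENNReal.ofReal s) :
    Integrable (fun ω => √(f ω).toReal) P ∧ ∫ ω, √(f ω).toReal ∂P ≤ √s := by
  have hfin : ∫⁻ ω, f ω ∂P ≠ ⊤ := (h.trans_lt ENNReal.ofReal_lt_top).ne
  have hint : Integrable (fun ω => (f ω).toReal) P := integrable_toReal_of_lintegral_ne_top
    hf.aemeasurable hfin
  have hval : ∫ ω, (f ω).toReal ∂P ≤ s := by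
    rw [integral_toReal hf.aemeasurable (ae_lt_top hf hfin)]
    exact ENNReal.toReal_le_of_le_ofReal hs.le h
  have hs' : 0 < √s := Real.sqrt_pos.2 hs
  have hle : ∀ ω, √(f ω).toReal ≤ ((f ω).toReal / √s + √s) / 2 := by
    intro ω
    have h1 : (f ω).toReal = √(f ω).toReal ^ 2 := (Real.sq_sqrt ENNReal.toReal_nonneg).symm
    rw [h1, Real.sqrt_sq (Real.sqrt_nonneg _), le_div_iff₀ two_pos]
    have h2 : √(f ω).toReal ^ 2 / √s + √s - √(f ω).toReal * 2 =
        (√(f ω).toReal - √s) ^ 2 / √s := by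
      field_simp
      ring
    have h3 : 0 ≤ (√(f ω).toReal - √s) ^ 2 / √s := by positivity
    linarith
  have hbound : Integrable (fun ω => ((f ω).toReal / √s + √s) / 2) P :=
    ((hint.div_const _).add (integrable_const _)).div_const _
  have hI : Integrable (fun ω => √(f ω).toReal) P := by
    refine hbound.mono' (hf.ennreal_toReal.sqrt.aestronglyMeasurable)
      (Eventually.of_forall fun ω => ?_)
    rw [Real.norm_eq_abs, abs_of_nonneg (Real.sqrt_nonneg _)]
    exact hle ω
  refine ⟨hI, (integral_mono hI hbound hle).trans ?_⟩
  rw [integral_div, integral_add (hint.div_const _) (integrable_const _), integral_div]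
  simp only [integral_const, probReal_univ, smul_eq_mul, one_mul]
  have h4 : (∫ ω, (f ω).toReal ∂P) / √s ≤ √s := by
    rw [div_le_iff₀ hs', Real.mul_self_sqrt hs.le]
    exact hval
  linarith

variable {m d k n Te : ℕ} {Ω : Type*} [mΩ : MeasurableSpace Ω] {P : Measure Ω}
  {I : Problem m d k} {b : Fin d → Vec d} {w0 : Fin n → Fin k} {γ KC Kμ : ℝ} {mode : Training}
  {ξ : ℕ → Fin n → Ω → Vec m × Vec d × ℝ} {A : ℕ → Fin n → Ω → Fin k}
  {Fhat : ℕ → Ω → Fin k → Vec m →L[ℝ] Vec d}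

/-- Outside an event of probability at most `e`, the prediction errors for individual `i` in round
`t` are bounded by a variable of mean at most `r`, unless this variable exceeds `c`. -/
def LabelBound (P : Measure Ω) (I : Problem m d k) (ξ : ℕ → Fin n → Ω → Vec m × Vec d × ℝ)
    (Fhat : ℕ → Ω → Fin k → Vec m →L[ℝ] Vec d) (t : ℕ) (i : Fin n) (c e r : ℝ) : Prop :=
  ∃ (E : Set Ω) (L : Ω → ℝ), P E ≤ ENNReal.ofReal e ∧ Integrable L P ∧ ∫ ω, L ω ∂P ≤ r ∧
    (∀ ω, 0 ≤ L ω) ∧ ∀ᵐ ω ∂P, ω ∉ E → c ≤ L ω ∨ ∀ a,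
      2 * |(inner ℝ (Fhat t ω a (ξ t i ω).1 - I.F a (ξ t i ω).1) (I.act a) : ℝ)| ≤ L ω

/-- Up to probability 1/K, some block of exploration samples of a given action has leverage at most
the level of x, and the dichotomy turns this into x = V u with small x·u. Levels at least 1/2 are
useless for that, but there the bounding variable exceeds c. The level does not depend on the
action, so its mean is paid once and only the exceptional probability carries a factor k. -/
theorem IsRun.labelBound_frozen [NeZero n] [IsProbabilityMeasure P]
    (h : IsRun P I b w0 γ Te .frozen ξ A Fhat)
    (hI : I.IsBounded KC Kμ) (hm : 1 ≤ m) {t : ℕ} (ht : Te < t) (i : Fin n) {B M : ℕ}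
    (hBM : k * (B * M) ≤ n * Te) {K : ℝ} (hK : 1 ≤ K) (hKB : K ≤ 2 ^ B) {c : ℝ} (hc : 0 ≤ c) :
    LabelBound P I ξ Fhat t i c (k * (2 / K))
      ((c + 2 * (Real.log (2 * K) + (I.σ : ℝ) ^ 2 / 2)) * √(8 * (m / (M + 1)))) := by
  have hD := hI.isProbabilityMeasure
  have hK0 : 0 < K := by linarith
  have hm' : (1 : ℝ) ≤ m := by exact_mod_cast hm
  set x : Ω → Vec m := fun ω => (ξ t i ω).1 with hx
  have hxm : Measurable x := (h.measurable_sample t i).fst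
  choose E₁ hE₁ hE₁' using fun a => h.exists_noise_event hI (t, i) a hK
  let idx : Fin k → Fin B × Fin M → ℕ := fun a c => exploreIdx n a (c.1 * M + c.2)
  have hpos : ∀ c : Fin B × Fin M, k * ((c.1 * M + c.2 : ℕ) + 1) ≤ n * Te := by
    intro c
    refine le_trans (Nat.mul_le_mul_left k ?_) hBM
    have h1 := c.2.2
    have h2 : ((c.1 : ℕ) + 1) * M ≤ B * M := Nat.mul_le_mul_right M c.1.2
    rw [Nat.succ_mul] at h2
    omega
  have hinj : ∀ a, Function.Injective (idx a) := by
    intro a c c' hcc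
    have h1 := exploreIdx_injective a hcc
    have hM : 0 < M := c.2.pos
    have h2 : (c.1 : ℕ) = c'.1 := by
      have := congrArg (· / M) h1
      simpa [add_comm _ (c.2 : ℕ), add_comm _ (c'.2 : ℕ), Nat.add_mul_div_right _ _ hM,
        Nat.div_eq_of_lt c.2.2, Nat.div_eq_of_lt c'.2.2] using this
    have h3 : (c.2 : ℕ) = c'.2 := by rw [h2] at h1; omega
    exact Prod.ext (Fin.ext h2) (Fin.ext h3)
  let X : Fin k → Fin B → Fin M → Ω → Vec m := fun a β l ω =>
    (ξ (sampleIdx n (idx a (β, l))).1 (sampleIdx n (idx a (β, l))).2 ω).1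
  have hround : ∀ a c, (sampleIdx n (idx a c)).1 ≤ Te := by
    intro a c
    exact Nat.lt_succ_iff.1 ((Nat.div_lt_iff_lt_mul (Nat.pos_of_ne_zero (NeZero.ne n))).2
      (exploreIdx_lt a (hpos c)))
  let E₂ : Fin k → Set Ω := fun a =>
    {ω | ∀ β, leverageLevel I.D M (x ω) < leverage (x ω) fun l => X a β l ω}
  have hE₂ : ∀ a, P (E₂ a) ≤ ENNReal.ofReal (1 / K) := by
    intro a
    have h1 := measure_forall_leverageLevel_lt_le (P := P) I.D hm (x := x) (X := X a) hxm
      (fun β l => (h.measurable_sample _ _).fst)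
      (map_feature_blocks h.measurable_sample h.law_sample h.indep_sample (t, i)
        (fun c => sampleIdx n (idx a c)) (fun c c' hcc => hinj a (sampleIdx_injective hcc))
        (fun c hcc => by
          have := hround a c
          rw [hcc] at this
          exact absurd this (not_le.2 ht)))
    refine h1.trans ?_
    rw [ENNReal.le_ofReal_iff_toReal_le (by simp) (by positivity)]
    simp only [ENNReal.toReal_pow, ENNReal.toReal_inv, ENNReal.toReal_ofNat, inv_pow]
    rw [one_div]
    exact inv_anti₀ hK0 hKB
  set f : Ω → ℝ≥0∞ := fun ω => 2 * leverageLevel I.D M (x ω) with hf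
  have hfm : Measurable f := ((measurable_leverageLevel I.D).comp hxm).const_mul 2
  have hfint : ∫⁻ ω, f ω ∂P ≤ ENNReal.ofReal (8 * (m / (M + 1))) := by
    have h1 : ∫⁻ ω, leverageLevel I.D M (x ω) ∂P = ∫⁻ y, leverageLevel I.D M y ∂I.D := by
      have h2 := lintegral_map (μ := P) (measurable_leverageLevel (M := M) I.D) hxm
      rw [map_feature h.measurable_sample h.law_sample (t, i)] at h2
      exact h2.symm
    have hlm : Measurable fun ω => leverageLevel I.D M (x ω) :=
      (measurable_leverageLevel I.D).comp hxm
    simp only [hf]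
    rw [lintegral_const_mul _ hlm]
    calc 2 * ∫⁻ ω, leverageLevel I.D M (x ω) ∂P ≤ 2 * (4 * (m / (M + 1 : ℕ))) := by
          rw [h1]; gcongr; exact lintegral_leverageLevel_le I.D
      _ = ENNReal.ofReal (8 * (m / (M + 1))) := by
          rw [ENNReal.ofReal_mul (by norm_num), ENNReal.ofReal_div_of_pos (by positivity),
            ENNReal.ofReal_natCast, show ((M : ℝ) + 1) = ((M + 1 : ℕ) : ℝ) by push_cast; ring,
            ENNReal.ofReal_natCast, ← mul_assoc]
          norm_num
  obtain ⟨hint, hval⟩ := integral_sqrt_toReal_le hfm (by positivity) hfint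
  set L₀ := Real.log (2 * K) + (I.σ : ℝ) ^ 2 / 2 with hL₀
  have hL₀0 : 0 ≤ L₀ := by
    have := Real.log_nonneg (show 1 ≤ 2 * K by linarith)
    positivity
  refine ⟨⋃ a, (E₁ a ∪ E₂ a), fun ω => (c + 2 * L₀) * √(f ω).toReal, ?_, hint.const_mul _, ?_,
    fun ω => by positivity, ?_⟩
  · calc P (⋃ a, (E₁ a ∪ E₂ a)) ≤ ∑ a, P (E₁ a ∪ E₂ a) := measure_iUnion_fintype_le _ _
      _ ≤ ∑ _a : Fin k, ENNReal.ofReal (2 / K) := by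
          refine Finset.sum_le_sum fun a _ => (measure_union_le _ _).trans ?_
          refine (add_le_add (hE₁ a) (hE₂ a)).trans (le_of_eq ?_)
          rw [← ENNReal.ofReal_add (by positivity) (by positivity)]
          congr 1
          ring
      _ = ENNReal.ofReal (k * (2 / K)) := by
          rw [ENNReal.ofReal_mul (by positivity)]
          simp
  · rw [integral_const_mul]
    gcongr
  · have hfin : ∀ᵐ ω ∂P, f ω < ⊤ := ae_lt_top hfm (hfint.trans_lt ENNReal.ofReal_lt_top).ne
    filter_upwards [hfin] with ω hω hE
    simp only [Set.mem_iUnion, Set.mem_union, not_exists, not_or] at hE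
    have hlev : leverageLevel I.D M (x ω) ≠ ⊤ := by
      intro htop
      simp [hf, htop] at hω
    have hfl : (f ω).toReal = 2 * (leverageLevel I.D M (x ω)).toReal := by
      simp [hf, ENNReal.toReal_mul]
    set y := (leverageLevel I.D M (x ω)).toReal with hy
    have hy0 : 0 ≤ y := ENNReal.toReal_nonneg
    rcases le_or_gt 1 (2 * y) with hbig | hsmall
    · left
      have h1 : 1 ≤ √(f ω).toReal := by
        rw [hfl]; exact Real.one_le_sqrt.2 hbig
      nlinarith
    · right
      intro a
      have h2 := (hE a).2
      simp only [E₂, Set.mem_ofPred_eq, not_forall, not_lt] at h2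
      obtain ⟨β, hβ⟩ := h2
      have hdom := h.sampleGram_le_design a (idx := fun l : Fin M => ((β : ℕ) * M + l : ℕ))
        (fun l l' hl => by
          ext
          simpa using hl) (fun l => hpos (β, l)) le_rfl ω
      rcases leverage_dichotomy (x ω) (fun l => X a β l ω)
        (posSemidef_design ξ A a ((Te + 1) * n) ω) hdom with h3 | ⟨u, hu, hu0, h3⟩
      · exfalso
        have h4 := h3.trans hβ
        have h5 : 1 ≤ y := by
          rw [hy, ← ENNReal.toReal_one]
          exact ENNReal.toReal_mono hlev h4
        linarith
      · have h4 := h3.trans hβ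
        have h5 : (x ω).ofLp ⬝ᵥ u / (1 + (x ω).ofLp ⬝ᵥ u) ≤ y :=
          (ENNReal.ofReal_le_iff_le_toReal hlev).1 h4
        -- From z/(1 + z) ≤ y with y < 1/2; this is why `f` is twice the level.
        have h6 : (x ω).ofLp ⬝ᵥ u ≤ 2 * y := by
          rw [div_le_iff₀ (by positivity)] at h5
          nlinarith
        have h7 := hE₁' a ω (hE a).1 u hu
        rw [inner_leastSquares_error (R := Te + 1) (fun G => h.leastSquares t ht ω a G) hu]
        have h8 : √((x ω).ofLp ⬝ᵥ u) ≤ √(f ω).toReal := by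
          rw [hfl]; exact Real.sqrt_le_sqrt h6
        have h9 : √((x ω).ofLp ⬝ᵥ u) * L₀ ≤ √(f ω).toReal * L₀ :=
          mul_le_mul_of_nonneg_right h8 hL₀0
        have h10 : 0 ≤ c * √(f ω).toReal := by positivity
        linarith [h7.trans h9]

end LabelBound

/-! ### Concentration of the Gram matrix of a regular design. -/

section RandomDesign

variable {m : ℕ} {D : Measure (Vec m)} {KX κ : ℝ}

theorem abs_apply_le_norm (x : Vec m) (p : Fin m) : |x p| ≤ ‖x‖ := by
  simpa using PiLp.norm_apply_le x p

theorem IsRegularDesign.abs_mul_le (hD : IsRegularDesign D KX κ) (p q : Fin m) :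
    ∀ᵐ x ∂D, |x p * x q| ≤ KX ^ 2 := by
  filter_upwards [hD.norm_le] with x hx
  rw [abs_mul, sq]
  have h0 : 0 ≤ KX := (norm_nonneg x).trans hx
  exact mul_le_mul ((abs_apply_le_norm x p).trans hx) ((abs_apply_le_norm x q).trans hx)
    (abs_nonneg _) h0

theorem IsRegularDesign.integrable_mul [IsProbabilityMeasure D] (hD : IsRegularDesign D KX κ)
    (p q : Fin m) : Integrable (fun x : Vec m => x p * x q) D :=
  Integrable.of_bound (by fun_prop) (KX ^ 2) (hD.abs_mul_le p q)

theorem IsRegularDesign.le_sum [IsProbabilityMeasure D] (hD : IsRegularDesign D KX κ)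
    (v : Fin m → ℝ) :
    κ * (v ⬝ᵥ v) ≤ ∑ p, ∑ q, v p * v q * ∫ x, x p * x q ∂D := by
  have h := hD.le_secondMoment (WithLp.toLp 2 v)
  have e1 : ‖(WithLp.toLp 2 v : Vec m)‖ ^ 2 = v ⬝ᵥ v := by
    rw [← real_inner_self_eq_norm_sq, inner_eq_dotProduct]
  have e2 : ∀ x : Vec m, (inner ℝ x (WithLp.toLp 2 v) : ℝ) ^ 2 =
      ∑ p, ∑ q, v p * v q * (x p * x q) := by
    intro x
    rw [inner_eq_dotProduct, sq, dotProduct, Finset.sum_mul_sum]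
    refine Finset.sum_congr rfl fun p _ => Finset.sum_congr rfl fun q _ => ?_
    ring
  rw [e1] at h
  refine h.trans (le_of_eq ?_)
  simp only [e2]
  rw [integral_finsetSum _ fun p _ => integrable_finsetSum _ fun q _ =>
    (hD.integrable_mul p q).const_mul _]
  refine Finset.sum_congr rfl fun p _ => ?_
  rw [integral_finsetSum _ fun q _ => (hD.integrable_mul p q).const_mul _]
  exact Finset.sum_congr rfl fun q _ => integral_const_mul _ _

theorem IsRegularDesign.nonneg [IsProbabilityMeasure D] (hD : IsRegularDesign D KX κ) :
    0 ≤ KX := by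
  obtain ⟨x, hx⟩ := hD.norm_le.exists
  exact (norm_nonneg x).trans hx

/-- The dimension is bounded by the ratio of the two parameters of a regular design. -/
theorem IsRegularDesign.card_mul_le [IsProbabilityMeasure D] (hD : IsRegularDesign D KX κ) :
    m * κ ≤ KX ^ 2 := by
  have h1 : ∀ p : Fin m, κ ≤ ∫ x, x p * x p ∂D := by
    intro p
    have := hD.le_sum (Pi.single p 1)
    simpa [Pi.single_apply] using this
  calc (m : ℝ) * κ = ∑ _p : Fin m, κ := by simp
    _ ≤ ∑ p, ∫ x, x p * x p ∂D := Finset.sum_le_sum fun p _ => h1 p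
    _ = ∫ x, ∑ p, x p * x p ∂D := (integral_finsetSum _ fun p _ => hD.integrable_mul p p).symm
    _ ≤ ∫ _, KX ^ 2 ∂D := by
        refine integral_mono_ae (integrable_finsetSum _ fun p _ => hD.integrable_mul p p)
          (integrable_const _) ?_
        filter_upwards [hD.norm_le] with x hx
        have : ∑ p, x p * x p = ‖x‖ ^ 2 := by
          rw [EuclideanSpace.norm_sq_eq]
          simp [sq]
        rw [this]
        gcongr
    _ = KX ^ 2 := by simp

variable {Ω : Type*} [mΩ : MeasurableSpace Ω] {P : Measure Ω} [IsProbabilityMeasure P]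

/-- Hoeffding's inequality: a variable in [-K, K] is sub-Gaussian with variance proxy K². -/
theorem measure_sum_sub_integral_ge_le {Y : ℕ → Ω → Vec m} (hY : ∀ l, Measurable (Y l))
    (hind : iIndepFun Y P) (hlaw : ∀ l, P.map (Y l) = D) {f : Vec m → ℝ} (hf : Measurable f)
    {K : ℝ} (hK : 0 ≤ K) (hbd : ∀ᵐ x ∂D, |f x| ≤ K) (N : ℕ) {ε : ℝ} (hε : 0 ≤ ε) :
    P {ω | ε ≤ ∑ l ∈ Finset.range N, (f (Y l ω) - ∫ x, f x ∂D)} ≤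
      ENNReal.ofReal (Real.exp (-ε ^ 2 / (2 * N * K ^ 2))) := by
  have hmean : ∀ l, ∫ ω, f (Y l ω) ∂P = ∫ x, f x ∂D := fun l => by
    rw [← hlaw l, integral_map (hY l).aemeasurable hf.aestronglyMeasurable]
  have hsub : ∀ l, HasSubgaussianMGF (fun ω => f (Y l ω) - ∫ x, f x ∂D) ((‖K - -K‖₊ / 2) ^ 2) P := by
    intro l
    rw [← hmean l]
    refine hasSubgaussianMGF_of_mem_Icc (hf.comp (hY l)).aemeasurable ?_
    have h1 : ∀ᵐ x ∂(P.map (Y l)), |f x| ≤ K := by rw [hlaw l]; exact hbd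
    filter_upwards [ae_of_ae_map (hY l).aemeasurable h1] with ω hω
    exact abs_le.1 hω
  have hindf : iIndepFun (fun l ω => f (Y l ω) - ∫ x, f x ∂D) P :=
    hind.comp (fun _ x => f x - ∫ x, f x ∂D) fun _ => hf.sub_const _
  have h := HasSubgaussianMGF.measure_sum_range_ge_le_of_iIndepFun hindf (n := N)
    (fun l _ => hsub l) hε
  rw [← ENNReal.ofReal_toReal (measure_ne_top P _)]
  refine ENNReal.ofReal_le_ofReal (h.trans (le_of_eq ?_))
  congr 3
  push_cast
  rw [Real.norm_eq_abs, abs_of_nonneg (by linarith)]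
  ring

/-- The Gram matrix of independent samples from a regular design is well conditioned with high
probability. -/
theorem IsRegularDesign.measure_not_forall_le [IsProbabilityMeasure D] (hD : IsRegularDesign D KX κ)
    (hκ : 0 < κ) (hm : 1 ≤ m) {Y : ℕ → Ω → Vec m} (hY : ∀ l, Measurable (Y l))
    (hind : iIndepFun Y P) (hlaw : ∀ l, P.map (Y l) = D) (N : ℕ) :
    P {ω | ¬ ∀ v : Fin m → ℝ, κ * N / 2 * (v ⬝ᵥ v) ≤
        ∑ l ∈ Finset.range N, ((Y l ω).ofLp ⬝ᵥ v) ^ 2} ≤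
      ENNReal.ofReal (2 * m ^ 2 *
        Real.exp (-(N * κ / (2 * m)) ^ 2 / (2 * N * (KX ^ 2) ^ 2))) := by
  have hm' : (1 : ℝ) ≤ m := by exact_mod_cast hm
  -- Entrywise deviations of size ε change the form at v by at most ε (∑ |v_p|)² ≤ ε m (v·v), which
  -- is half of the guaranteed mean κ N (v·v).
  set ε : ℝ := N * κ / (2 * m) with hε
  have hε0 : 0 ≤ ε := by positivity
  set ρ := Real.exp (-ε ^ 2 / (2 * N * (KX ^ 2) ^ 2)) with hρ
  let f : Fin m → Fin m → Vec m → ℝ := fun p q x => x p * x q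
  have hf : ∀ p q, Measurable (f p q) := fun p q => by fun_prop
  let E : Fin m → Fin m → Set Ω := fun p q =>
    {ω | ε ≤ ∑ l ∈ Finset.range N, (f p q (Y l ω) - ∫ x, f p q x ∂D)} ∪
    {ω | ε ≤ ∑ l ∈ Finset.range N, ((-f p q) (Y l ω) - ∫ x, (-f p q) x ∂D)}
  have hE : ∀ p q, P (E p q) ≤ ENNReal.ofReal (2 * ρ) := by
    intro p q
    refine (measure_union_le _ _).trans ?_
    rw [two_mul, ENNReal.ofReal_add (Real.exp_pos _).le (Real.exp_pos _).le]
    refine add_le_add ?_ ?_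
    · exact measure_sum_sub_integral_ge_le hY hind hlaw (hf p q) (sq_nonneg KX)
        (hD.abs_mul_le p q) N hε0
    · refine measure_sum_sub_integral_ge_le hY hind hlaw (hf p q).neg (sq_nonneg KX) ?_ N hε0
      filter_upwards [hD.abs_mul_le p q] with x hx
      simpa [f] using hx
  calc _ ≤ P (⋃ p, ⋃ q, E p q) := by
        refine measure_mono ?_
        intro ω hω
        by_contra hcon
        simp only [Set.mem_iUnion, not_exists] at hcon
        refine hω ?_
        intro v
        have hdev : ∀ p q, |∑ l ∈ Finset.range N, (f p q (Y l ω) - ∫ x, f p q x ∂D)| ≤ ε := by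
          intro p q
          have h1 := hcon p q
          simp only [E, Set.mem_union, Set.mem_ofPred_eq, not_or, not_le, Pi.neg_apply,
            integral_neg] at h1
          have h2 : ∑ l ∈ Finset.range N, (-f p q (Y l ω) - -∫ x, f p q x ∂D) =
              -∑ l ∈ Finset.range N, (f p q (Y l ω) - ∫ x, f p q x ∂D) := by
            rw [← Finset.sum_neg_distrib]
            exact Finset.sum_congr rfl fun l _ => by ring
          rw [h2] at h1
          rw [abs_le]
          constructor <;> linarith [h1.1, h1.2]
        have e1 : ∑ l ∈ Finset.range N, ((Y l ω).ofLp ⬝ᵥ v) ^ 2 =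
            ∑ p, ∑ q, v p * v q * (∑ l ∈ Finset.range N, (f p q (Y l ω) - ∫ x, f p q x ∂D)) +
              N * ∑ p, ∑ q, v p * v q * ∫ x, f p q x ∂D := by
          have e2 : ∀ p q, v p * v q * (∑ l ∈ Finset.range N, (f p q (Y l ω) - ∫ x, f p q x ∂D)) =
              v p * v q * (∑ l ∈ Finset.range N, f p q (Y l ω)) -
                N * (v p * v q * ∫ x, f p q x ∂D) := by
            intro p q
            rw [Finset.sum_sub_distrib, Finset.sum_const, Finset.card_range, nsmul_eq_mul]
            ring
          have e5 : ∑ p, ∑ q, (N : ℝ) * (v p * v q * ∫ x, f p q x ∂D) =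
              N * ∑ p, ∑ q, v p * v q * ∫ x, f p q x ∂D := by
            simp only [Finset.mul_sum]
          rw [Finset.sum_congr rfl fun p _ => Finset.sum_congr rfl fun q _ => e2 p q]
          simp only [Finset.sum_sub_distrib]
          rw [e5, sub_add_cancel]
          simp only [Finset.mul_sum]
          rw [Finset.sum_congr rfl fun p _ => Finset.sum_comm, Finset.sum_comm]
          refine Finset.sum_congr rfl fun l _ => ?_
          rw [sq, dotProduct, Finset.sum_mul_sum]
          refine Finset.sum_congr rfl fun p _ => Finset.sum_congr rfl fun q _ => ?_
          simp only [f]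
          ring
        have e3 : -(ε * (m * (v ⬝ᵥ v))) ≤
            ∑ p, ∑ q, v p * v q * (∑ l ∈ Finset.range N, (f p q (Y l ω) - ∫ x, f p q x ∂D)) := by
          have e4 : ∀ p q, -(ε * (|v p| * |v q|)) ≤
              v p * v q * (∑ l ∈ Finset.range N, (f p q (Y l ω) - ∫ x, f p q x ∂D)) := by
            intro p q
            have := abs_mul (v p * v q)
              (∑ l ∈ Finset.range N, (f p q (Y l ω) - ∫ x, f p q x ∂D))
            refine neg_le_of_abs_le ?_
            rw [this, abs_mul, mul_comm ε]
            exact mul_le_mul_of_nonneg_left (hdev p q) (by positivity)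
          refine le_trans ?_ (Finset.sum_le_sum fun p _ => Finset.sum_le_sum fun q _ => e4 p q)
          simp only [Finset.sum_neg_distrib, ← Finset.mul_sum]
          rw [← Finset.sum_mul]
          refine neg_le_neg (mul_le_mul_of_nonneg_left ?_ hε0)
          have := sq_sum_le_card_mul_sum_sq (s := (Finset.univ : Finset (Fin m)))
            (f := fun p => |v p|)
          rw [Finset.card_univ, Fintype.card_fin, sq] at this
          refine this.trans (le_of_eq ?_)
          simp [dotProduct, sq]
        have e5 := hD.le_sum v
        have e6 : ε * (m * (v ⬝ᵥ v)) = κ * N / 2 * (v ⬝ᵥ v) := by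
          rw [hε]; field_simp
        rw [e1]
        have e7 := mul_le_mul_of_nonneg_left e5 (Nat.cast_nonneg (α := ℝ) N)
        simp only [f] at e3 ⊢
        linarith
    _ ≤ ∑ p, ∑ q, P (E p q) := (measure_iUnion_fintype_le _ _).trans
        (Finset.sum_le_sum fun p _ => measure_iUnion_fintype_le _ _)
    _ ≤ ∑ _p : Fin m, ∑ _q : Fin m, ENNReal.ofReal (2 * ρ) :=
        Finset.sum_le_sum fun p _ => Finset.sum_le_sum fun q _ => hE p q
    _ = ENNReal.ofReal (2 * m ^ 2 * ρ) := by
        simp only [Finset.sum_const, Finset.card_univ, Fintype.card_fin, nsmul_eq_mul]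
        rw [← ENNReal.ofReal_natCast, ← ENNReal.ofReal_mul (by positivity),
          ← ENNReal.ofReal_mul (by positivity)]
        congr 1
        ring

end RandomDesign

/-! ### Label noise and prediction errors for adaptively collected data. -/

section RetrainNoise

set_option linter.unusedSectionVars false

variable {m d k n Te : ℕ} [NeZero n] {Ω : Type*} [mΩ : MeasurableSpace Ω] {P : Measure Ω}
  [IsProbabilityMeasure P]
  {I : Problem m d k} {b : Fin d → Vec d} {w0 : Fin n → Fin k} {γ KC Kμ KX κ : ℝ} {mode : Training}
  {ξ : ℕ → Fin n → Ω → Vec m × Vec d × ℝ} {A : ℕ → Fin n → Ω → Fin k}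
  {Fhat : ℕ → Ω → Fin k → Vec m →L[ℝ] Vec d}

/-- What is drawn before the noise of the `p`-th sample. -/
def beforeSample (n : ℕ) [NeZero n] (p : ℕ) : Set ((ℕ × Fin n) × Bool) :=
  {q | (q.2 = true ∧ ∃ r < p, q.1 = sampleIdx n r) ∨ (q.2 = false ∧ q.1.1 ≤ p / n)}

theorem beforeSample_mono : Monotone (beforeSample n) := by
  intro p p' hpp q hq
  rcases hq with ⟨h1, r, hr, hq⟩ | ⟨h1, hq⟩
  · exact Or.inl ⟨h1, r, hr.trans_le hpp, hq⟩
  · exact Or.inr ⟨h1, hq.trans (Nat.div_le_div_right hpp)⟩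

theorem notMem_beforeSample (p : ℕ) : (sampleIdx n p, true) ∉ beforeSample n p := by
  rintro (⟨-, r, hr, h⟩ | ⟨h, -⟩)
  · exact hr.ne' (sampleIdx_injective h)
  · simp at h

/-- An action may depend on the features of all individuals of its round, so the filtration over
samples reveals the features of a round together and only the noises in order. -/
theorem beforeNoise_subset_beforeSample (p : ℕ) : beforeNoise n (p / n) ⊆ beforeSample n p := by
  rintro ⟨⟨s, i⟩, c⟩ hq
  have hn : 0 < n := Nat.pos_of_ne_zero (NeZero.ne n)
  have hs : s ≤ p / n := by
    rcases hq with hq | hq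
    · exact hq.le
    · exact hq.1.le
  cases c
  · exact Or.inr ⟨rfl, hs⟩
  · rcases hq with hq | hq
    · refine Or.inl ⟨rfl, s * n + i, ?_, (sampleIdx_mul_add s i).symm⟩
      have h1 : (s + 1) * n ≤ p := (Nat.le_div_iff_mul_le hn).1 hq
      rw [Nat.succ_mul] at h1
      have := i.2
      omega
    · exact absurd hq.2 (by simp)

theorem IsRun.measurable_regressor (h : IsRun P I b w0 γ Te mode ξ A Fhat) (a : Fin k) (p : ℕ) :
    Measurable[past ξ (beforeSample n p)] (regressor ξ A a p) := by
  refine measurable_ite_apply ((h.measurable_action_past (sampleIdx n p).1 (sampleIdx n p).2).mono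
    (past_mono (beforeNoise_subset_beforeSample p)) le_rfl) ?_ a 0
  have h1 := (measurable_feature_part ξ (sampleIdx n p)).mono
    (part_le_past (ξ := ξ) (S := beforeSample n p) (Or.inr ⟨rfl, le_rfl⟩)) le_rfl
  have h2 : Measurable fun x : Vec m => x.ofLp := by fun_prop
  exact h2.comp h1

theorem IsRun.ae_norm_feature_le (h : IsRun P I b w0 γ Te mode ξ A Fhat) [IsProbabilityMeasure I.D]
    (hD : IsRegularDesign I.D KX κ) : ∀ᵐ ω ∂P, ∀ q : ℕ × Fin n, ‖(ξ q.1 q.2 ω).1‖ ≤ KX := by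
  rw [ae_all_iff]
  intro q
  have h1 := hD.norm_le
  rw [← map_feature h.measurable_sample h.law_sample q] at h1
  exact ae_of_ae_map (h.measurable_sample _ _).fst.aemeasurable h1

theorem regressor_dotProduct_self_le {ω : Ω} (hω : ∀ q : ℕ × Fin n, ‖(ξ q.1 q.2 ω).1‖ ≤ KX)
    (a : Fin k) (p : ℕ) : regressor ξ A a p ω ⬝ᵥ regressor ξ A a p ω ≤ KX ^ 2 := by
  simp only [regressor]
  split_ifs
  · rw [← inner_eq_dotProduct, real_inner_self_eq_norm_sq]
    exact pow_le_pow_left₀ (norm_nonneg _) (hω _) 2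
  · simpa using sq_nonneg KX

/-- The self-normalized bound for the label noise of adaptively collected data. -/
theorem IsRun.measure_labelNoise_ge_le (h : IsRun P I b w0 γ Te mode ξ A Fhat)
    (hI : I.IsBounded KC Kμ) (hD : IsRegularDesign I.D KX κ) (hm : 1 ≤ m) (a : Fin k) (N : ℕ)
    {K : ℝ} (hK : 1 ≤ K) :
    P {ω | 2 * ((I.σ : ℝ) ^ 2 + 1) * (Real.log K + m * Real.log (1 + KX ^ 2 * N) / 2) ≤
        (∑ p ∈ Finset.range N, labelNoise I ξ a p ω • regressor ξ A a p ω) ⬝ᵥ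
          (1 + design ξ A a N ω)⁻¹ *ᵥ
            (∑ p ∈ Finset.range N, labelNoise I ξ a p ω • regressor ξ A a p ω)} ≤
      ENNReal.ofReal (1 / K) := by
  have := hI.isProbabilityMeasure
  have hne : Nonempty (Fin m) := ⟨⟨0, hm⟩⟩
  have hm' : (1 : ℝ) ≤ m := by exact_mod_cast hm
  have hs : (0 : ℝ) < (I.σ : ℝ) ^ 2 + 1 := by positivity
  have key := measure_selfNormalized_ge_le (P := P) (G := (1 : Matrix (Fin m) (Fin m) ℝ))
    (𝓕 := fun p => past ξ (beforeSample n p)) (φ := regressor ξ A a) (g := labelNoise I ξ a)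
    (v := fun _ => I.σ ^ 2 * ‖I.act a‖₊ ^ 2) (θ := ((I.σ : ℝ) ^ 2 + 1)⁻¹)
    (R := (1 + KX ^ 2 * N) ^ m) (δ := 1 / K)
    (fun p => past_le h.measurable_sample _) (fun p q hpq => past_mono (beforeSample_mono hpq))
    (fun p => h.measurable_regressor a p)
    (fun p => (measurable_labelNoise_part I ξ a p).mono
      (part_le_past (Or.inl ⟨rfl, p, Nat.lt_succ_self p, rfl⟩)) le_rfl)
    (fun p => indep_of_indep_of_le_right (indep_past_part h.measurable_sample h.law_sample
      h.indep_sample (notMem_beforeSample p)) (measurable_labelNoise_part I ξ a p).comap_le)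
    (fun p => map_labelNoise h.measurable_sample h.law_sample a p) (by positivity)
    (fun p => ?_) Matrix.PosDef.one N (by positivity) (by positivity) ?_
  · refine le_trans (measure_mono ?_) key
    intro ω hω
    simp only [Set.mem_ofPred_eq] at hω ⊢
    refine le_trans (le_of_eq ?_) hω
    rw [one_div_one_div, Real.log_pow]
    field_simp
  · rw [inv_mul_le_iff₀ hs]
    have := noise_var_le (s := I.σ) (hI.norm_act_le a)
    linarith
  · filter_upwards [h.ae_norm_feature_le hD] with ω hω
    have h1 := det_one_add_sum_vecMulVec_le (Finset.range N) (fun p => regressor ξ A a p ω)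
      (K := KX ^ 2) fun p _ => by
        rw [Fintype.card_fin]
        have := regressor_dotProduct_self_le (A := A) hω a p
        nlinarith [sq_nonneg KX]
    simpa using h1

/-- Exploration samples alone give V ≥ κN/2, and later data only increase V. Cauchy–Schwarz
separates the self-normalized noise from u·u + u·Vu. The condition κN ≥ 2 gives u·u ≤ u·Vu, so the
identity added for regularization costs a factor 2. -/
theorem IsRun.labelBound_retrain (h : IsRun P I b w0 γ Te .retrain ξ A Fhat)
    (hI : I.IsBounded KC Kμ) (hD : IsRegularDesign I.D KX κ) (hκ : 0 < κ) (hm : 1 ≤ m) {t : ℕ}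
    (ht : Te < t) (i : Fin n) {N : ℕ} (hN : k * N ≤ n * Te) (hκN : 2 ≤ κ * N) {K : ℝ} (hK : 1 ≤ K)
    (c : ℝ) :
    LabelBound P I ξ Fhat t i c
      (k * (2 * m ^ 2 * Real.exp (-(N * κ / (2 * m)) ^ 2 / (2 * N * (KX ^ 2) ^ 2)) + 1 / K))
      (4 * KX / √(κ * N) *
        √(2 * ((I.σ : ℝ) ^ 2 + 1) * (Real.log K + m * Real.log (1 + KX ^ 2 * (t * n : ℕ)) / 2))) := by
  have hDp := hI.isProbabilityMeasure
  have hK0 : 0 < K := by linarith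
  have hKX := hD.nonneg
  set ρ := 2 * (m : ℝ) ^ 2 * Real.exp (-(N * κ / (2 * m)) ^ 2 / (2 * N * (KX ^ 2) ^ 2)) with hρ
  have hρ0 : 0 ≤ ρ := by positivity
  set Q₀ := 2 * ((I.σ : ℝ) ^ 2 + 1) *
    (Real.log K + m * Real.log (1 + KX ^ 2 * (t * n : ℕ)) / 2) with hQ₀
  let E₁ : Fin k → Set Ω := fun a => {ω | ¬ ∀ v : Fin m → ℝ, κ * N / 2 * (v ⬝ᵥ v) ≤
    ∑ l ∈ Finset.range N, ((ξ (sampleIdx n (exploreIdx n a l)).1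
      (sampleIdx n (exploreIdx n a l)).2 ω).1.ofLp ⬝ᵥ v) ^ 2}
  let S : Fin k → Ω → Fin m → ℝ := fun a ω =>
    ∑ p ∈ Finset.range (t * n), labelNoise I ξ a p ω • regressor ξ A a p ω
  let E₂ : Fin k → Set Ω := fun a =>
    {ω | Q₀ ≤ S a ω ⬝ᵥ (1 + design ξ A a (t * n) ω)⁻¹ *ᵥ S a ω}
  have hE₁ : ∀ a, P (E₁ a) ≤ ENNReal.ofReal ρ := fun a =>
    hD.measure_not_forall_le hκ hm (Y := fun l ω => (ξ (sampleIdx n (exploreIdx n a l)).1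
      (sampleIdx n (exploreIdx n a l)).2 ω).1) (fun l => (h.measurable_sample _ _).fst)
      ((h.indep_sample.precomp (sampleIdx_injective.comp (exploreIdx_injective a))).comp
        (fun _ => Prod.fst) fun _ => measurable_fst)
      (fun l => map_feature h.measurable_sample h.law_sample _) N
  have hE₂ : ∀ a, P (E₂ a) ≤ ENNReal.ofReal (1 / K) := fun a =>
    h.measure_labelNoise_ge_le hI hD hm a (t * n) hK
  refine ⟨⋃ a, (E₁ a ∪ E₂ a), fun _ => 4 * KX / √(κ * N) * √Q₀, ?_, integrable_const _,
    by simp, fun ω => by positivity, ?_⟩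
  · calc P (⋃ a, (E₁ a ∪ E₂ a)) ≤ ∑ a, P (E₁ a ∪ E₂ a) := measure_iUnion_fintype_le _ _
      _ ≤ ∑ _a : Fin k, ENNReal.ofReal (ρ + 1 / K) := by
          refine Finset.sum_le_sum fun a _ => (measure_union_le _ _).trans ?_
          refine (add_le_add (hE₁ a) (hE₂ a)).trans (le_of_eq ?_)
          rw [← ENNReal.ofReal_add (by positivity) (by positivity)]
      _ = ENNReal.ofReal (k * (ρ + 1 / K)) := by
          rw [ENNReal.ofReal_mul (by positivity)]
          simp
  · filter_upwards [h.ae_norm_feature_le hD] with ω hω hE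
    simp only [Set.mem_iUnion, Set.mem_union, not_exists, not_or] at hE
    right
    intro a
    obtain ⟨h1, h2⟩ := hE a
    simp only [E₁, Set.mem_ofPred_eq, not_not] at h1
    simp only [E₂, Set.mem_ofPred_eq, not_le] at h2
    set V := design ξ A a (t * n) ω with hV
    have hVps : V.PosSemidef := posSemidef_design ξ A a (t * n) ω
    have hVge : ∀ v : Fin m → ℝ, κ * N / 2 * (v ⬝ᵥ v) ≤ v ⬝ᵥ V *ᵥ v := by
      intro v
      refine (h1 v).trans ?_
      have h3 := h.sampleGram_le_design a (M := N) (N := t * n) (idx := fun l : Fin N => (l : ℕ))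
        Fin.val_injective (fun l => (Nat.mul_le_mul_left k l.2).trans hN)
        (Nat.mul_le_mul_right n ht) ω v
      refine le_trans (le_of_eq ?_) h3
      rw [sampleGram, dotProduct_sum_vecMulVec_mulVec, Finset.sum_range]
      simp only [sq]
    have hVpd : V.PosDef := by
      refine Matrix.PosDef.of_dotProduct_mulVec_pos hVps.isHermitian fun v hv => ?_
      have h4 : 0 < v ⬝ᵥ v := (dotProduct_self_nonneg v).lt_of_ne'
        fun h0 => hv (dotProduct_self_eq_zero.1 h0)
      have h5 := hVge v
      rw [star_trivial]
      nlinarith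
    set x := (ξ t i ω).1 with hx
    set u := V⁻¹ *ᵥ x.ofLp with hu
    have hVu : V *ᵥ u = x.ofLp := PosDef.mulVec_inv_mulVec hVpd _
    rw [inner_leastSquares_error (R := t) (fun G => h.leastSquares t ht ω a G) hVu]
    set e := ∑ p ∈ Finset.range (t * n), (regressor ξ A a p ω ⬝ᵥ u) * labelNoise I ξ a p ω with he
    have heS : e = S a ω ⬝ᵥ u := by
      simp only [he, S, sum_dotProduct, smul_dotProduct, smul_eq_mul]
      exact Finset.sum_congr rfl fun p _ => mul_comm _ _
    have hG : (1 + V).PosDef := Matrix.PosDef.one.add_posSemidef hVps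
    have hcs := PosDef.dotProduct_sq_le hG (S a ω) u
    rw [← heS, Matrix.add_mulVec, Matrix.one_mulVec, dotProduct_add, hVu] at hcs
    set l := u ⬝ᵥ x.ofLp with hl
    have huV : κ * N / 2 * (u ⬝ᵥ u) ≤ l := by
      have := hVge u
      rwa [hVu] at this
    have huu : 0 ≤ u ⬝ᵥ u := dotProduct_self_nonneg u
    have hl0 : 0 ≤ l := le_trans (by positivity) huV
    have h6 : u ⬝ᵥ u ≤ l := by nlinarith
    have hlle : l ^ 2 ≤ (u ⬝ᵥ u) * KX ^ 2 := by
      have h7 := PosSemidef.form_sq_le (Matrix.PosSemidef.one (n := Fin m) (R := ℝ)) u x.ofLp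
      simp only [Matrix.one_mulVec] at h7
      refine h7.trans (mul_le_mul_of_nonneg_left ?_ huu)
      rw [← inner_eq_dotProduct, real_inner_self_eq_norm_sq]
      exact pow_le_pow_left₀ (norm_nonneg _) (hω (t, i)) 2
    have hκN0 : 0 < κ * N := by linarith
    -- Here l = x·V⁻¹x. Combining l² ≤ (u·u) KX² with u·u ≤ 2l/(κN) leaves one factor l to cancel.
    have hlfin : l ≤ 2 * KX ^ 2 / (κ * N) := by
      rw [le_div_iff₀ hκN0]
      by_contra! hcon
      have hlpos : 0 < l := by
        by_contra! h0
        have : l = 0 := le_antisymm h0 hl0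
        rw [this, zero_mul] at hcon
        nlinarith [sq_nonneg KX]
      nlinarith [mul_le_mul_of_nonneg_right huV (sq_nonneg KX), mul_pos hlpos hκN0]
    have hQ0 := PosDef.inv_form_nonneg hG (S a ω)
    have hQ₀0 : 0 ≤ Q₀ := hQ0.trans h2.le
    have h8 : e ^ 2 ≤ (2 * KX / √(κ * N) * √Q₀) ^ 2 := by
      rw [mul_pow, div_pow, Real.sq_sqrt hκN0.le, Real.sq_sqrt hQ₀0]
      calc e ^ 2 ≤ _ := hcs
        _ ≤ Q₀ * (2 * (2 * KX ^ 2 / (κ * N))) := by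
            refine mul_le_mul h2.le (by linarith) (by positivity) hQ₀0
        _ = (2 * KX) ^ 2 / (κ * N) * Q₀ := by ring
    have h9 := abs_le_of_sq_le_sq h8 (by positivity)
    calc 2 * |e| ≤ 2 * (2 * KX / √(κ * N) * √Q₀) := by linarith [h9]
      _ = 4 * KX / √(κ * N) * √Q₀ := by ring

end RetrainNoise

/-! ### Reduction of the regret to conditional mean losses. -/

section Regret

theorem measurable_apply_finite {Ω α ι : Type*} [Fintype ι] [MeasurableSpace ι]
    [MeasurableSingletonClass ι] [MeasurableSpace Ω] [MeasurableSpace α] {f : α → ι → ℝ}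
    (hf : ∀ a, Measurable fun x => f x a) {W : Ω → ι} (hW : Measurable W) {X : Ω → α}
    (hX : Measurable X) : Measurable fun ω => f (X ω) (W ω) := by
  classical
  have : (fun ω => f (X ω) (W ω)) = fun ω => ∑ a, if W ω = a then f (X ω) a else 0 := by
    funext ω
    simp
  rw [this]
  refine Finset.measurable_fun_sum _ fun a _ => ?_
  exact Measurable.ite (hW (measurableSet_singleton a)) ((hf a).comp hX) measurable_const

variable {m d k n Te : ℕ} {Ω : Type*} [mΩ : MeasurableSpace Ω] {P : Measure Ω}
  {I : Problem m d k} {b : Fin d → Vec d} {w0 : Fin n → Fin k} {γ KC Kμ : ℝ} {mode : Training}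
  {ξ : ℕ → Fin n → Ω → Vec m × Vec d × ℝ} {A : ℕ → Fin n → Ω → Fin k}
  {Fhat : ℕ → Ω → Fin k → Vec m →L[ℝ] Vec d} {π : Vec m → Fin k}

theorem Problem.IsOptimalPolicy.meanCost_le (hπ : I.IsOptimalPolicy π) (x : Vec m) (a : Fin k) :
    I.meanCost x (π x) ≤ I.meanCost x a := by
  simpa only [I.expectedCost_eq] using hπ.le x a

theorem Problem.continuous_meanCost (I : Problem m d k) (a : Fin k) :
    Continuous fun x => I.meanCost x a := by
  unfold Problem.meanCost
  fun_prop

/-- The ℓ¹ bound on the mean label pairs with coordinates of the action, which the ℓ² norm bounds by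
one. -/
theorem Problem.IsBounded.abs_meanCost_le (hI : I.IsBounded KC Kμ) :
    ∀ᵐ x ∂I.D, ∀ a, |I.meanCost x a| ≤ KC + Kμ := by
  filter_upwards [hI.mean_le] with x hx a
  have h1 : |(inner ℝ (I.F a x) (I.act a) : ℝ)| ≤ KC := by
    rw [inner_eq_dotProduct, dotProduct]
    refine (Finset.abs_sum_le_sum_abs _ _).trans (le_trans (Finset.sum_le_sum fun j _ => ?_) (hx a))
    rw [abs_mul]
    exact mul_le_of_le_one_right (abs_nonneg _)
      ((abs_apply_le_norm _ j).trans (hI.norm_act_le a))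
  exact (abs_add_le _ _).trans (add_le_add h1 (hI.unknown_le a))

theorem Problem.IsBounded.nonneg (hI : I.IsBounded KC Kμ) (a : Fin k) : 0 ≤ KC + Kμ := by
  have := hI.isProbabilityMeasure
  obtain ⟨x, hx⟩ := hI.abs_meanCost_le.exists
  exact (abs_nonneg _).trans (hx a)

/-- The expected loss in individual `i` and round `t`, given what is drawn before the noise. -/
def gap (I : Problem m d k) (π : Vec m → Fin k) (ξ : ℕ → Fin n → Ω → Vec m × Vec d × ℝ)
    (A : ℕ → Fin n → Ω → Fin k) (t : ℕ) (i : Fin n) (ω : Ω) : ℝ :=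
  I.meanCost (ξ t i ω).1 (A t i ω) - I.meanCost (ξ t i ω).1 (π (ξ t i ω).1)

theorem IsRun.measurable_meanCost (h : IsRun P I b w0 γ Te mode ξ A Fhat) (t : ℕ) (i : Fin n)
    {W : Ω → Fin k} (hW : Measurable W) : Measurable fun ω => I.meanCost (ξ t i ω).1 (W ω) := by
  have hx : Measurable fun ω => (ξ t i ω).1 := (h.measurable_sample t i).fst
  exact measurable_apply_finite (fun a => (I.continuous_meanCost a).measurable) hW hx

variable [IsProbabilityMeasure P]

/-- Split according to the value of W: each term is an indicator determined before the noise, times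
an independent centred Gaussian. This covers the action played and that of the optimal policy. -/
theorem IsRun.integral_inner_action (h : IsRun P I b w0 γ Te mode ξ A Fhat)
    [IsProbabilityMeasure I.D] (t : ℕ) (i : Fin n) {W : Ω → Fin k}
    (hW : Measurable[past ξ (beforeNoise n t)] W) :
    Integrable (fun ω => (inner ℝ (I.act (W ω)) (ξ t i ω).2.1 : ℝ)) P ∧
      ∫ ω, (inner ℝ (I.act (W ω)) (ξ t i ω).2.1 : ℝ) ∂P = 0 := by
  classical
  have hnot : ((t, i), true) ∉ beforeNoise n t := by simp [beforeNoise]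
  have hind := indep_past_part h.measurable_sample h.law_sample h.indep_sample hnot
  have hnm : Measurable fun ω => (ξ t i ω).2 := (h.measurable_sample t i).snd
  have hlaw := map_noise h.measurable_sample h.law_sample (t, i)
  have hg : ∀ a, Integrable (fun ω => (inner ℝ (I.act a) (ξ t i ω).2.1 : ℝ)) P ∧
      ∫ ω, (inner ℝ (I.act a) (ξ t i ω).2.1 : ℝ) ∂P = 0 := by
    intro a
    have h0 := I.integral_inner_noise (I.act a)
    rw [← hlaw] at h0
    have hc : Continuous fun e : Vec d × ℝ => (inner ℝ (I.act a) e.1 : ℝ) := by fun_prop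
    refine ⟨(integrable_map_measure hc.aestronglyMeasurable hnm.aemeasurable).1 h0.1, ?_⟩
    rw [← h0.2, integral_map hnm.aemeasurable hc.aestronglyMeasurable]
  have hf : ∀ a, Measurable[past ξ (beforeNoise n t)] fun ω => if W ω = a then (1 : ℝ) else 0 :=
    fun a => (measurable_of_finite fun j : Fin k => if j = a then (1 : ℝ) else 0).comp hW
  have hgm : ∀ a, Measurable[part ξ ((t, i), true)] fun ω =>
      (inner ℝ (I.act a) (ξ t i ω).2.1 : ℝ) := by
    intro a
    have hc : Measurable fun e : Vec d × ℝ => (inner ℝ (I.act a) e.1 : ℝ) := by fun_prop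
    exact hc.comp (measurable_noise_part ξ (t, i))
  have hifun : ∀ a, IndepFun (fun ω => if W ω = a then (1 : ℝ) else 0)
      (fun ω => (inner ℝ (I.act a) (ξ t i ω).2.1 : ℝ)) P := fun a =>
    indep_of_indep_of_le_left (indep_of_indep_of_le_right hind (hgm a).comap_le) (hf a).comap_le
  have hfi : ∀ a, Integrable (fun ω => if W ω = a then (1 : ℝ) else 0) P := fun a =>
    Integrable.of_bound ((hf a).mono (past_le h.measurable_sample _) le_rfl).aestronglyMeasurable 1
      (Eventually.of_forall fun ω => by split_ifs <;> simp)
  have hprod : ∀ a, Integrable (fun ω => (if W ω = a then (1 : ℝ) else 0) *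
      (inner ℝ (I.act a) (ξ t i ω).2.1 : ℝ)) P := fun a =>
    (hifun a).integrable_mul (hfi a) (hg a).1
  have hzero : ∀ a, ∫ ω, (if W ω = a then (1 : ℝ) else 0) *
      (inner ℝ (I.act a) (ξ t i ω).2.1 : ℝ) ∂P = 0 := by
    intro a
    rw [(hifun a).integral_fun_mul_eq_mul_integral (hfi a).aestronglyMeasurable
      (hg a).1.aestronglyMeasurable, (hg a).2, mul_zero]
  have heq : (fun ω => (inner ℝ (I.act (W ω)) (ξ t i ω).2.1 : ℝ)) = fun ω =>
      ∑ a, (if W ω = a then (1 : ℝ) else 0) * (inner ℝ (I.act a) (ξ t i ω).2.1 : ℝ) := by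
    funext ω
    simp
  rw [heq]
  refine ⟨integrable_finsetSum _ fun a _ => hprod a, ?_⟩
  rw [integral_finsetSum _ fun a _ => hprod a]
  exact Finset.sum_eq_zero fun a _ => hzero a

theorem IsRun.gap_mem (h : IsRun P I b w0 γ Te mode ξ A Fhat) (hI : I.IsBounded KC Kμ)
    (hπ : I.IsOptimalPolicy π) (t : ℕ) (i : Fin n) :
    ∀ᵐ ω ∂P, 0 ≤ gap I π ξ A t i ω ∧ gap I π ξ A t i ω ≤ 2 * (KC + Kμ) := by
  have := hI.isProbabilityMeasure
  have h1 := hI.abs_meanCost_le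
  rw [← map_feature h.measurable_sample h.law_sample (t, i)] at h1
  filter_upwards [ae_of_ae_map (h.measurable_sample t i).fst.aemeasurable h1] with ω hω
  refine ⟨sub_nonneg.2 (hπ.meanCost_le _ _), ?_⟩
  have h2 := abs_le.1 (hω (A t i ω))
  have h3 := abs_le.1 (hω (π (ξ t i ω).1))
  simp only [gap]
  linarith [h2.2, h3.1]

theorem IsRun.integrable_gap (h : IsRun P I b w0 γ Te mode ξ A Fhat) (hI : I.IsBounded KC Kμ)
    (hπ : I.IsOptimalPolicy π) (t : ℕ) (i : Fin n) : Integrable (gap I π ξ A t i) P := by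
  have hA : Measurable (A t i) :=
    (h.measurable_action_past t i).mono (past_le h.measurable_sample _) le_rfl
  have hm : Measurable (gap I π ξ A t i) := (h.measurable_meanCost t i hA).sub
    (h.measurable_meanCost t i (hπ.measurable.comp (h.measurable_sample t i).fst))
  refine Integrable.of_bound hm.aestronglyMeasurable (2 * (KC + Kμ)) ?_
  filter_upwards [h.gap_mem hI hπ t i] with ω hω
  rw [Real.norm_eq_abs, abs_of_nonneg hω.1]
  exact hω.2

/-- The regret is the sum of the expected losses. -/
theorem IsRun.integral_excessCost (h : IsRun P I b w0 γ Te mode ξ A Fhat)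
    (hI : I.IsBounded KC Kμ) (hπ : I.IsOptimalPolicy π) (T : ℕ) :
    Integrable (excessCost I π ξ A T) P ∧ ∫ ω, excessCost I π ξ A T ω ∂P =
      ∑ t ∈ Finset.Icc 1 T, ∑ i, ∫ ω, gap I π ξ A t i ω ∂P := by
  have := hI.isProbabilityMeasure
  have key : ∀ t i, Integrable (fun ω => I.cost (A t i ω) (ξ t i ω) -
      I.cost (π (ξ t i ω).1) (ξ t i ω)) P ∧ ∫ ω, (I.cost (A t i ω) (ξ t i ω) -
      I.cost (π (ξ t i ω).1) (ξ t i ω)) ∂P = ∫ ω, gap I π ξ A t i ω ∂P := by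
    intro t i
    have hA := h.integral_inner_action t i (h.measurable_action_past t i)
    have hx : Measurable[past ξ (beforeNoise n t)] fun ω => π (ξ t i ω).1 :=
      hπ.measurable.comp ((measurable_feature_part ξ (t, i)).mono
        (part_le_past (Or.inr ⟨rfl, rfl⟩)) le_rfl)
    have hP := h.integral_inner_action t i hx
    have hg := h.integrable_gap hI hπ t i
    -- The noise η is the same under both actions and cancels.
    have heq : (fun ω => I.cost (A t i ω) (ξ t i ω) - I.cost (π (ξ t i ω).1) (ξ t i ω)) =
        fun ω => gap I π ξ A t i ω + ((inner ℝ (I.act (A t i ω)) (ξ t i ω).2.1 : ℝ) -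
          inner ℝ (I.act (π (ξ t i ω).1)) (ξ t i ω).2.1) := by
      funext ω
      simp only [I.cost_eq, gap]
      ring
    rw [heq]
    refine ⟨hg.add (hA.1.sub hP.1), ?_⟩
    have hAP : Integrable (fun ω => (inner ℝ (I.act (A t i ω)) (ξ t i ω).2.1 : ℝ) -
        inner ℝ (I.act (π (ξ t i ω).1)) (ξ t i ω).2.1) P := hA.1.sub hP.1
    rw [integral_add hg hAP, integral_sub hA.1 hP.1, hA.2, hP.2, sub_zero, add_zero]
  unfold excessCost
  have h1 : ∀ t ∈ Finset.Icc 1 T, Integrable (fun ω => ∑ i, (I.cost (A t i ω) (ξ t i ω) -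
      I.cost (π (ξ t i ω).1) (ξ t i ω))) P := fun t _ =>
    integrable_finsetSum _ fun i _ => (key t i).1
  refine ⟨integrable_finsetSum _ h1, ?_⟩
  rw [integral_finsetSum _ h1]
  refine Finset.sum_congr rfl fun t _ => ?_
  rw [integral_finsetSum _ fun i _ => (key t i).1]
  exact Finset.sum_congr rfl fun i _ => (key t i).2

end Regret

/-! ### Optimism and the total loss of one individual. -/

section RegretBound

theorem sum_Icc_one_div_sq_le (T : ℕ) : ∑ t ∈ Finset.Icc 1 T, 1 / (t : ℝ) ^ 2 ≤ 2 - 1 / (T : ℝ) := by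
  induction T with
  | zero => simp
  | succ T ih =>
    rw [Finset.sum_Icc_succ_top (by omega)]
    rcases Nat.eq_zero_or_pos T with rfl | hT
    · norm_num
    · have hT' : (0 : ℝ) < T := by exact_mod_cast hT
      have : 1 / ((T + 1 : ℕ) : ℝ) ^ 2 ≤ 1 / T - 1 / ((T + 1 : ℕ) : ℝ) := by
        push_cast
        rw [div_sub_div _ _ hT'.ne' (by positivity), div_le_div_iff₀ (by positivity) (by positivity)]
        nlinarith
      linarith

variable {m d k n Te : ℕ} {Ω : Type*} {I : Problem m d k} {b : Fin d → Vec d}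
  {w0 : Fin n → Fin k} {γ KC Kμ : ℝ} {mode : Training}
  {ξ : ℕ → Fin n → Ω → Vec m × Vec d × ℝ} {A : ℕ → Fin n → Ω → Fin k}
  {Fhat : ℕ → Ω → Fin k → Vec m →L[ℝ] Vec d} {π : Vec m → Fin k}

/-- The squared width of the confidence ball in the direction of the action taken. -/
def width (I : Problem m d k) (b : Fin d → Vec d) (A : ℕ → Fin n → Ω → Fin k) (t : ℕ) (i : Fin n)
    (ω : Ω) : ℝ :=
  (I.act (A t i ω)).ofLp ⬝ᵥ (gram I b A t i ω)⁻¹ *ᵥ (I.act (A t i ω)).ofLp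

theorem IsBarycentricSpanner.width_nonneg (hb : IsBarycentricSpanner I.act b) (t : ℕ) (i : Fin n)
    (ω : Ω) : 0 ≤ width I b A t i ω :=
  PosDef.inv_form_nonneg (hb.posDef_gram t i ω) _

theorem gram_succ (I : Problem m d k) (b : Fin d → Vec d) (A : ℕ → Fin n → Ω → Fin k) (s : ℕ)
    (i : Fin n) (ω : Ω) : gram I b A (s + 1) i ω = (∑ j, vecMulVec (b j).ofLp (b j).ofLp) +
      ∑ r ∈ Finset.range s, vecMulVec (I.act (A (r + 1) i ω)).ofLp (I.act (A (r + 1) i ω)).ofLp := by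
  rw [gram, Finset.sum_Ico_eq_sum_range]
  simp only [Nat.add_sub_cancel, add_comm 1]

theorem IsBarycentricSpanner.sum_min_one_width_le (hb : IsBarycentricSpanner I.act b) (hd : 1 ≤ d)
    (T : ℕ) (i : Fin n) (ω : Ω) :
    ∑ s ∈ Finset.range T, min 1 (width I b A (s + 1) i ω) ≤ 2 * (d * Real.log (T + 1)) := by
  set G := ∑ j, vecMulVec (b j).ofLp (b j).ofLp with hG
  have hpd : G.PosDef := hb.posDef
  have h1 := sum_log_one_add_inv_form hpd (fun s => (I.act (A (s + 1) i ω)).ofLp) T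
  have h2 : ∑ s ∈ Finset.range T, min 1 (width I b A (s + 1) i ω) ≤
      ∑ s ∈ Finset.range T, 2 * Real.log (1 + width I b A (s + 1) i ω) :=
    Finset.sum_le_sum fun s _ => min_one_le_two_mul_log_one_add (hb.width_nonneg _ _ _)
  refine h2.trans ?_
  rw [← Finset.mul_sum]
  simp only [width, gram_succ, ← hG]
  rw [h1, hG, ← gram_succ I b A T i ω, ← hG]
  have h3 := hb.det_gram_le (A := A) hd (t := T + 1) (by omega) i ω
  have h4 := Real.log_le_log (hb.posDef_gram (A := A) (T + 1) i ω).det_pos h3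
  rw [← hG, Real.log_mul (by positivity) hpd.det_pos.ne', Real.log_pow] at h4
  push_cast at h4
  linarith

/-- Cauchy–Schwarz over the rounds; truncation at 1 commutes with the square root. -/
theorem IsBarycentricSpanner.sum_min_one_sqrt_width_le (hb : IsBarycentricSpanner I.act b)
    (hd : 1 ≤ d) (T : ℕ) (i : Fin n) (ω : Ω) :
    ∑ t ∈ Finset.Icc 1 T, min 1 √(width I b A t i ω) ≤ √T * √(2 * (d * Real.log (T + 1))) := by
  have h0 : ∑ t ∈ Finset.Icc 1 T, min 1 √(width I b A t i ω) =
      ∑ s ∈ Finset.range T, min 1 √(width I b A (s + 1) i ω) := by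
    rw [← Finset.Ico_add_one_right_eq_Icc, Finset.sum_Ico_eq_sum_range]
    simp only [Nat.add_sub_cancel, add_comm 1]
  have hsq : ∀ s, (min 1 √(width I b A s i ω)) ^ 2 = min 1 (width I b A s i ω) := by
    intro s
    rcases le_total 1 (width I b A s i ω) with h | h
    · rw [min_eq_left h, min_eq_left (Real.one_le_sqrt.2 h), one_pow]
    · rw [min_eq_right h, min_eq_right (Real.sqrt_le_one.2 h), Real.sq_sqrt (hb.width_nonneg _ _ _)]
  rw [h0, ← Real.sqrt_mul (Nat.cast_nonneg T)]
  refine Real.le_sqrt_of_sq_le ?_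
  have h1 := sq_sum_le_card_mul_sum_sq (s := Finset.range T)
    (f := fun s => min 1 √(width I b A (s + 1) i ω))
  simp only [Finset.card_range, hsq] at h1
  exact h1.trans (mul_le_mul_of_nonneg_left (hb.sum_min_one_width_le hd T i ω) (Nat.cast_nonneg T))

variable [mΩ : MeasurableSpace Ω] {P : Measure Ω}

/-- The loss of the optimistic action when the confidence ball contains `μ`. -/
theorem IsRun.gap_le (h : IsRun P I b w0 γ Te mode ξ A Fhat) (hb : IsBarycentricSpanner I.act b)
    {t : ℕ} (ht : Te < t) {i : Fin n} {ω : Ω} (hμ : I.μ ∈ confBall I b γ ξ A t i ω) :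
    gap I π ξ A t i ω ≤
      |(inner ℝ (Fhat t ω (A t i ω) (ξ t i ω).1 - I.F (A t i ω) (ξ t i ω).1)
        (I.act (A t i ω)) : ℝ)| +
      |(inner ℝ (Fhat t ω (π (ξ t i ω).1) (ξ t i ω).1 - I.F (π (ξ t i ω).1) (ξ t i ω).1)
        (I.act (π (ξ t i ω).1)) : ℝ)| +
      2 * √(radius n d γ t) * √(width I b A t i ω) := by
  obtain ⟨ν, hν, hopt⟩ := h.optimistic t i ω ht
  -- The optimistic pair is tested against the optimal action with the true μ, admissible because μ
  -- lies in the ball.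
  have h1 := hopt (π (ξ t i ω).1) I.μ hμ
  have h2 := (abs_le.1 (abs_inner_sub_le hb hν hμ (I.act (A t i ω)))).1
  have h3 := neg_abs_le
    (inner ℝ (Fhat t ω (A t i ω) (ξ t i ω).1 - I.F (A t i ω) (ξ t i ω).1) (I.act (A t i ω)) : ℝ)
  have h4 := le_abs_self
    (inner ℝ (Fhat t ω (π (ξ t i ω).1) (ξ t i ω).1 - I.F (π (ξ t i ω).1) (ξ t i ω).1)
      (I.act (π (ξ t i ω).1)) : ℝ)
  set e₁ := |(inner ℝ (Fhat t ω (A t i ω) (ξ t i ω).1 - I.F (A t i ω) (ξ t i ω).1)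
    (I.act (A t i ω)) : ℝ)|
  set e₂ := |(inner ℝ (Fhat t ω (π (ξ t i ω).1) (ξ t i ω).1 - I.F (π (ξ t i ω).1) (ξ t i ω).1)
        (I.act (π (ξ t i ω).1)) : ℝ)|
  simp only [inner_add_left, inner_sub_left] at h1 h2 h3 h4
  simp only [gap, Problem.meanCost, width]
  linarith

variable [IsProbabilityMeasure P]

/-- In early rounds, where log t is still below the constants of the problem, the prefactor makes
the right side at least 1. The failure probabilities thus remain summable over all rounds. -/
theorem IsRun.measure_notMem_confBall_le_mul (h : IsRun P I b w0 γ Te mode ξ A Fhat)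
    (hI : I.IsBounded KC Kμ) (hb : IsBarycentricSpanner I.act b) (hd : 1 ≤ d) (hn : 1 ≤ n)
    (hγ : 0 < γ) (hγ1 : γ ≤ 1) {t : ℕ} (ht : 1 ≤ t) (i : Fin n) :
    P {ω | I.μ ∉ confBall I b γ ξ A t i ω} ≤
      ENNReal.ofReal (Real.exp ((I.σ : ℝ) ^ 2 + 1 + |Kμ|) ^ 2 * (1 / (t : ℝ) ^ 2)) := by
  have ht0 : (0 : ℝ) < t := by exact_mod_cast ht
  have hK := abs_nonneg Kμ
  have hs := sq_nonneg (I.σ : ℝ)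
  rcases le_or_gt ((I.σ : ℝ) ^ 2 + 1 + |Kμ|) (Real.log t) with h1 | h1
  · refine (h.measure_notMem_confBall_le hI hb hd hn hγ hγ1 ht (by linarith) (by linarith) i).trans
      (ENNReal.ofReal_le_ofReal (le_mul_of_one_le_left (by positivity) ?_))
    exact one_le_pow₀ (Real.one_le_exp (by linarith))
  · refine prob_le_one.trans ?_
    rw [ENNReal.one_le_ofReal, mul_one_div, one_le_div₀ (by positivity)]
    exact pow_le_pow_left₀ ht0.le ((Real.lt_exp_of_log_lt h1).le) 2

/-- The total loss for one individual. -/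
theorem IsRun.sum_integral_gap_le (h : IsRun P I b w0 γ Te mode ξ A Fhat)
    (hI : I.IsBounded KC Kμ) (hb : IsBarycentricSpanner I.act b) (hd : 1 ≤ d) (hn : 1 ≤ n)
    (hγ : 0 < γ) (hγ1 : γ ≤ 1) (hπ : I.IsOptimalPolicy π) (T : ℕ) (i : Fin n) {R e r : ℝ}
    (hR : ∀ t ∈ Finset.Icc 1 T, √(radius n d γ t) ≤ R) (he : 0 ≤ e) (hr : 0 ≤ r)
    (hL : ∀ t, Te < t → t ≤ T → LabelBound P I ξ Fhat t i (2 * (KC + Kμ)) e r) :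
    ∑ t ∈ Finset.Icc 1 T, ∫ ω, gap I π ξ A t i ω ∂P ≤
      2 * (KC + Kμ) * Te + T * (2 * (KC + Kμ) * e + r) +
        2 * (KC + Kμ) * (2 * Real.exp ((I.σ : ℝ) ^ 2 + 1 + |Kμ|) ^ 2) +
        (2 * (KC + Kμ) + 2 * R) * (√T * √(2 * (d * Real.log (T + 1)))) := by
  set B := 2 * (KC + Kμ) with hB
  set C₀ := Real.exp ((I.σ : ℝ) ^ 2 + 1 + |Kμ|) ^ 2 with hC₀
  have hC₀0 : 0 ≤ C₀ := by positivity
  have hB0 : 0 ≤ B := by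
    obtain ⟨ω⟩ := P.nonempty_of_neZero
    have := hI.nonneg (A 0 i ω)
    positivity
  -- The width term is kept outside `U`: it is summed pathwise by the potential lemma, so only the
  -- resulting constant is integrated.
  have hround : ∀ t ∈ Finset.Icc 1 T, ∃ U : Ω → ℝ, Integrable U P ∧
      ∫ ω, U ω ∂P ≤ (if t ≤ Te then B else 0) + (B * e + r) + B * (C₀ * (1 / (t : ℝ) ^ 2)) ∧
      ∀ᵐ ω ∂P, gap I π ξ A t i ω ≤ U ω + (B + 2 * R) * min 1 √(width I b A t i ω) := by
    intro t ht
    have hR0 : 0 ≤ R := (Real.sqrt_nonneg _).trans (hR t ht)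
    rcases le_or_gt t Te with hte | hte
    · refine ⟨fun _ => B, integrable_const _, ?_, ?_⟩
      · simp only [integral_const, probReal_univ, one_smul, if_pos hte]
        have : 0 ≤ B * e + r := by positivity
        have : 0 ≤ B * (C₀ * (1 / (t : ℝ) ^ 2)) := by positivity
        linarith
      · filter_upwards [h.gap_mem hI hπ t i] with ω hω
        have : 0 ≤ (B + 2 * R) * min 1 √(width I b A t i ω) := by positivity
        linarith [hω.2]
    · obtain ⟨E, L, hE, hLi, hLr, hL0, hEL⟩ := hL t hte (Finset.mem_Icc.1 ht).2
      -- The exceptional events need not be measurable; their measurable hulls have the same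
      -- probability.
      set E' := toMeasurable P E with hE'
      set F' := toMeasurable P {ω | I.μ ∉ confBall I b γ ξ A t i ω} with hF'
      have hE'm : MeasurableSet E' := measurableSet_toMeasurable _ _
      have hF'm : MeasurableSet F' := measurableSet_toMeasurable _ _
      have hi1 : Integrable (E'.indicator fun _ => B) P := (integrable_const B).indicator hE'm
      have hi2 : Integrable (F'.indicator fun _ => B) P := (integrable_const B).indicator hF'm
      have hEr : P.real E' ≤ e := by
        rw [measureReal_def, hE', measure_toMeasurable]
        exact ENNReal.toReal_le_of_le_ofReal he hE
      have hFr : P.real F' ≤ C₀ * (1 / (t : ℝ) ^ 2) := by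
        rw [measureReal_def, hF', measure_toMeasurable]
        exact ENNReal.toReal_le_of_le_ofReal (by positivity)
          (h.measure_notMem_confBall_le_mul hI hb hd hn hγ hγ1 (Finset.mem_Icc.1 ht).1 i)
      have hi12 : Integrable (fun ω => E'.indicator (fun _ => B) ω + F'.indicator (fun _ => B) ω) P :=
        hi1.add hi2
      refine ⟨fun ω => (E'.indicator (fun _ => B) ω + F'.indicator (fun _ => B) ω) + L ω,
        hi12.add hLi, ?_, ?_⟩
      · rw [integral_add hi12 hLi, integral_add hi1 hi2, integral_indicator_const _ hE'm,
          integral_indicator_const _ hF'm, if_neg (not_le.2 hte), smul_eq_mul, smul_eq_mul]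
        have h1 := mul_le_mul_of_nonneg_right hEr hB0
        have h2 := mul_le_mul_of_nonneg_right hFr hB0
        linarith
      · filter_upwards [h.gap_mem hI hπ t i, hEL] with ω hω hω'
        have hw : 0 ≤ (B + 2 * R) * min 1 √(width I b A t i ω) := by positivity
        have hE0 : 0 ≤ E'.indicator (fun _ => B) ω := Set.indicator_nonneg (fun _ _ => hB0) _
        have hF0 : 0 ≤ F'.indicator (fun _ => B) ω := Set.indicator_nonneg (fun _ _ => hB0) _
        by_cases hωE : ω ∈ E'
        · rw [Set.indicator_of_mem hωE]
          linarith [hω.2, hL0 ω]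
        by_cases hωF : ω ∈ F'
        · rw [Set.indicator_of_mem hωF]
          linarith [hω.2, hL0 ω]
        have hωE₁ : ω ∉ E := fun hh => hωE (subset_toMeasurable _ _ hh)
        have hμ : I.μ ∈ confBall I b γ ξ A t i ω := by
          by_contra hh
          exact hωF (subset_toMeasurable _ _ hh)
        rcases hω' hωE₁ with h1 | h1
        · linarith [hω.2]
        · have h2 := h.gap_le (π := π) hb hte hμ
          have h3 := h1 (A t i ω)
          have h4 := h1 (π (ξ t i ω).1)
          -- A width above 1 is truncated, and the trivial bound `B` on the loss takes over; hence
          -- `B` in the factor B + 2R.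
          rcases le_total 1 √(width I b A t i ω) with h5 | h5
          · rw [min_eq_left h5]
            linarith [hω.2, hL0 ω]
          · rw [min_eq_right h5]
            have h6 : √(radius n d γ t) * √(width I b A t i ω) ≤ R * √(width I b A t i ω) :=
              mul_le_mul_of_nonneg_right (hR t ht) (Real.sqrt_nonneg _)
            have h7 : 0 ≤ B * √(width I b A t i ω) := by positivity
            linarith
  choose! U hUi hUle hU using hround
  have hall : ∀ᵐ ω ∂P, ∀ t ∈ Finset.Icc 1 T,
      gap I π ξ A t i ω ≤ U t ω + (B + 2 * R) * min 1 √(width I b A t i ω) :=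
    (Finset.eventually_all _).2 hU
  have hsum : ∀ᵐ ω ∂P, ∑ t ∈ Finset.Icc 1 T, gap I π ξ A t i ω ≤
      ∑ t ∈ Finset.Icc 1 T, U t ω + (B + 2 * R) * (√T * √(2 * (d * Real.log (T + 1)))) := by
    filter_upwards [hall] with ω hω
    rcases Nat.eq_zero_or_pos T with rfl | hT
    · simp
    have hR0 : 0 ≤ R := (Real.sqrt_nonneg _).trans (hR 1 (Finset.mem_Icc.2 ⟨le_rfl, hT⟩))
    refine (Finset.sum_le_sum hω).trans ?_
    rw [Finset.sum_add_distrib, ← Finset.mul_sum]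
    have := mul_le_mul_of_nonneg_left (hb.sum_min_one_sqrt_width_le (A := A) hd T i ω)
      (show 0 ≤ B + 2 * R by positivity)
    linarith
  have hgi : ∀ t ∈ Finset.Icc 1 T, Integrable (fun ω => gap I π ξ A t i ω) P := fun t _ =>
    h.integrable_gap hI hπ t i
  rw [← integral_finsetSum _ hgi]
  have hUs : Integrable (fun ω => ∑ t ∈ Finset.Icc 1 T, U t ω) P := integrable_finsetSum _ hUi
  have hint := integral_mono_ae (integrable_finsetSum _ hgi) (hUs.add (integrable_const _)) hsum
  refine hint.trans ?_
  simp only [Pi.add_apply]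
  rw [integral_add hUs (integrable_const _), integral_finsetSum _ hUi, integral_const,
    probReal_univ, one_smul]
  refine add_le_add_left ((Finset.sum_le_sum hUle).trans ?_) _
  rw [Finset.sum_add_distrib, Finset.sum_add_distrib, Finset.sum_const, Nat.card_Icc,
    ← Finset.mul_sum, ← Finset.mul_sum, Nat.add_sub_cancel, nsmul_eq_mul]
  have h1 : ∑ t ∈ Finset.Icc 1 T, (if t ≤ Te then B else 0) ≤ B * Te := by
    rw [← Finset.sum_filter, Finset.sum_const, nsmul_eq_mul, mul_comm]
    refine mul_le_mul_of_nonneg_left ?_ hB0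
    have hc : (Finset.Icc 1 T |>.filter fun t => t ≤ Te) ⊆ Finset.Icc 1 Te := by
      intro t ht
      simp only [Finset.mem_filter, Finset.mem_Icc] at ht ⊢
      omega
    have := Finset.card_le_card hc
    rw [Nat.card_Icc, Nat.add_sub_cancel] at this
    exact_mod_cast this
  have h2 : ∑ t ∈ Finset.Icc 1 T, 1 / (t : ℝ) ^ 2 ≤ 2 :=
    (sum_Icc_one_div_sq_le T).trans (by simp)
  have h3 : B * (C₀ * ∑ t ∈ Finset.Icc 1 T, 1 / (t : ℝ) ^ 2) ≤ B * (2 * C₀) := by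
    refine mul_le_mul_of_nonneg_left ?_ hB0
    nlinarith
  linarith

end RegretBound

/-! ### Choice of parameters and orders of magnitude. -/

section Rates

/-- With ℓ = log (nT/γ), the two logarithms in the radius are at most ℓ and 2ℓ, so both terms of the
maximum are at most 256 d ℓ². -/
theorem sqrt_radius_le {n d t T : ℕ} {γ : ℝ} (hn : 1 ≤ n) (hd : 1 ≤ d) (hγ : 0 < γ) (hγ1 : γ ≤ 1)
    (ht : t ∈ Finset.Icc 1 T) :
    √(radius n d γ t) ≤ 16 * √d * (1 + Real.log (n * T / γ)) := by
  obtain ⟨ht1, htT⟩ := Finset.mem_Icc.1 ht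
  have hn' : (1 : ℝ) ≤ n := by exact_mod_cast hn
  have hd' : (1 : ℝ) ≤ d := by exact_mod_cast hd
  have ht' : (1 : ℝ) ≤ t := by exact_mod_cast ht1
  have htT' : (t : ℝ) ≤ T := by exact_mod_cast htT
  have hT' : (1 : ℝ) ≤ T := ht'.trans htT'
  set ℓ := Real.log (n * T / γ) with hℓ
  have hnγ : (n : ℝ) ≤ n / γ := le_div_self (by positivity) hγ hγ1
  have h1 : (t : ℝ) ≤ n * T / γ := by
    rw [mul_div_right_comm]
    nlinarith
  have h2 : Real.log t ≤ ℓ := Real.log_le_log (by positivity) h1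
  have ht0 : 0 ≤ Real.log t := Real.log_nonneg ht'
  have h3 : Real.log (n * (t : ℝ) ^ 2 / γ) ≤ 2 * ℓ := by
    have : 2 * ℓ = Real.log ((n * T / γ) ^ 2) := by rw [Real.log_pow]; norm_num [hℓ]
    rw [this]
    refine Real.log_le_log (by positivity) ?_
    rw [mul_div_right_comm, mul_div_right_comm, mul_pow]
    have h5 : (n : ℝ) / γ ≤ (n / γ) ^ 2 := by
      rw [sq]
      exact le_mul_of_one_le_left (by positivity) (hn'.trans hnγ)
    exact mul_le_mul h5 (pow_le_pow_left₀ (by positivity) htT' 2) (by positivity) (by positivity)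
  have h4 : 0 ≤ Real.log (n * (t : ℝ) ^ 2 / γ) := by
    refine Real.log_nonneg ?_
    rw [mul_div_right_comm]
    exact one_le_mul_of_one_le_of_one_le (hn'.trans hnγ) (one_le_pow₀ ht')
  have hℓ0 : 0 ≤ ℓ := ht0.trans h2
  have h6 : radius n d γ t ≤ (16 * √d * ℓ) ^ 2 := by
    have e : (16 * √d * ℓ) ^ 2 = 256 * d * ℓ ^ 2 := by
      rw [mul_pow, mul_pow, Real.sq_sqrt (by positivity)]
      norm_num
    rw [e]
    refine max_le ?_ ?_
    · calc 128 * d * Real.log t * Real.log (n * (t : ℝ) ^ 2 / γ)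
          ≤ 128 * d * ℓ * (2 * ℓ) := by gcongr
        _ = 256 * d * ℓ ^ 2 := by ring
    · calc (8 / 3 * Real.log (n * (t : ℝ) ^ 2 / γ)) ^ 2 ≤ (8 / 3 * (2 * ℓ)) ^ 2 := by gcongr
        _ ≤ 256 * 1 * ℓ ^ 2 := by nlinarith [sq_nonneg ℓ]
        _ ≤ 256 * d * ℓ ^ 2 := by gcongr
  refine (Real.sqrt_le_left (by positivity)).2 h6 |>.trans ?_
  gcongr
  linarith

/-- The relations between the parameters when the exploration phase ends before the horizon: `S` is
the rate `(d k)^{1/3} T^{2/3}` and `Λ` the logarithmic factor. -/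
structure Regime (n d k T Te : ℕ) (S Λ : ℝ) : Prop where
  one_le_n : 1 ≤ n
  one_le_d : 1 ≤ d
  one_le_T : 1 ≤ T
  d_le_k : d ≤ k
  dk_le : (d : ℝ) * k ≤ 8 * T
  one_le_S : 1 ≤ S
  S_pow : S ^ 3 = d * k * (T : ℝ) ^ 2
  S_le : S ≤ 2 * Te
  log_le : 1 + Real.log (n * T) ≤ Λ

namespace Regime

variable {n d k T Te : ℕ} {S Λ : ℝ}

theorem one_le_k (h : Regime n d k T Te S Λ) : 1 ≤ k := h.one_le_d.trans h.d_le_k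

theorem log_T_le (h : Regime n d k T Te S Λ) : 1 + Real.log T ≤ Λ := by
  have hn : (1 : ℝ) ≤ n := by exact_mod_cast h.one_le_n
  have hT : (1 : ℝ) ≤ T := by exact_mod_cast h.one_le_T
  refine le_trans (add_le_add_right (Real.log_le_log (by positivity) ?_) 1) h.log_le
  nlinarith

theorem one_le_log (h : Regime n d k T Te S Λ) : 1 ≤ Λ := by
  have hT : (1 : ℝ) ≤ T := by exact_mod_cast h.one_le_T
  linarith [h.log_T_le, Real.log_nonneg hT]

/-- The number of actions does not occur in Λ; k ≤ 8T absorbs its logarithm. -/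
theorem log_kT_le (h : Regime n d k T Te S Λ) : Real.log (k * T) ≤ 3 * Λ := by
  have hd : (1 : ℝ) ≤ d := by exact_mod_cast h.one_le_d
  have hT : (1 : ℝ) ≤ T := by exact_mod_cast h.one_le_T
  have hk : (1 : ℝ) ≤ k := by exact_mod_cast h.one_le_k
  have hk8 : (k : ℝ) ≤ 8 * T := le_trans (by nlinarith) h.dk_le
  have h1 : Real.log (k * T) ≤ Real.log (2 ^ 3 * (T : ℝ) ^ 2) := by
    refine Real.log_le_log (by positivity) ?_
    nlinarith
  have e : Real.log (2 ^ 3 * (T : ℝ) ^ 2) = 3 * Real.log 2 + 2 * Real.log T := by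
    rw [Real.log_mul (by positivity) (by positivity), Real.log_pow, Real.log_pow]
    norm_num
  rw [e] at h1
  have := Real.log_two_lt_d9
  have hT0 := Real.log_nonneg hT
  linarith [h.log_T_le]

/-- The order of the cost of optimism. In sixth powers, d⁶T³ ≤ 8 (d k T²)² follows from d ≤ k and d²
≤ d k ≤ 8T. -/
theorem d_mul_sqrt_le (h : Regime n d k T Te S Λ) : d * √T ≤ 2 * S := by
  have hd : (1 : ℝ) ≤ d := by exact_mod_cast h.one_le_d
  have hT : (1 : ℝ) ≤ T := by exact_mod_cast h.one_le_T
  have hk : (d : ℝ) ≤ k := by exact_mod_cast h.d_le_k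
  have hS := h.one_le_S
  refine le_of_pow_le_pow_left₀ (n := 6) (by norm_num) (by positivity) ?_
  have e1 : (√(T : ℝ)) ^ 6 = T ^ 3 := by
    rw [show 6 = 2 * 3 by norm_num, pow_mul, Real.sq_sqrt (by positivity)]
  have e2 : (2 * S) ^ 6 = 64 * (d * k * (T : ℝ) ^ 2) ^ 2 := by
    rw [← h.S_pow]
    ring
  rw [mul_pow, e1, e2]
  have h1 : (d : ℝ) ^ 2 ≤ 8 * T := le_trans (by nlinarith) h.dk_le
  calc (d : ℝ) ^ 6 * T ^ 3 = (d : ℝ) ^ 2 * (d ^ 2 * d ^ 2) * T ^ 3 := by ring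
    _ ≤ (d : ℝ) ^ 2 * (k ^ 2 * (8 * T)) * T ^ 3 := by gcongr
    _ = 8 * (d * k * (T : ℝ) ^ 2) ^ 2 := by ring
    _ ≤ 64 * (d * k * (T : ℝ) ^ 2) ^ 2 := by nlinarith [sq_nonneg (d * k * (T : ℝ) ^ 2)]

/-- The effect of the length of exploration: it amounts to T √(k/T̃) = O(S). -/
theorem k_mul_sq_le (h : Regime n d k T Te S Λ) : (k : ℝ) * T ^ 2 ≤ 2 * Te * S ^ 2 := by
  have hd : (1 : ℝ) ≤ d := by exact_mod_cast h.one_le_d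
  have hS := h.one_le_S
  calc (k : ℝ) * T ^ 2 ≤ d * (k * T ^ 2) := le_mul_of_one_le_left (by positivity) hd
    _ = S * S ^ 2 := by
        have := h.S_pow
        linarith
    _ ≤ 2 * Te * S ^ 2 := mul_le_mul_of_nonneg_right h.S_le (by positivity)

/-- The samples of one action give the rate. -/
theorem T_le_mul_sqrt (h : Regime n d k T Te S Λ) {x : ℝ} (hx : 0 < x) (hxk : Te ≤ k * x) :
    T ≤ S * √(2 * x) := by
  have hk : (1 : ℝ) ≤ k := by exact_mod_cast h.one_le_k
  have hS := h.one_le_S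
  refine le_of_pow_le_pow_left₀ (n := 2) (by norm_num) (by positivity) ?_
  rw [mul_pow, Real.sq_sqrt (by positivity)]
  refine le_of_mul_le_mul_left ?_ (by linarith : (0 : ℝ) < k)
  refine h.k_mul_sq_le.trans ?_
  nlinarith [mul_le_mul_of_nonneg_right hxk (sq_nonneg S)]

/-- The cost of optimism. -/
theorem optimism_le (h : Regime n d k T Te S Λ) {B : ℝ} (hB : 0 ≤ B) :
    (B + 2 * (16 * √d * Λ)) * (√T * √(2 * (d * Real.log (T + 1)))) ≤
      4 * (B + 32) * (Λ ^ 2 * S) := by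
  have hd : (1 : ℝ) ≤ d := by exact_mod_cast h.one_le_d
  have hT : (1 : ℝ) ≤ T := by exact_mod_cast h.one_le_T
  have hΛ := h.one_le_log
  have hsd : 1 ≤ √(d : ℝ) := Real.one_le_sqrt.2 hd
  have hlog : Real.log (T + 1) ≤ Λ := by
    refine le_trans ?_ h.log_T_le
    have : Real.log ((T : ℝ) + 1) ≤ Real.log (2 * T) :=
      Real.log_le_log (by positivity) (by linarith)
    rw [Real.log_mul (by norm_num) (by positivity)] at this
    linarith [Real.log_two_lt_d9]
  have h1 : √(2 * (d * Real.log (T + 1))) ≤ 2 * √d * Λ := by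
    refine Real.sqrt_le_iff.2 ⟨by positivity, ?_⟩
    rw [mul_pow, mul_pow, Real.sq_sqrt (by positivity)]
    have : Real.log (T + 1) ≤ Λ ^ 2 := hlog.trans (by nlinarith)
    nlinarith [mul_le_mul_of_nonneg_left this (by positivity : (0 : ℝ) ≤ d),
      sq_nonneg Λ]
  have h2 : B + 2 * (16 * √d * Λ) ≤ (B + 32) * (√d * Λ) := by
    have : 1 ≤ √d * Λ := one_le_mul_of_one_le_of_one_le hsd hΛ
    nlinarith
  calc (B + 2 * (16 * √d * Λ)) * (√T * √(2 * (d * Real.log (T + 1))))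
      ≤ (B + 32) * (√d * Λ) * (√T * (2 * √d * Λ)) := by gcongr
    _ = 2 * (B + 32) * Λ ^ 2 * ((√d * √d) * √T) := by ring
    _ = 2 * (B + 32) * Λ ^ 2 * (d * √T) := by rw [Real.mul_self_sqrt (by positivity)]
    _ ≤ 2 * (B + 32) * Λ ^ 2 * (2 * S) := mul_le_mul_of_nonneg_left h.d_mul_sqrt_le (by positivity)
    _ = 4 * (B + 32) * (Λ ^ 2 * S) := by ring

theorem sqrt_two_mul_le (h : Regime n d k T Te S Λ) {c : ℝ} (hc : 0 ≤ c) :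
    √(2 * (c * Λ)) ≤ (1 + 2 * c) * Λ := by
  have hΛ := h.one_le_log
  refine Real.sqrt_le_iff.2 ⟨by positivity, ?_⟩
  have h2 : 2 * c ≤ (1 + 2 * c) ^ 2 := by nlinarith
  have h3 : Λ ≤ Λ ^ 2 := by nlinarith
  calc 2 * (c * Λ) = 2 * c * Λ := by ring
    _ ≤ (1 + 2 * c) ^ 2 * Λ ^ 2 := by gcongr
    _ = _ := by ring

theorem log_one_add_le (h : Regime n d k T Te S Λ) (KX : ℝ) {t : ℕ} (ht : t ≤ T) :
    Real.log (1 + KX ^ 2 * (t * n : ℕ)) ≤ (1 + KX ^ 2) * Λ := by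
  have hn : (1 : ℝ) ≤ n := by exact_mod_cast h.one_le_n
  have hT : (1 : ℝ) ≤ T := by exact_mod_cast h.one_le_T
  have ht' : (t : ℝ) ≤ T := by exact_mod_cast ht
  have h1 : 1 + KX ^ 2 * ((t * n : ℕ) : ℝ) ≤ (1 + KX ^ 2) * (n * T) := by
    push_cast
    have h2 : (t : ℝ) * n ≤ n * T := by nlinarith
    have h3 : 1 ≤ (n : ℝ) * T := one_le_mul_of_one_le_of_one_le hn hT
    nlinarith [mul_le_mul_of_nonneg_left h2 (sq_nonneg KX)]
  have h4 := Real.log_le_log (by positivity) h1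
  rw [Real.log_mul (by positivity) (by positivity)] at h4
  have h5 : Real.log (1 + KX ^ 2) ≤ KX ^ 2 := by
    have := Real.log_le_sub_one_of_pos (show (0 : ℝ) < 1 + KX ^ 2 by positivity)
    linarith
  have h6 : KX ^ 2 ≤ KX ^ 2 * Λ := le_mul_of_one_le_right (by positivity) h.one_le_log
  linarith [h.log_le]

end Regime

variable {m d k n T Te : ℕ} {S Λ : ℝ} {Ω : Type*} [mΩ : MeasurableSpace Ω] {P : Measure Ω}
  [IsProbabilityMeasure P]
  {I : Problem m d k} {b : Fin d → Vec d} {w0 : Fin n → Fin k} {γ KC Kμ KX κ : ℝ}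
  {ξ : ℕ → Fin n → Ω → Vec m × Vec d × ℝ} {A : ℕ → Fin n → Ω → Fin k}
  {Fhat : ℕ → Ω → Fin k → Vec m →L[ℝ] Vec d}

/-- With K = kT, the failure probabilities sum over actions to 2/T per round. This needs about log₂
(kT) blocks, whose number enters the bound only through a square root. -/
theorem IsRun.exists_labelBound_frozen (hreg : Regime n d k T Te S Λ)
    (h : IsRun P I b w0 γ Te .frozen ξ A Fhat) (hI : I.IsBounded KC Kμ) (hm : 1 ≤ m) {c : ℝ}
    (hc : 0 ≤ c) : ∃ e r : ℝ, 0 ≤ e ∧ 0 ≤ r ∧ T * e ≤ 2 ∧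
      T * r ≤ 12 * (c + 8 + (I.σ : ℝ) ^ 2) * (Λ ^ 2 * S * √m) ∧
      ∀ t i, Te < t → LabelBound P I ξ Fhat t i c e r := by
  have : NeZero n := ⟨by have := hreg.one_le_n; omega⟩
  have hT : (1 : ℝ) ≤ T := by exact_mod_cast hreg.one_le_T
  have hk : (1 : ℝ) ≤ k := by exact_mod_cast hreg.one_le_k
  have hk0 : 0 < k := hreg.one_le_k
  have hm' : (1 : ℝ) ≤ m := by exact_mod_cast hm
  have hΛ := hreg.one_le_log
  have hS := hreg.one_le_S
  have hkT := hreg.log_kT_le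
  have hK : (1 : ℝ) ≤ k * T := one_le_mul_of_one_le_of_one_le hk hT
  have hlog0 := Real.log_nonneg hK
  set N := Nat.clog 2 (k * T) + 1 with hN
  have hNpos : 0 < N := by omega
  have hN2 : (k * T : ℝ) ≤ 2 ^ N := by
    have h1 : k * T ≤ 2 ^ N :=
      (Nat.le_pow_clog (by norm_num) _).trans (Nat.pow_le_pow_right (by norm_num) (by omega))
    exact_mod_cast h1
  have hNle : (N : ℝ) ≤ 8 * Λ := by
    have h1 : (2 : ℝ) ^ (Nat.clog 2 (k * T)) ≤ 2 * (k * T) := by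
      rcases Nat.lt_or_ge 1 (k * T) with h2 | h2
      · have h3 := Nat.pow_pred_clog_lt_self (by norm_num : 1 < 2) h2
        have h4 : 0 < Nat.clog 2 (k * T) := Nat.clog_pos (by norm_num) h2
        have h5 : 2 ^ (Nat.clog 2 (k * T)) ≤ 2 * (k * T) := by
          rw [← Nat.succ_pred_eq_of_pos h4, pow_succ]
          omega
        exact_mod_cast h5
      · rw [Nat.clog_of_right_le_one h2, pow_zero]
        linarith
    have h2 := Real.log_le_log (by positivity) h1
    rw [Real.log_pow, Real.log_mul (by norm_num) (by positivity)] at h2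
    have h3 := Real.log_two_gt_d9
    have h4 : ((Nat.clog 2 (k * T) : ℕ) : ℝ) ≤ 1 + 6 * Λ := by
      by_contra! h5
      nlinarith
    rw [hN]
    push_cast
    linarith
  -- The blocks may be empty; the bounds involve M + 1 only, and rounding down still leaves Te ≤ k N
  -- (M + 1).
  set M := n * Te / (k * N) with hM
  have hBM : k * (N * M) ≤ n * Te := by
    rw [← mul_assoc]
    exact Nat.mul_div_le _ _
  have hM1 : (Te : ℝ) ≤ k * (N * (M + 1)) := by
    have h1 : n * Te < k * N * (M + 1) := Nat.lt_mul_div_succ _ (Nat.mul_pos hk0 hNpos)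
    have h2 : Te ≤ n * Te := Nat.le_mul_of_pos_left _ hreg.one_le_n
    have h3 : Te ≤ k * (N * (M + 1)) := by
      rw [← mul_assoc]
      omega
    exact_mod_cast h3
  have hNr : (0 : ℝ) < N := by exact_mod_cast hNpos
  have hTS := hreg.T_le_mul_sqrt (x := N * (M + 1)) (by positivity) hM1
  refine ⟨k * (2 / (k * T)), (c + 2 * (Real.log (2 * (k * T)) + (I.σ : ℝ) ^ 2 / 2)) *
    √(8 * (m / (M + 1))), by positivity, ?_, ?_, ?_, fun t i ht =>
      h.labelBound_frozen hI hm ht i hBM hK hN2 hc⟩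
  · have : 0 ≤ Real.log (2 * (k * T)) := Real.log_nonneg (by linarith)
    positivity
  · rw [show (T : ℝ) * (k * (2 / (k * T))) = 2 by field_simp]
  · have h1 : T * √(8 * (m / (M + 1))) ≤ 12 * (Λ * S * √m) := by
      have e1 : √(2 * (N * ((M : ℝ) + 1))) * √(8 * (m / (M + 1))) = √(16 * N) * √m := by
        rw [← Real.sqrt_mul (by positivity), ← Real.sqrt_mul (by positivity)]
        congr 1
        field_simp
        ring
      have e2 : √(16 * (N : ℝ)) ≤ 12 * Λ := by
        refine Real.sqrt_le_iff.2 ⟨by positivity, ?_⟩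
        nlinarith
      calc T * √(8 * (m / (M + 1)))
          ≤ S * √(2 * (N * ((M : ℝ) + 1))) * √(8 * (m / (M + 1))) := by gcongr
        _ = S * (√(16 * N) * √m) := by rw [mul_assoc, e1]
        _ ≤ S * (12 * Λ * √m) := by gcongr
        _ = 12 * (Λ * S * √m) := by ring
    have h2 : c + 2 * (Real.log (2 * (k * T)) + (I.σ : ℝ) ^ 2 / 2) ≤
        (c + 8 + (I.σ : ℝ) ^ 2) * Λ := by
      rw [Real.log_mul (by norm_num) (by positivity)]
      have := Real.log_two_lt_d9
      nlinarith [mul_le_mul_of_nonneg_left hΛ hc, mul_le_mul_of_nonneg_left hΛ (sq_nonneg (I.σ : ℝ))]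
    have h3 : 0 ≤ c + 2 * (Real.log (2 * (k * T)) + (I.σ : ℝ) ^ 2 / 2) := by
      have : 0 ≤ Real.log (2 * (k * T)) := Real.log_nonneg (by linarith)
      positivity
    calc T * ((c + 2 * (Real.log (2 * (k * T)) + (I.σ : ℝ) ^ 2 / 2)) * √(8 * (m / (M + 1))))
        = (c + 2 * (Real.log (2 * (k * T)) + (I.σ : ℝ) ^ 2 / 2)) * (T * √(8 * (m / (M + 1)))) := by
          ring
      _ ≤ (c + 8 + (I.σ : ℝ) ^ 2) * Λ * (12 * (Λ * S * √m)) := by gcongr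
      _ = 12 * (c + 8 + (I.σ : ℝ) ^ 2) * (Λ ^ 2 * S * √m) := by ring

/-- Replacing m by KX²/κ makes the exponent N times a constant free of the dimension. -/
theorem exp_neg_le_one_div {κ KX m N K : ℝ} (hκ : 0 < κ) (hKX : 0 < KX) (hm : 0 < m)
    (hmκ : m ≤ KX ^ 2 / κ) (hN : 0 < N) (hK : 0 < K)
    (hexp : Real.log K ≤ N * (κ ^ 4 / (8 * KX ^ 8))) :
    Real.exp (-(N * κ / (2 * m)) ^ 2 / (2 * N * (KX ^ 2) ^ 2)) ≤ 1 / K := by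
  rw [one_div, ← Real.exp_log (show (0 : ℝ) < K by positivity), ← Real.exp_neg]
  refine Real.exp_le_exp.2 ?_
  rw [neg_div, neg_le_neg_iff]
  refine hexp.trans ?_
  have e1 : (N * κ / (2 * m)) ^ 2 / (2 * N * (KX ^ 2) ^ 2) =
      N * (κ ^ 2 / (8 * KX ^ 4 * m ^ 2)) := by
    field_simp
    ring
  have e2 : κ ^ 4 / (8 * KX ^ 8) = κ ^ 2 / (8 * KX ^ 4 * (KX ^ 2 / κ) ^ 2) := by
    field_simp
  rw [e1, e2]
  gcongr

/-- Concentration requires N, the number of exploration samples per action, to exceed a multiple of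
Λ. If it does not, the horizon is so short relative to S that the trivial bound in every round is
affordable. -/
theorem IsRun.exists_labelBound_retrain (hreg : Regime n d k T Te S Λ)
    (h : IsRun P I b w0 γ Te .retrain ξ A Fhat) (hI : I.IsBounded KC Kμ)
    (hD : IsRegularDesign I.D KX κ) (hκ : 0 < κ) (hm : 1 ≤ m) {c : ℝ} (hc : 0 ≤ c) :
    ∃ e r : ℝ, 0 ≤ e ∧ 0 ≤ r ∧ T * e ≤ 2 * (KX ^ 2 / κ) ^ 2 + 1 ∧
      T * r ≤ (c * (1 + 2 * (1 + 2 / κ + 3 * (8 * KX ^ 8 / κ ^ 4))) +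
        8 * KX / √κ * √(2 * ((I.σ : ℝ) ^ 2 + 1) * (3 + KX ^ 2 / κ * (1 + KX ^ 2)))) *
          (Λ ^ 2 * S * √m) ∧
      ∀ t i, Te < t → t ≤ T → LabelBound P I ξ Fhat t i c e r := by
  have : NeZero n := ⟨by have := hreg.one_le_n; omega⟩
  have := hI.isProbabilityMeasure
  have hT : (1 : ℝ) ≤ T := by exact_mod_cast hreg.one_le_T
  have hn : (1 : ℝ) ≤ n := by exact_mod_cast hreg.one_le_n
  have hk : (1 : ℝ) ≤ k := by exact_mod_cast hreg.one_le_k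
  have hk0 : 0 < k := hreg.one_le_k
  have hm' : (1 : ℝ) ≤ m := by exact_mod_cast hm
  have hsm : 1 ≤ √(m : ℝ) := Real.one_le_sqrt.2 hm'
  have hΛ := hreg.one_le_log
  have hS := hreg.one_le_S
  have hkT := hreg.log_kT_le
  have hKX := hD.nonneg
  have hmκ : (m : ℝ) ≤ KX ^ 2 / κ := by
    rw [le_div_iff₀ hκ]
    exact hD.card_mul_le
  have hKXpos : 0 < KX := by
    refine lt_of_le_of_ne hKX fun h0 => ?_
    rw [← h0] at hmκ
    norm_num at hmκ
    linarith
  have hK : (1 : ℝ) ≤ k * T := one_le_mul_of_one_le_of_one_le hk hT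
  have hΛS : Λ * S ≤ Λ ^ 2 * S * √m := by
    calc Λ * S = Λ * S * 1 := by ring
      _ ≤ Λ * S * (Λ * √m) := by
          gcongr
          exact one_le_mul_of_one_le_of_one_le hΛ hsm
      _ = Λ ^ 2 * S * √m := by ring
  have hB0 : 0 ≤ 8 * KX / √κ := by positivity
  set C₁ := 1 + 2 / κ + 3 * (8 * KX ^ 8 / κ ^ 4) with hC₁
  set Q := 2 * ((I.σ : ℝ) ^ 2 + 1) * (3 + KX ^ 2 / κ * (1 + KX ^ 2)) with hQ
  have hC₁0 : 0 < C₁ := by positivity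
  set N := n * Te / k with hN
  have hkN : k * N ≤ n * Te := Nat.mul_div_le _ _
  have hN1 : (Te : ℝ) ≤ k * (N + 1) := by
    have h1 : n * Te < k * (N + 1) := Nat.lt_mul_div_succ _ hk0
    have h2 : Te ≤ n * Te := Nat.le_mul_of_pos_left _ hreg.one_le_n
    have h3 : Te ≤ k * (N + 1) := by omega
    exact_mod_cast h3
  by_cases hbig : 2 ≤ κ * N ∧ Real.log (k * T) ≤ N * (κ ^ 4 / (8 * KX ^ 8))
  · obtain ⟨hκN, hexp⟩ := hbig
    have hNpos : 0 < N := by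
      rcases Nat.eq_zero_or_pos N with h0 | h0
      · rw [h0] at hκN
        norm_num at hκN
      · exact h0
    have hN1' : (1 : ℝ) ≤ N := by exact_mod_cast hNpos
    have hTS := hreg.T_le_mul_sqrt (x := 2 * N) (by positivity)
      (hN1.trans (mul_le_mul_of_nonneg_left (by linarith) (by positivity)))
    have hexp' : Real.exp (-(N * κ / (2 * m)) ^ 2 / (2 * N * (KX ^ 2) ^ 2)) ≤ 1 / (k * T) :=
      exp_neg_le_one_div hκ hKXpos (by linarith) hmκ (by linarith) (by linarith) hexp
    -- The factor m² from the union over matrix entries is replaced by its bound (KX²/κ)².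
    refine ⟨k * (2 * (KX ^ 2 / κ) ^ 2 * (1 / (k * T)) + 1 / (k * T)),
      4 * KX / √(κ * N) * √(Q * Λ), by positivity, by positivity, ?_, ?_, ?_⟩
    · refine le_of_eq ?_
      field_simp
    · calc T * (4 * KX / √(κ * N) * √(Q * Λ))
          ≤ S * √(2 * (2 * N)) * (4 * KX / √(κ * N) * √(Q * Λ)) := by gcongr
        _ = 8 * KX / √κ * √Q * (√Λ * S) := by
            rw [show (2 * (2 * N) : ℝ) = 2 ^ 2 * N by ring, Real.sqrt_mul (by positivity),
              Real.sqrt_sq (by norm_num), Real.sqrt_mul hκ.le, Real.sqrt_mul (by positivity)]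
            have : √(N : ℝ) ≠ 0 := by positivity
            field_simp
            ring
        _ ≤ 8 * KX / √κ * √Q * (Λ ^ 2 * S * √m) := by
            refine mul_le_mul_of_nonneg_left (le_trans ?_ hΛS) (by positivity)
            refine mul_le_mul_of_nonneg_right ?_ (by positivity)
            exact Real.sqrt_le_iff.2 ⟨by positivity, by nlinarith⟩
        _ ≤ _ := by
            gcongr
            exact le_add_of_nonneg_left (by positivity)
    · intro t i ht htT
      obtain ⟨E, L, hE, hLi, hLr, hL0, hEL⟩ := h.labelBound_retrain hI hD hκ hm ht i hkN hκN hK c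
      refine ⟨E, L, hE.trans (ENNReal.ofReal_le_ofReal ?_), hLi, hLr.trans ?_, hL0, hEL⟩
      · gcongr
      · have hlog := hreg.log_one_add_le KX htT
        have hlog0 : 0 ≤ Real.log (1 + KX ^ 2 * (t * n : ℕ)) :=
          Real.log_nonneg (le_add_of_nonneg_right (by positivity))
        refine mul_le_mul_of_nonneg_left (Real.sqrt_le_sqrt ?_) (by positivity)
        rw [hQ, mul_assoc (2 * ((I.σ : ℝ) ^ 2 + 1))]
        refine mul_le_mul_of_nonneg_left ?_ (by positivity)
        have h7 : m * Real.log (1 + KX ^ 2 * (t * n : ℕ)) ≤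
            KX ^ 2 / κ * ((1 + KX ^ 2) * Λ) := by gcongr
        have h8 : 0 ≤ KX ^ 2 / κ * ((1 + KX ^ 2) * Λ) := by positivity
        linarith
  -- Too few samples: each way for `hbig` to fail bounds N by one summand of C₁ times Λ. Then T ≤ S
  -- √(2 C₁ Λ), and the constant c serves as bounding variable.
  · have hN2 : (N : ℝ) + 1 ≤ C₁ * Λ := by
      rw [not_and_or, not_le, not_le] at hbig
      have h0 : 0 ≤ 2 / κ * Λ := by positivity
      have h0' : 0 ≤ 3 * (8 * KX ^ 8 / κ ^ 4) * Λ := by positivity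
      rcases hbig with h1 | h1
      · have h2 : (N : ℝ) ≤ 2 / κ := by
          rw [le_div_iff₀ hκ]
          linarith
        have h3 : 2 / κ ≤ 2 / κ * Λ := le_mul_of_one_le_right (by positivity) hΛ
        rw [hC₁]
        linarith
      · have h2 : (N : ℝ) ≤ 3 * Λ * (8 * KX ^ 8 / κ ^ 4) := by
          have h3 : N * (κ ^ 4 / (8 * KX ^ 8)) ≤ 3 * Λ := h1.le.trans hkT
          rw [← le_div_iff₀ (by positivity)] at h3
          refine h3.trans (le_of_eq ?_)
          field_simp
        rw [hC₁]
        linarith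
    have hTS := hreg.T_le_mul_sqrt (x := C₁ * Λ) (by positivity)
      (hN1.trans (mul_le_mul_of_nonneg_left hN2 (by positivity)))
    refine ⟨0, c, le_rfl, hc, by rw [mul_zero]; positivity, ?_, fun t i _ _ => ⟨∅, fun _ => c, by simp,
      integrable_const _, by simp, fun _ => hc, Eventually.of_forall fun ω _ => Or.inl le_rfl⟩⟩
    have h1 := hreg.sqrt_two_mul_le hC₁0.le
    calc T * c ≤ S * √(2 * (C₁ * Λ)) * c := by gcongr
      _ ≤ S * ((1 + 2 * C₁) * Λ) * c := by gcongr
      _ = c * (1 + 2 * C₁) * (Λ * S) := by ring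
      _ ≤ c * (1 + 2 * C₁) * (Λ ^ 2 * S * √m) := by gcongr
      _ ≤ _ := by
          gcongr
          exact le_add_of_nonneg_right (by positivity)

end Rates

/-! ### Summation of the contributions to the regret. -/

section Assembly

variable {m d k n T Te : ℕ} {S Λ : ℝ} {Ω : Type*} [mΩ : MeasurableSpace Ω] {P : Measure Ω}
  [IsProbabilityMeasure P]
  {I : Problem m d k} {b : Fin d → Vec d} {w0 : Fin n → Fin k} {γ KC Kμ : ℝ} {mode : Training}
  {ξ : ℕ → Fin n → Ω → Vec m × Vec d × ℝ} {A : ℕ → Fin n → Ω → Fin k}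
  {Fhat : ℕ → Ω → Fin k → Vec m →L[ℝ] Vec d} {π : Vec m → Fin k}

/-- The constant of the regret bound, for losses at most `B` per round, events of total probability
`ce`, prediction errors of total size `cr` and an excess `C₀` of the early confidence balls. -/
def regretConst (B ce cr C₀ : ℝ) : ℝ :=
  2 * B + B * ce + cr + B * (2 * C₀) + 4 * (B + 32)

/-- Exploration, prediction errors and optimism are each O(Λ² S √m) per individual. If exploration
fills the whole horizon, then T ≤ T̃ ≤ 2S and the trivial bound per round is enough. -/
theorem IsRun.integral_excessCost_le (h : IsRun P I b w0 γ Te mode ξ A Fhat)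
    (hI : I.IsBounded KC Kμ) (hb : IsBarycentricSpanner I.act b) (hπ : I.IsOptimalPolicy π)
    (hn : 1 ≤ n) (hm : 1 ≤ m) (hd : 1 ≤ d) (hT : 1 ≤ T) (hγ : 0 < γ) (hγ1 : γ ≤ 1)
    (hTe1 : 1 / 2 * ((T : ℝ) ^ (2 / 3 : ℝ) * ((d : ℝ) * k) ^ (1 / 3 : ℝ)) ≤ Te)
    (hTe2 : (Te : ℝ) ≤ 2 * ((T : ℝ) ^ (2 / 3 : ℝ) * ((d : ℝ) * k) ^ (1 / 3 : ℝ))) {ce cr : ℝ}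
    (hce : 0 ≤ ce) (hcr : 0 ≤ cr)
    (hL : ∀ S Λ, Regime n d k T Te S Λ → ∃ e r : ℝ, 0 ≤ e ∧ 0 ≤ r ∧ T * e ≤ ce ∧
      T * r ≤ cr * (Λ ^ 2 * S * √m) ∧
      ∀ t i, Te < t → t ≤ T → LabelBound P I ξ Fhat t i (2 * (KC + Kμ)) e r) :
    ∫ ω, excessCost I π ξ A T ω ∂P ≤
      regretConst (2 * (KC + Kμ)) ce cr (Real.exp ((I.σ : ℝ) ^ 2 + 1 + |Kμ|) ^ 2) *
        (1 + Real.log (n * T / γ)) ^ 2 *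
          (n * ((d : ℝ) * k) ^ (1 / 3 : ℝ) * (m : ℝ) ^ (1 / 2 : ℝ) * (T : ℝ) ^ (2 / 3 : ℝ)) := by
  set B := 2 * (KC + Kμ) with hB
  set C₀ := Real.exp ((I.σ : ℝ) ^ 2 + 1 + |Kμ|) ^ 2 with hC₀
  set S := (T : ℝ) ^ (2 / 3 : ℝ) * ((d : ℝ) * k) ^ (1 / 3 : ℝ) with hS
  set Λ := 1 + Real.log (n * T / γ) with hΛ
  have hC₀0 : 0 ≤ C₀ := by positivity
  have hB0 : 0 ≤ B := by
    have := hI.nonneg (w0 ⟨0, hn⟩)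
    positivity
  have hdk := hb.card_le
  have hn' : (1 : ℝ) ≤ n := by exact_mod_cast hn
  have hm' : (1 : ℝ) ≤ m := by exact_mod_cast hm
  have hd' : (1 : ℝ) ≤ d := by exact_mod_cast hd
  have hk' : (1 : ℝ) ≤ k := by exact_mod_cast hd.trans hdk
  have hT' : (1 : ℝ) ≤ T := by exact_mod_cast hT
  have hsm : 1 ≤ √(m : ℝ) := Real.one_le_sqrt.2 hm'
  have hnT : 1 ≤ (n : ℝ) * T := one_le_mul_of_one_le_of_one_le hn' hT'
  have hnTγ : (n : ℝ) * T ≤ n * T / γ := le_div_self (by positivity) hγ hγ1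
  have hlog : Real.log (n * T) ≤ Real.log (n * T / γ) := Real.log_le_log (by positivity) hnTγ
  have hΛ1 : 1 ≤ Λ := by
    have := Real.log_nonneg hnT
    linarith
  have hS1 : 1 ≤ S := one_le_mul_of_one_le_of_one_le (Real.one_le_rpow hT' (by norm_num))
    (Real.one_le_rpow (one_le_mul_of_one_le_of_one_le hd' hk') (by norm_num))
  have hone : 1 ≤ Λ ^ 2 * √m := one_le_mul_of_one_le_of_one_le (one_le_pow₀ hΛ1) hsm
  have hX : S ≤ Λ ^ 2 * S * √m := by
    calc S ≤ S * (Λ ^ 2 * √m) := le_mul_of_one_le_right (by linarith) hone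
      _ = _ := by ring
  have hX1 : 1 ≤ Λ ^ 2 * S * √m := hS1.trans hX
  suffices hsuff : ∀ i, ∑ t ∈ Finset.Icc 1 T, ∫ ω, gap I π ξ A t i ω ∂P ≤
      regretConst B ce cr C₀ * (Λ ^ 2 * S * √m) by
    rw [(h.integral_excessCost hI hπ T).2, Finset.sum_comm]
    refine (Finset.sum_le_sum fun i _ => hsuff i).trans (le_of_eq ?_)
    rw [Finset.sum_const, Finset.card_univ, Fintype.card_fin, nsmul_eq_mul, hS, Real.sqrt_eq_rpow]
    ring
  intro i
  rcases le_or_gt T Te with hTTe | hTTe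
  · have h1 : ∑ t ∈ Finset.Icc 1 T, ∫ ω, gap I π ξ A t i ω ∂P ≤ ∑ t ∈ Finset.Icc 1 T, B := by
      refine Finset.sum_le_sum fun t _ => ?_
      have h2 := integral_mono_ae (h.integrable_gap hI hπ t i) (integrable_const B)
        ((h.gap_mem hI hπ t i).mono fun ω hω => hω.2)
      simpa using h2
    rw [Finset.sum_const, Nat.card_Icc, Nat.add_sub_cancel, nsmul_eq_mul] at h1
    have h2 : (T : ℝ) ≤ Te := by exact_mod_cast hTTe
    refine h1.trans ?_
    calc T * B ≤ 2 * S * B := by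
          gcongr
          exact h2.trans hTe2
      _ = 2 * B * S := by ring
      _ ≤ regretConst B ce cr C₀ * (Λ ^ 2 * S * √m) := by
          refine mul_le_mul ?_ hX (by linarith) ?_
          · unfold regretConst
            have h3 : 0 ≤ B * ce := by positivity
            have h4 : 0 ≤ B * (2 * C₀) := by positivity
            linarith
          · unfold regretConst
            positivity
  · have hTTe' : (Te : ℝ) < T := by exact_mod_cast hTTe
    have hSpow : S ^ 3 = d * k * (T : ℝ) ^ 2 := by
      rw [hS, mul_pow, ← Real.rpow_natCast, ← Real.rpow_natCast (_ ^ (1 / 3 : ℝ)),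
        ← Real.rpow_mul (by positivity), ← Real.rpow_mul (by positivity)]
      norm_num
      ring
    have hreg : Regime n d k T Te S Λ := by
      refine ⟨hn, hd, hT, hdk, ?_, hS1, hSpow, by linarith, by linarith⟩
      -- From S ≤ 2T̃ < 2T; cancelling T² in the cubes gives d k ≤ 8T.
      have h1 : S ^ 3 ≤ (2 * T) ^ 3 := pow_le_pow_left₀ (by linarith) (by linarith) 3
      rw [hSpow] at h1
      have h2 : (0 : ℝ) < (T : ℝ) ^ 2 := by positivity
      refine le_of_mul_le_mul_right ?_ h2
      linarith [h1]
    obtain ⟨e, r, he, hr, hTe, hTr, hLB⟩ := hL S Λ hreg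
    have hmain := h.sum_integral_gap_le hI hb hd hn hγ hγ1 hπ T i
      (R := 16 * √d * Λ) (fun t ht => sqrt_radius_le hn hd hγ hγ1 ht) he hr
      (fun t h1 h2 => hLB t i h1 h2)
    rw [← hB, ← hC₀] at hmain
    refine hmain.trans ?_
    have h1 : B * Te ≤ 2 * B * (Λ ^ 2 * S * √m) := by
      calc B * Te ≤ B * (2 * S) := mul_le_mul_of_nonneg_left hTe2 hB0
        _ = 2 * B * S := by ring
        _ ≤ _ := mul_le_mul_of_nonneg_left hX (by positivity)
    have h2 : T * (B * e + r) ≤ (B * ce + cr) * (Λ ^ 2 * S * √m) := by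
      have h3 : B * (T * e) ≤ B * ce * (Λ ^ 2 * S * √m) :=
        (mul_le_mul_of_nonneg_left hTe hB0).trans (le_mul_of_one_le_right (by positivity) hX1)
      linarith
    have h3 : B * (2 * C₀) ≤ B * (2 * C₀) * (Λ ^ 2 * S * √m) :=
      le_mul_of_one_le_right (by positivity) hX1
    have h4 : (B + 2 * (16 * √d * Λ)) * (√T * √(2 * (d * Real.log (T + 1)))) ≤
        4 * (B + 32) * (Λ ^ 2 * S * √m) :=
      (hreg.optimism_le hB0).trans (mul_le_mul_of_nonneg_left
        (le_mul_of_one_le_right (by positivity) hsm) (by positivity))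
    unfold regretConst
    linarith

end Assembly

end BanditDDO

end

theorem mainTheorem6 :
    ∃ p : ℕ, ∀ (mode : BanditDDO.Training) (σ : ℝ≥0) (KC Kμ KX κ : ℝ), 0 < κ →
    ∃ C : ℝ, ∀ (n m d k T Te : ℕ) (γ : ℝ),
      1 ≤ n → 1 ≤ m → 1 ≤ d → 1 ≤ T → 0 < γ → γ ≤ 1 →
      1 / 2 * ((T : ℝ) ^ (2 / 3 : ℝ) * ((d : ℝ) * k) ^ (1 / 3 : ℝ)) ≤ Te →
      (Te : ℝ) ≤ 2 * ((T : ℝ) ^ (2 / 3 : ℝ) * ((d : ℝ) * k) ^ (1 / 3 : ℝ)) →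
    ∀ (I : BanditDDO.Problem m d k), I.σ = σ → I.IsBounded KC Kμ →
      (mode = BanditDDO.Training.retrain → BanditDDO.IsRegularDesign I.D KX κ) →
    ∀ (b : Fin d → BanditDDO.Vec d), BanditDDO.IsBarycentricSpanner I.act b →
    ∀ (w0 : Fin n → Fin k) (π : BanditDDO.Vec m → Fin k), I.IsOptimalPolicy π →
    ∀ (Ω : Type*) [MeasurableSpace Ω] (P : Measure Ω) [IsProbabilityMeasure P]
      (ξ : ℕ → Fin n → Ω → BanditDDO.Vec m × BanditDDO.Vec d × ℝ)
      (A : ℕ → Fin n → Ω → Fin k)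
      (Fhat : ℕ → Ω → Fin k → BanditDDO.Vec m →L[ℝ] BanditDDO.Vec d),
      BanditDDO.IsRun P I b w0 γ Te mode ξ A Fhat →
      Integrable (BanditDDO.excessCost I π ξ A T) P ∧
      ∫ ω, BanditDDO.excessCost I π ξ A T ω ∂P ≤
        C * (1 + Real.log (n * T / γ)) ^ p *
          (n * ((d : ℝ) * k) ^ (1 / 3 : ℝ) * (m : ℝ) ^ (1 / 2 : ℝ) * (T : ℝ) ^ (2 / 3 : ℝ)) := by
  -- Two logarithms suffice: optimism takes one for the radius and at most one for the potential,
  -- frozen predictions one for the noise level and at most one for the blocks.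
  refine ⟨2, fun mode σ KC Kμ KX κ hκ => ?_⟩
  cases mode with
  | frozen =>
    refine ⟨BanditDDO.regretConst (2 * (KC + Kμ)) 2 (12 * (2 * (KC + Kμ) + 8 + (σ : ℝ) ^ 2))
      (Real.exp ((σ : ℝ) ^ 2 + 1 + |Kμ|) ^ 2), ?_⟩
    intro n m d k T Te γ hn hm hd hT hγ hγ1 hTe1 hTe2 I hσ hI _ b hb w0 π hπ Ω _ P _ ξ A Fhat h
    subst hσ
    have hB : 0 ≤ 2 * (KC + Kμ) := mul_nonneg (by norm_num) (hI.nonneg (w0 ⟨0, hn⟩))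
    refine ⟨(h.integral_excessCost hI hπ T).1, h.integral_excessCost_le hI hb hπ hn hm hd hT hγ hγ1
      hTe1 hTe2 (by norm_num) (by positivity) fun S Λ hreg => ?_⟩
    obtain ⟨e, r, he, hr, h1, h2, h3⟩ := h.exists_labelBound_frozen hreg hI hm hB
    exact ⟨e, r, he, hr, h1, h2, fun t i ht _ => h3 t i ht⟩
  | retrain =>
    refine ⟨BanditDDO.regretConst (2 * (KC + Kμ)) (2 * (KX ^ 2 / κ) ^ 2 + 1)
      (2 * (KC + Kμ) * (1 + 2 * (1 + 2 / κ + 3 * (8 * KX ^ 8 / κ ^ 4))) +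
        8 * KX / √κ * √(2 * ((σ : ℝ) ^ 2 + 1) * (3 + KX ^ 2 / κ * (1 + KX ^ 2))))
      (Real.exp ((σ : ℝ) ^ 2 + 1 + |Kμ|) ^ 2), ?_⟩
    intro n m d k T Te γ hn hm hd hT hγ hγ1 hTe1 hTe2 I hσ hI hD b hb w0 π hπ Ω _ P _ ξ A Fhat h
    subst hσ
    have hD' := hD rfl
    have := hI.isProbabilityMeasure
    have hKX := hD'.nonneg
    have hB : 0 ≤ 2 * (KC + Kμ) := mul_nonneg (by norm_num) (hI.nonneg (w0 ⟨0, hn⟩))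
    exact ⟨(h.integral_excessCost hI hπ T).1, h.integral_excessCost_le hI hb hπ hn hm hd hT hγ hγ1
      hTe1 hTe2 (by positivity) (by positivity) fun S Λ hreg =>
        h.exists_labelBound_retrain hreg hI hD' hκ hm hB⟩
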